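/- **Setting.** Let $L_0\ge 1$, $L_{\max}=2L_0-1$, $d\ge 2L_{\max}$. The letter $\texttt a$ (resp. $\texttt b$) at position $\ell$ is embedded as $E_\ell^{\texttt a}=e_{2\ell-1}$ (resp. $E_\ell^{\texttt b}=e_{2\ell}$) in $\mathbb R^d$. For a binary sequence $X=[x_1,\dots,x_L]$ of embedded letters and parameters $u\in\mathbb R^d$, $W\in\mathbb R^{d\times d}$, with scaling $\lambda>0$, put $\varphi_\ell=[\mathrm{softmax}(X^\top W x_L/\lambda)]_\ell$ and $\mathtt T_{u,W}(X)=u^\top\sum_{\ell=1}^L x_\ell\varphi_\ell$. Let $I_L=\{\texttt a,\texttt b\}^L$. The label $y$ of a sequence of length $L$ is $1$ if its last letter equals its letter at position $\ell_0(L)$, and $-1$ otherwise, where $\ell_0(L)=1$ for $L<L_0$ (even pairs) and $\ell_0(L)=L-L_0+1$ for $L_0\le L\le L_{\max}$ (chain-of-thought steps of parity check). The training loss (chain-of-thought loss, $L\ge L_0$, plus even-pairs regularization, $L<L_0$) is $$\mathcal L(u,W)=\sum_{L=1}^{L_{\max}}\frac1{|I_L|}\sum_{X\in I_L}\log\bigl(1+e^{-y\,\mathtt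 T_{u,W}(X)}\bigr).$$ Two-phase gradient descent starts at $(u_0,W_0)=(0,0)$ and takes $u_{t+1}=u_t-\eta\nabla_u\mathcal L(u_t,W_t)$ and $W_{t+1}=W_t-\eta_t\nabla_W\mathcal L(u_t,W_t)$ with $\eta_t=\eta\lambda$ for $t\le t_0$ and $\eta_t=\eta$ for $t>t_0$. Let $u^*_{CoT}$ be the vector $u$ of least norm with $\langle u,\,y\sum_\ell x_\ell\varphi_\ell\rangle\ge 1$ for all training sequences $X$ of length $1\le L\le L_{\max}$, where $\varphi_\ell$ is computed with $W=W_{t_0}$. Norms of vectors are Euclidean, norms of matrices are Frobenius norms. **Theorem.** There are absolute constants $C_\lambda,c_0,c_T,C_T,C_W>0$ with $c_T\le C_T$, for every $\varepsilon>0$ a constant $c_u>0$ (depending only on $\varepsilon$), and for every $\varepsilon>0$ and $L_0\ge1$ a constant $K>0$ (depending only on $\varepsilon,L_0$), such that the following holds for all $d\ge 2L_{\max}$, $\lambda\ge C_\lambda L_{\max}^2$, $\eta>0$ and all integers $t_0$ with $2\le t_0\le c_0/(\eta L_{\max})$. The max-margin solution $u^*_{CoT}$ exists, and there are $t_2,T$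 with $$1\le t_2\le K\eta^{-(1+\varepsilon)},\qquad c_T\,\frac{\lambda^{2/3}}{\eta L_{\max}}\le T\le C_T\,\frac{\lambda^{2/3}}{\eta L_{\max}},$$ such that for all integers $t$ with $t_2\le t\le T$: - $\|u_t\|\ge c_u\log t$; - $\displaystyle\Bigl\langle\frac{u_t}{\|u_t\|},\frac{u^*_{CoT}}{\|u^*_{CoT}\|}\Bigr\rangle\ge 1-\frac12\Bigl(\frac1{6\|u^*_{CoT}\|}-\frac1{\|u_t\|}\Bigr)^2$; - $\|W_t-W_{t_0}\|\le C_W$. -/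

import Mathlib

namespace ParityCoT

/-- Vectors of `ℝ^d` with the Euclidean norm. -/
abbrev Vec (d : ℕ) : Type := EuclideanSpace ℝ (Fin d)

/-- Real `d × d` matrices; the norm of this space is the Frobenius norm and its inner product is
the trace inner product. -/
abbrev Mat (d : ℕ) : Type := EuclideanSpace ℝ (Fin d × Fin d)

/-- Tokens: `false` is the letter a and `true` is the letter b. -/
abbrev Token : Type := Bool

/-- Binary sequences of length `m + 1`. Positions are numbered from `0` here, so the usual
position `ℓ ≥ 1` is the index `ℓ - 1`. The set of all of them is the data set `I_L`, `L = m + 1`. -/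
abbrev Seq (m : ℕ) : Type := Fin (m + 1) → Token

/-- Embedding of a token at (zero-based) position `p`: the basis vector with (zero-based) number
`2 p` for the letter a and `2 p + 1` for the letter b. -/
noncomputable def embed (d p : ℕ) (w : Token) : Vec d :=
  WithLp.toLp 2 fun i => if (i : ℕ) = 2 * p + w.toNat then 1 else 0

/-- The embedded token `x_ℓ` of the sequence `X`. -/
noncomputable def tok (d : ℕ) {m : ℕ} (X : Seq m) (i : Fin (m + 1)) : Vec d :=
  embed d i (X i)

/-- The bilinear form `xᵀ W y`. -/
noncomputable def bilin {d : ℕ} (W : Mat d) (x y : Vec d) : ℝ :=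
  ∑ i, ∑ j, x i * W (i, j) * y j

/-- The softmax function. -/
noncomputable def softmax {k : ℕ} (v : Fin k → ℝ) (i : Fin k) : ℝ :=
  Real.exp (v i) / ∑ j, Real.exp (v j)

/-- Attention weights `φ_ℓ = [softmax (Xᵀ W x_L / λ)]_ℓ`, with `x_L` the last token of `X`. -/
noncomputable def attnWeight {d m : ℕ} (lam : ℝ) (W : Mat d) (X : Seq m) : Fin (m + 1) → ℝ :=
  softmax fun i => bilin W (tok d X i) (tok d X (Fin.last m)) / lam

/-- Output of the attention layer, `∑_ℓ x_ℓ φ_ℓ`. -/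
noncomputable def attnOut {d m : ℕ} (lam : ℝ) (W : Mat d) (X : Seq m) : Vec d :=
  ∑ i, attnWeight lam W X i • tok d X i

/-- The one-layer transformer `T_θ(X) = uᵀ ∑_ℓ x_ℓ φ_ℓ`, `θ = (u, W)`. -/
noncomputable def transformer {d m : ℕ} (lam : ℝ) (u : Vec d) (W : Mat d) (X : Seq m) : ℝ :=
  inner ℝ u (attnOut lam W X)

/-- Even-pairs label: `1` if the last token equals the first one, `-1` otherwise. -/
noncomputable def evenPairsLabel {m : ℕ} (X : Seq m) : ℝ :=
  if X (Fin.last m) = X 0 then 1 else -1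

/-- Chain-of-thought label for a sequence of length `L = m + 1 ≥ L₀ ≥ 1`: `1` if the last token
equals the token at position `L - L₀ + 1` (zero-based index `m - (L₀ - 1)`), `-1` otherwise. -/
noncomputable def cotLabel (L₀ : ℕ) {m : ℕ} (X : Seq m) : ℝ :=
  if X (Fin.last m) = X ⟨m - (L₀ - 1), by omega⟩ then 1 else -1

/-- Logistic loss `log (1 + exp (-z))`. -/
noncomputable def logistic (z : ℝ) : ℝ := Real.log (1 + Real.exp (-z))

/-- The chain-of-thought loss: lengths `L = m + 1` with `L₀ ≤ L ≤ 2 L₀ - 1`. -/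
noncomputable def lossCoT (d L₀ : ℕ) (lam : ℝ) (u : Vec d) (W : Mat d) : ℝ :=
  ∑ m ∈ Finset.Ico (L₀ - 1) (2 * L₀ - 1),
    (1 / (Fintype.card (Seq m) : ℝ)) *
      ∑ X : Seq m, logistic (cotLabel L₀ X * transformer lam u W X)

/-- The even-pairs regularization loss: lengths `L = m + 1` with `1 ≤ L ≤ L₀ - 1`. -/
noncomputable def lossReg (d L₀ : ℕ) (lam : ℝ) (u : Vec d) (W : Mat d) : ℝ :=
  ∑ m ∈ Finset.range (L₀ - 1),
    (1 / (Fintype.card (Seq m) : ℝ)) *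
      ∑ X : Seq m, logistic (evenPairsLabel X * transformer lam u W X)

/-- The total training loss. -/
noncomputable def lossParity (d L₀ : ℕ) (lam : ℝ) (u : Vec d) (W : Mat d) : ℝ :=
  lossCoT d L₀ lam u W + lossReg d L₀ lam u W

/-- Two-phase gradient descent from zero initialization: the linear layer always has step size
`η`; the attention layer has step size `η λ` at the steps `t ≤ t₀` and `η` afterwards. The value at
`t` is the pair `(u_t, W_t)`. -/
noncomputable def train (d L₀ : ℕ) (lam η : ℝ) (t₀ : ℕ) : ℕ → Vec d × Mat d
  | 0 => (0, 0)
  | t + 1 =>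
    let θ := train d L₀ lam η t₀ t
    (θ.1 - η • gradient (fun u => lossParity d L₀ lam u θ.2) θ.1,
      θ.2 - (if t ≤ t₀ then η * lam else η) • gradient (fun W => lossParity d L₀ lam θ.1 W) θ.2)

/-- The label of a training sequence: even pairs if its length `m + 1` is less than `L₀`, chain of
thought otherwise. -/
noncomputable def label (L₀ : ℕ) {m : ℕ} (X : Seq m) : ℝ :=
  if m + 1 < L₀ then evenPairsLabel X else cotLabel L₀ X

/-- `u` classifies the attention outputs (with attention matrix `W`) of all training sequences,
of length `1 ≤ L ≤ 2 L₀ - 1`, with margin at least `1`. -/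
def HasUnitMargin {d : ℕ} (L₀ : ℕ) (lam : ℝ) (W : Mat d) (u : Vec d) : Prop :=
  ∀ m < 2 * L₀ - 1, ∀ X : Seq m, 1 ≤ inner ℝ u (label L₀ X • attnOut lam W X)

/-- `u` is the max-margin solution: it has the least norm among all vectors of margin at least
`1`. -/
def IsMaxMargin {d : ℕ} (L₀ : ℕ) (lam : ℝ) (W : Mat d) (u : Vec d) : Prop :=
  HasUnitMargin L₀ lam W u ∧ ∀ v : Vec d, HasUnitMargin L₀ lam W v → ‖u‖ ≤ ‖v‖

end ParityCoT

open ParityCoT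

namespace ParityCoT

/-! Write `N = 2 * L₀ - 1` and `x = λ^(1/3)`. Because `λ` is large and `W` stays bounded, attention
remains uniform up to a relative error of order `1/λ`. Both `u_t` and the max-margin vector then
point nearly along one fixed unit vector, `linVec d N limitDir`, equal to `1/2` on both letters of
the first position and `-1/2` on both letters of the second. The theorem compares each of them with
this vector.

Reduction. The data are invariant under exchanging the two letters, so training keeps `u` equal on
the two letters of a position and keeps each attention score a function of the label, which matters
only at the key position (`isReduced_train`). Gradient descent becomes a recursion for position
values `v p` and scores `S m p y`.

Separability. With uniform attention the two labels cancel for every length above one; length one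
alone pushes `v 0` up, while the other values stay small (`redTrain_fst_bounds`). A dominant `v 0`
moves the key scores of the two labels apart (`scoresSeparate_redTrain`), and this suffices to
construct a separator (`ScoresSeparate.exists_separator`). Hence a max-margin vector exists.

Max-margin direction. Under nearly uniform attention both labels see almost the same output, namely
the prefix sum of `v` divided by the length. Outputs at least `1` and at most `-1` therefore force
the norm to be at least `λ/4` and the prefix sums to be small relative to the norm
(`NearUniform.margin_bounds`).

Trained direction. With `W = 0` the loss is convex in `u`; its infimum `(N - 1) log 2` is approached
along the limit direction but not attained. Training is gradient descent on it with perturbed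
gradients, so the excess loss is `O(N⁴/√(ηt))` (`excess_loss_train_le`). A small excess forces `v 0
≥ log(ηt)/4` and small prefix sums (`train_late`).

Conclusion. Since `‖u_t‖² ≤ ηNt`, up to time `x²/(ηN)` one has `‖u_t‖ ≤ x`, and `W` moves by `O(1)`.
Each direction lies within `1/(4‖u_t‖)` of the limit one, and `1/(6‖u*‖) ≤ 1/(2‖u_t‖)`, which gives
the alignment bound. For `L₀ = 1` the two directions coincide. -/

/-! ### Calculus of the logistic loss. -/

/-- The negative derivative of the logistic loss. -/
noncomputable def logSlope (x : ℝ) : ℝ := 1 / (1 + Real.exp x)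

lemma logSlope_pos (x : ℝ) : 0 < logSlope x := by unfold logSlope; positivity

lemma logSlope_le_one (x : ℝ) : logSlope x ≤ 1 := by
  unfold logSlope
  rw [div_le_one (by positivity)]
  linarith [Real.exp_pos x]

lemma hasDerivAt_logistic (x : ℝ) : HasDerivAt logistic (-logSlope x) x := by
  have h1 : HasDerivAt (fun z : ℝ => Real.log (1 + Real.exp (-z)))
      ((Real.exp (-x) * (-1)) / (1 + Real.exp (-x))) x :=
    (((hasDerivAt_id x).neg.exp).const_add 1).log (by positivity)
  refine h1.congr_deriv ?_
  unfold logSlope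
  rw [Real.exp_neg]
  have := Real.exp_pos x
  field_simp
  ring

lemma logSlope_sub_le (x y : ℝ) : |logSlope x - logSlope y| ≤ 1 / 4 * |x - y| := by
  have h : ∀ z ∈ (Set.univ : Set ℝ), HasDerivWithinAt logSlope
      (-Real.exp z / (1 + Real.exp z) ^ 2) Set.univ z := by
    intro z _
    have : HasDerivAt (fun z : ℝ => (1 + Real.exp z)⁻¹) (-Real.exp z / (1 + Real.exp z) ^ 2) z :=
      ((Real.hasDerivAt_exp z).const_add 1).inv (by positivity)
    have e : logSlope = fun z : ℝ => (1 + Real.exp z)⁻¹ := by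
      funext z; simp [logSlope]
    rw [e]
    exact this.hasDerivWithinAt
  have hb : ∀ z ∈ (Set.univ : Set ℝ), ‖-Real.exp z / (1 + Real.exp z) ^ 2‖ ≤ 1 / 4 := by
    intro z _
    have := Real.exp_pos z
    rw [norm_div, norm_neg, Real.norm_of_nonneg this.le, Real.norm_of_nonneg (by positivity),
      div_le_iff₀ (by positivity)]
    nlinarith [sq_nonneg (1 - Real.exp z)]
  have := convex_univ.norm_image_sub_le_of_norm_hasDerivWithin_le h hb
    (Set.mem_univ y) (Set.mem_univ x)
  simpa [Real.norm_eq_abs] using this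

lemma logSlope_zero : logSlope 0 = 1 / 2 := by norm_num [logSlope]

/-- For `x ≥ 0`, the bound `exp x ≥ 1 + x + x²/2` gives `1 + exp x - 3x ≥ (x - 2)²/2`. This limits
the outward component of a gradient step and so yields square-root growth of `‖u_t‖`. -/
lemma mul_logSlope_le (x : ℝ) : x * logSlope x ≤ 1 / 3 := by
  unfold logSlope
  rw [mul_one_div, div_le_iff₀ (by positivity)]
  rcases le_total x 0 with h | h
  · have := Real.exp_pos x
    linarith
  · nlinarith [Real.quadratic_le_exp_of_nonneg h, sq_nonneg (x - 2)]

lemma logistic_convex (x y : ℝ) : logistic x - logSlope x * (y - x) ≤ logistic y := by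
  have hp := logSlope_pos x
  have h1 : (0 : ℝ) < 1 + Real.exp (-x) := by positivity
  have h2 : (0 : ℝ) < 1 + Real.exp (-y) := by positivity
  -- With `p = logSlope x`, the ratio `(1 + exp(-y)) / (1 + exp(-x))` equals `p exp(-(y - x)) + (1 -
  -- p)`; Jensen bounds it below by `exp(-p (y - x))`, and logarithms finish.
  have hc := convexOn_exp.2 (Set.mem_univ (-(y - x))) (Set.mem_univ (0 : ℝ)) hp.le
    (sub_nonneg.2 (logSlope_le_one x)) (by ring)
  simp only [smul_eq_mul, mul_zero, add_zero, Real.exp_zero, mul_one] at hc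
  have hr : logSlope x * Real.exp (-(y - x)) + (1 - logSlope x)
      = (1 + Real.exp (-y)) / (1 + Real.exp (-x)) := by
    unfold logSlope
    rw [neg_sub, Real.exp_sub, Real.exp_neg, Real.exp_neg]
    have := Real.exp_pos x
    have := Real.exp_pos y
    field_simp
    ring
  rw [hr, ← Real.le_log_iff_exp_le] at hc
  · rw [Real.log_div h2.ne' h1.ne'] at hc
    unfold logistic
    linarith
  · positivity

lemma logistic_nonneg (x : ℝ) : 0 ≤ logistic x :=
  Real.log_nonneg (by linarith [Real.exp_pos (-x)])

/-! ### Softmax: distance from the uniform weights, and derivative. -/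

section Softmax

variable {k : ℕ}

lemma softmax_pos (v : Fin k → ℝ) (i : Fin k) : 0 < softmax v i := by
  unfold softmax
  have : Nonempty (Fin k) := ⟨i⟩
  have : 0 < ∑ j, Real.exp (v j) :=
    Finset.sum_pos (fun j _ => Real.exp_pos _) Finset.univ_nonempty
  positivity

lemma softmax_sum [NeZero k] (v : Fin k → ℝ) : ∑ i, softmax v i = 1 := by
  unfold softmax
  rw [← Finset.sum_div]
  have : 0 < ∑ j, Real.exp (v j) :=
    Finset.sum_pos (fun j _ => Real.exp_pos _) Finset.univ_nonempty
  exact div_self this.ne'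

/-- Each weight lies between `exp(-2r)/k` and `exp(2r)/k`; the condition `r ≤ 1/4` allows both
factors to be linearised. -/
lemma softmax_sub_le [NeZero k] (v : Fin k → ℝ) {r : ℝ} (hr : r ≤ 1 / 4) (hv : ∀ i, |v i| ≤ r)
    (i : Fin k) : |softmax v i - 1 / (k : ℝ)| ≤ 4 * r / k := by
  have hk : (0 : ℝ) < k := by exact_mod_cast Nat.pos_of_ne_zero (NeZero.ne k)
  have hr0 : 0 ≤ r := (abs_nonneg _).trans (hv i)
  have hup : ∀ j, Real.exp (v j) ≤ Real.exp r := fun j => Real.exp_le_exp.2 (abs_le.1 (hv j)).2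
  have hlo : ∀ j, Real.exp (-r) ≤ Real.exp (v j) := fun j => Real.exp_le_exp.2 (abs_le.1 (hv j)).1
  have hS1 : (k : ℝ) * Real.exp (-r) ≤ ∑ j, Real.exp (v j) := by
    have := Finset.card_nsmul_le_sum (Finset.univ : Finset (Fin k)) _ _ (fun j _ => hlo j)
    simpa using this
  have hS2 : ∑ j, Real.exp (v j) ≤ (k : ℝ) * Real.exp r := by
    have := Finset.sum_le_card_nsmul (Finset.univ : Finset (Fin k)) _ _ (fun j _ => hup j)
    simpa using this
  have hS : 0 < ∑ j, Real.exp (v j) := lt_of_lt_of_le (by positivity) hS1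
  have he : Real.exp (2 * r) ≤ 1 + 4 * r := by
    have hb := Real.abs_exp_sub_one_sub_id_le (x := 2 * r) (by rw [abs_le]; constructor <;> linarith)
    have := (abs_le.1 hb).2
    nlinarith
  have he' : 1 - 2 * r ≤ Real.exp (-(2 * r)) := by
    have := Real.add_one_le_exp (-(2 * r)); linarith
  have hE : Real.exp r = Real.exp (2 * r) * Real.exp (-r) := by
    rw [← Real.exp_add]; ring_nf
  have hE' : Real.exp (-r) = Real.exp (-(2 * r)) * Real.exp r := by
    rw [← Real.exp_add]; ring_nf
  unfold softmax
  rw [abs_le]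
  constructor
  · have : (1 - 4 * r) / k ≤ Real.exp (v i) / ∑ j, Real.exp (v j) := by
      rw [div_le_div_iff₀ hk hS]
      calc (1 - 4 * r) * ∑ j, Real.exp (v j) ≤ (1 - 2 * r) * ∑ j, Real.exp (v j) := by
            exact mul_le_mul_of_nonneg_right (by linarith) hS.le
        _ ≤ Real.exp (-(2 * r)) * ((k : ℝ) * Real.exp r) :=
            mul_le_mul he' hS2 hS.le (Real.exp_pos _).le
        _ = k * Real.exp (-r) := by rw [hE']; ring
        _ ≤ k * Real.exp (v i) := mul_le_mul_of_nonneg_left (hlo i) hk.le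
        _ = _ := by ring
    have e : (1 - 4 * r) / k = 1 / k - 4 * r / k := by ring
    linarith
  · have : Real.exp (v i) / ∑ j, Real.exp (v j) ≤ (1 + 4 * r) / k := by
      rw [div_le_div_iff₀ hS hk]
      calc Real.exp (v i) * k ≤ Real.exp r * k := mul_le_mul_of_nonneg_right (hup i) hk.le
        _ = Real.exp (2 * r) * (k * Real.exp (-r)) := by rw [hE]; ring
        _ ≤ (1 + 4 * r) * ∑ j, Real.exp (v j) := by gcongr
    have e : (1 + 4 * r) / k = 1 / k + 4 * r / k := by ring
    linarith

lemma hasFDerivAt_softmax_sum [NeZero k] {E : Type*} [NormedAddCommGroup E] [NormedSpace ℝ E]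
    (s : Fin k → E → ℝ) (s' : Fin k → E →L[ℝ] ℝ) (x : E) (hs : ∀ i, HasFDerivAt (s i) (s' i) x)
    (c : Fin k → ℝ) :
    HasFDerivAt (fun z => ∑ i, softmax (fun j => s j z) i * c i)
      (∑ i, (softmax (fun j => s j x) i * (c i - ∑ j, softmax (fun j => s j x) j * c j)) • s' i)
      x := by
  have hden : 0 < ∑ j, Real.exp (s j x) :=
    Finset.sum_pos (fun j _ => Real.exp_pos _) Finset.univ_nonempty
  have h1 : HasFDerivAt (fun z => ∑ i, Real.exp (s i z)) (∑ i, Real.exp (s i x) • s' i) x :=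
    HasFDerivAt.fun_sum fun i _ => (hs i).exp
  have h2 : HasFDerivAt (fun z => ∑ i, Real.exp (s i z) * c i)
      (∑ i, c i • (Real.exp (s i x) • s' i)) x :=
    HasFDerivAt.fun_sum fun i _ => (hs i).exp.mul_const (c i)
  have h3 := (hasDerivAt_inv hden.ne').comp_hasFDerivAt x h1
  have h4 := h3.mul h2
  have e : (fun z => ∑ i, softmax (fun j => s j z) i * c i) =
      (fun z => (Inv.inv ∘ fun z => ∑ i, Real.exp (s i z)) z * ∑ i, Real.exp (s i z) * c i) := by
    funext z
    simp only [softmax, Function.comp, Finset.mul_sum]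
    refine Finset.sum_congr rfl fun i _ => by ring
  rw [e]
  refine h4.congr_fderiv ?_
  ext w
  simp only [softmax, Function.comp, add_apply, smul_apply, sum_apply, smul_eq_mul]
  have e2 : ∑ j, Real.exp (s j x) / (∑ j, Real.exp (s j x)) * c j =
      (∑ j, Real.exp (s j x))⁻¹ * ∑ j, Real.exp (s j x) * c j := by
    rw [Finset.mul_sum]; refine Finset.sum_congr rfl fun i _ => by ring
  rw [e2]
  set D := ∑ j, Real.exp (s j x)
  set Nn := ∑ j, Real.exp (s j x) * c j
  simp only [Finset.mul_sum, ← Finset.sum_add_distrib]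
  refine Finset.sum_congr rfl fun i _ => ?_
  field_simp
  ring

end Softmax

/-! ### Averages over sequences, embeddings and attention outputs. -/

/-- Average over all sequences of a given length. -/
noncomputable def seqAvg {E : Type*} [AddCommGroup E] [Module ℝ E] (m : ℕ) (f : Seq m → E) : E :=
  (1 / (Fintype.card (Seq m) : ℝ)) • ∑ X, f X

lemma card_seq_pos (m : ℕ) : (0 : ℝ) < Fintype.card (Seq m) := by
  exact_mod_cast Fintype.card_pos

lemma norm_seqAvg_le {E : Type*} [NormedAddCommGroup E] [NormedSpace ℝ E] {m : ℕ}
    {f : Seq m → E} {C : ℝ} (h : ∀ X, ‖f X‖ ≤ C) : ‖seqAvg m f‖ ≤ C := by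
  have hc := card_seq_pos m
  unfold seqAvg
  rw [norm_smul, Real.norm_of_nonneg (by positivity), div_mul_eq_mul_div, one_mul,
    div_le_iff₀ hc]
  calc ‖∑ X, f X‖ ≤ ∑ X : Seq m, C := norm_sum_le_of_le _ fun X _ => h X
    _ = C * Fintype.card (Seq m) := by simp [mul_comm]

lemma seqAvg_mono {m : ℕ} {f g : Seq m → ℝ} (h : ∀ X, f X ≤ g X) : seqAvg m f ≤ seqAvg m g := by
  have hc := card_seq_pos m
  unfold seqAvg
  simp only [smul_eq_mul]
  gcongr with X
  exact h X

lemma seqAvg_const {m : ℕ} (c : ℝ) : seqAvg m (fun _ => c) = c := by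
  have hc := card_seq_pos m
  simp only [seqAvg, Finset.sum_const, Finset.card_univ, nsmul_eq_mul, smul_eq_mul]
  field_simp

lemma seqAvg_sub {E : Type*} [AddCommGroup E] [Module ℝ E] {m : ℕ} (f g : Seq m → E) :
    seqAvg m (fun X => f X - g X) = seqAvg m f - seqAvg m g := by
  simp [seqAvg, smul_sub]

lemma seqAvg_add {E : Type*} [AddCommGroup E] [Module ℝ E] {m : ℕ} (f g : Seq m → E) :
    seqAvg m (fun X => f X + g X) = seqAvg m f + seqAvg m g := by
  simp [seqAvg, Finset.sum_add_distrib]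

lemma inner_seqAvg {E : Type*} [NormedAddCommGroup E] [InnerProductSpace ℝ E] {m : ℕ}
    (f : Seq m → E) (v : E) : inner ℝ (seqAvg m f) v = seqAvg m fun X => inner ℝ (f X) v := by
  simp [seqAvg, inner_smul_left, sum_inner]

lemma hasFDerivAt_seqAvg {E : Type*} [NormedAddCommGroup E] [InnerProductSpace ℝ E]
    {m : ℕ} (f : Seq m → E → ℝ) (g : Seq m → E) (x : E)
    (h : ∀ X, HasFDerivAt (f X) (innerSL ℝ (g X)) x) :
    HasFDerivAt (fun z => seqAvg m fun X => f X z) (innerSL ℝ (seqAvg m g)) x := by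
  unfold seqAvg
  have h1 : HasFDerivAt (fun z => ∑ X, f X z) (∑ X, innerSL ℝ (g X)) x :=
    HasFDerivAt.fun_sum fun X _ => h X
  refine (h1.const_smul (1 / (Fintype.card (Seq m) : ℝ))).congr_fderiv ?_
  simp [map_sum, map_smul]

/-- The rank one matrix `x yᵀ`. -/
noncomputable def outer {d : ℕ} (x y : Vec d) : Mat d := WithLp.toLp 2 fun ij => x ij.1 * y ij.2

lemma bilin_eq_inner {d : ℕ} (W : Mat d) (x y : Vec d) : bilin W x y = inner ℝ (outer x y) W := by
  simp only [bilin, outer, PiLp.inner_apply, Fintype.sum_prod_type]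
  refine Finset.sum_congr rfl fun i _ => Finset.sum_congr rfl fun j _ => ?_
  simp
  ring

lemma inner_outer {d : ℕ} (x y z w : Vec d) :
    inner ℝ (outer x y) (outer z w) = inner ℝ x z * inner ℝ y w := by
  simp only [outer, PiLp.inner_apply, Fintype.sum_prod_type, Finset.sum_mul_sum]
  refine Finset.sum_congr rfl fun i _ => Finset.sum_congr rfl fun j _ => ?_
  simp
  ring

lemma norm_outer {d : ℕ} (x y : Vec d) : ‖outer x y‖ = ‖x‖ * ‖y‖ := by
  have h : ‖outer x y‖ ^ 2 = (‖x‖ * ‖y‖) ^ 2 := by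
    rw [← real_inner_self_eq_norm_sq, inner_outer, real_inner_self_eq_norm_sq,
      real_inner_self_eq_norm_sq, mul_pow]
  exact (pow_left_inj₀ (norm_nonneg _) (by positivity) two_ne_zero).1 h

lemma abs_bilin_le {d : ℕ} (W : Mat d) (x y : Vec d) : |bilin W x y| ≤ ‖x‖ * ‖y‖ * ‖W‖ := by
  rw [bilin_eq_inner, ← norm_outer]
  exact abs_real_inner_le_norm _ _

lemma embed_eq_single {d p : ℕ} (w : Token) (h : 2 * p + w.toNat < d) :
    embed d p w = EuclideanSpace.single ⟨2 * p + w.toNat, h⟩ (1 : ℝ) := by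
  ext i
  simp [embed, PiLp.single_apply, Fin.ext_iff]

lemma inner_embed {d p q : ℕ} (w w' : Token) (h : 2 * p + 2 ≤ d) :
    inner ℝ (embed d p w) (embed d q w') = if p = q ∧ w = w' then (1 : ℝ) else 0 := by
  have h' : 2 * p + w.toNat < d := by have := Bool.toNat_lt w; omega
  rw [embed_eq_single w h', EuclideanSpace.inner_single_left]
  simp only [embed, map_one, one_mul]
  refine if_congr ?_ rfl rfl
  cases w <;> cases w' <;> simp <;> omega

lemma norm_embed_le {d p : ℕ} (w : Token) : ‖embed d p w‖ ≤ 1 := by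
  by_cases h : 2 * p + w.toNat < d
  · rw [embed_eq_single w h]; simp
  · have : embed d p w = 0 := by
      ext i
      have := i.2
      simp only [embed, PiLp.zero_apply, ite_eq_right_iff, one_ne_zero, imp_false]
      omega
    simp [this]

lemma norm_tok_le {d m : ℕ} (X : Seq m) (i : Fin (m + 1)) : ‖tok d X i‖ ≤ 1 := norm_embed_le _

lemma attnWeight_pos {d m : ℕ} (lam : ℝ) (W : Mat d) (X : Seq m) (i : Fin (m + 1)) :
    0 < attnWeight lam W X i := softmax_pos _ _

lemma attnWeight_sum {d m : ℕ} (lam : ℝ) (W : Mat d) (X : Seq m) :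
    ∑ i, attnWeight lam W X i = 1 := softmax_sum _

lemma norm_attnOut_le {d m : ℕ} (lam : ℝ) (W : Mat d) (X : Seq m) : ‖attnOut lam W X‖ ≤ 1 := by
  unfold attnOut
  rw [← attnWeight_sum lam W X]
  refine norm_sum_le_of_le _ fun i _ => ?_
  rw [norm_smul, Real.norm_of_nonneg (attnWeight_pos _ _ _ _).le]
  exact mul_le_of_le_one_right (attnWeight_pos _ _ _ _).le (norm_tok_le _ _)

lemma abs_transformer_le {d m : ℕ} (lam : ℝ) (u : Vec d) (W : Mat d) (X : Seq m) :
    |transformer lam u W X| ≤ ‖u‖ :=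
  (abs_real_inner_le_norm _ _).trans
    (mul_le_of_le_one_right (norm_nonneg _) (norm_attnOut_le _ _ _))

lemma transformer_eq_sum {d m : ℕ} (lam : ℝ) (u : Vec d) (W : Mat d) (X : Seq m) :
    transformer lam u W X = ∑ i, attnWeight lam W X i * inner ℝ u (tok d X i) := by
  simp [transformer, attnOut, inner_sum, inner_smul_right]

/-- For short sequences the truncated subtraction `m - (L₀ - 1)` is `0`, so the chain-of-thought
formula already gives the even-pairs label, and both losses can be treated as one sum. -/
lemma label_eq (L₀ : ℕ) {m : ℕ} (X : Seq m) : label L₀ X = cotLabel L₀ X := by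
  unfold label
  split_ifs with h
  · unfold evenPairsLabel cotLabel
    have : (⟨m - (L₀ - 1), by omega⟩ : Fin (m + 1)) = 0 := by
      ext; simp; omega
    rw [this]
  · rfl

lemma abs_cotLabel (L₀ : ℕ) {m : ℕ} (X : Seq m) : |cotLabel L₀ X| = 1 := by
  unfold cotLabel; split_ifs <;> simp

lemma lossParity_eq (d L₀ : ℕ) (lam : ℝ) (u : Vec d) (W : Mat d) :
    lossParity d L₀ lam u W = ∑ m ∈ Finset.range (2 * L₀ - 1),
      seqAvg m fun X => logistic (cotLabel L₀ X * transformer lam u W X) := by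
  unfold lossParity lossCoT lossReg
  rw [add_comm, ← Finset.sum_range_add_sum_Ico _ (show L₀ - 1 ≤ 2 * L₀ - 1 by omega)]
  congr 1
  refine Finset.sum_congr rfl fun m hm => ?_
  have hm := Finset.mem_range.1 hm
  unfold seqAvg
  rw [smul_eq_mul]
  congr 1
  refine Finset.sum_congr rfl fun X _ => ?_
  have h := label_eq L₀ X
  rw [label, if_pos (by omega)] at h
  rw [h]

/-! ### Gradients of the loss, the training recursion and a priori bounds. -/

/-- The gradient of the loss with respect to the linear layer. -/
noncomputable def gradU (d L₀ : ℕ) (lam : ℝ) (u : Vec d) (W : Mat d) : Vec d :=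
  ∑ m ∈ Finset.range (2 * L₀ - 1), seqAvg m fun X =>
    (-(cotLabel L₀ X * logSlope (cotLabel L₀ X * transformer lam u W X))) • attnOut lam W X

/-- The gradient of the output with respect to the attention matrix. -/
noncomputable def gradT {d m : ℕ} (lam : ℝ) (u : Vec d) (W : Mat d) (X : Seq m) : Mat d :=
  ∑ i, (attnWeight lam W X i * (inner ℝ u (tok d X i) - transformer lam u W X) / lam) •
    outer (tok d X i) (tok d X (Fin.last m))

/-- The gradient of the loss with respect to the attention matrix. -/
noncomputable def gradW (d L₀ : ℕ) (lam : ℝ) (u : Vec d) (W : Mat d) : Mat d :=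
  ∑ m ∈ Finset.range (2 * L₀ - 1), seqAvg m fun X =>
    (-(cotLabel L₀ X * logSlope (cotLabel L₀ X * transformer lam u W X))) • gradT lam u W X

lemma hasFDerivAt_lossParity_left (d L₀ : ℕ) (lam : ℝ) (u : Vec d) (W : Mat d) :
    HasFDerivAt (fun u => lossParity d L₀ lam u W) (innerSL ℝ (gradU d L₀ lam u W)) u := by
  simp only [lossParity_eq]
  have : ∀ m ∈ Finset.range (2 * L₀ - 1), HasFDerivAt (fun u : Vec d =>
      seqAvg m fun X => logistic (cotLabel L₀ X * transformer lam u W X))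
      (innerSL ℝ (seqAvg m fun X =>
        (-(cotLabel L₀ X * logSlope (cotLabel L₀ X * transformer lam u W X))) • attnOut lam W X))
      u := by
    intro m _
    refine hasFDerivAt_seqAvg _ _ _ fun X => ?_
    have h1 : HasFDerivAt (fun u : Vec d => cotLabel L₀ X * transformer lam u W X)
        (innerSL ℝ (cotLabel L₀ X • attnOut lam W X)) u := by
      refine ((innerSL ℝ (cotLabel L₀ X • attnOut lam W X)).hasFDerivAt).congr_of_eventuallyEq ?_
      refine Filter.Eventually.of_forall fun z => ?_
      simp [transformer, real_inner_comm]
    refine ((hasDerivAt_logistic _).comp_hasFDerivAt u h1).congr_fderiv ?_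
    rw [← map_smul, smul_smul]
    congr 2
    ring
  refine (HasFDerivAt.fun_sum this).congr_fderiv ?_
  simp [gradU, map_sum]

lemma hasFDerivAt_transformer {d m : ℕ} (lam : ℝ) (u : Vec d) (W : Mat d) (X : Seq m) :
    HasFDerivAt (fun W => transformer lam u W X) (innerSL ℝ (gradT lam u W X)) W := by
  have h1 : ∀ i, HasFDerivAt
      (fun W : Mat d => bilin W (tok d X i) (tok d X (Fin.last m)) / lam)
      (innerSL ℝ ((1 / lam) • outer (tok d X i) (tok d X (Fin.last m)))) W := by
    intro i
    refine ((innerSL ℝ ((1 / lam) • outer (tok d X i)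
      (tok d X (Fin.last m)))).hasFDerivAt).congr_of_eventuallyEq ?_
    refine Filter.Eventually.of_forall fun z => ?_
    simp [bilin_eq_inner, div_eq_inv_mul]
  have h2 := hasFDerivAt_softmax_sum _ _ W h1 (fun i => inner ℝ u (tok d X i))
  have e : (fun W => transformer lam u W X) = fun W => ∑ i,
      softmax (fun j => bilin W (tok d X j) (tok d X (Fin.last m)) / lam) i *
        inner ℝ u (tok d X i) := by
    funext W; rw [transformer_eq_sum]; rfl
  rw [e]
  refine h2.congr_fderiv ?_
  rw [gradT, map_sum]
  refine Finset.sum_congr rfl fun i _ => ?_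
  rw [← map_smul, smul_smul, transformer_eq_sum]
  congr 2
  simp only [attnWeight]
  ring

lemma hasFDerivAt_lossParity_right (d L₀ : ℕ) (lam : ℝ) (u : Vec d) (W : Mat d) :
    HasFDerivAt (fun W => lossParity d L₀ lam u W) (innerSL ℝ (gradW d L₀ lam u W)) W := by
  simp only [lossParity_eq]
  have : ∀ m ∈ Finset.range (2 * L₀ - 1), HasFDerivAt (fun W : Mat d =>
      seqAvg m fun X => logistic (cotLabel L₀ X * transformer lam u W X))
      (innerSL ℝ (seqAvg m fun X =>
        (-(cotLabel L₀ X * logSlope (cotLabel L₀ X * transformer lam u W X))) • gradT lam u W X))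
      W := by
    intro m _
    refine hasFDerivAt_seqAvg _ _ _ fun X => ?_
    have h1 := (hasFDerivAt_transformer lam u W X).const_mul (cotLabel L₀ X)
    refine ((hasDerivAt_logistic _).comp_hasFDerivAt W h1).congr_fderiv ?_
    rw [smul_smul, ← map_smul]
    congr 2
    ring
  refine (HasFDerivAt.fun_sum this).congr_fderiv ?_
  simp [gradW, map_sum]

lemma gradient_eq_of_hasFDerivAt {E : Type*} [NormedAddCommGroup E] [InnerProductSpace ℝ E]
    [CompleteSpace E] {f : E → ℝ} {g x : E} (h : HasFDerivAt f (innerSL ℝ g) x) :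
    gradient f x = g := by
  have : HasGradientAt f g x := by
    rw [hasGradientAt_iff_hasFDerivAt]
    exact h.congr_fderiv (by ext; simp)
  exact this.gradient

lemma train_zero (d L₀ : ℕ) (lam η : ℝ) (t₀ : ℕ) : train d L₀ lam η t₀ 0 = (0, 0) := rfl

lemma train_succ_fst (d L₀ : ℕ) (lam η : ℝ) (t₀ t : ℕ) :
    (train d L₀ lam η t₀ (t + 1)).1 = (train d L₀ lam η t₀ t).1 -
      η • gradU d L₀ lam (train d L₀ lam η t₀ t).1 (train d L₀ lam η t₀ t).2 := by
  rw [← gradient_eq_of_hasFDerivAt (hasFDerivAt_lossParity_left _ _ _ _ _)]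
  rfl

lemma train_succ_snd (d L₀ : ℕ) (lam η : ℝ) (t₀ t : ℕ) :
    (train d L₀ lam η t₀ (t + 1)).2 = (train d L₀ lam η t₀ t).2 -
      (if t ≤ t₀ then η * lam else η) •
        gradW d L₀ lam (train d L₀ lam η t₀ t).1 (train d L₀ lam η t₀ t).2 := by
  rw [← gradient_eq_of_hasFDerivAt (hasFDerivAt_lossParity_right _ _ _ _ _)]
  rfl

lemma norm_gradU_le (d L₀ : ℕ) (lam : ℝ) (u : Vec d) (W : Mat d) :
    ‖gradU d L₀ lam u W‖ ≤ ((2 * L₀ - 1 : ℕ) : ℝ) := by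
  unfold gradU
  calc _ ≤ ∑ m ∈ Finset.range (2 * L₀ - 1), (1 : ℝ) := by
        refine norm_sum_le_of_le _ fun m _ => norm_seqAvg_le fun X => ?_
        rw [norm_smul, norm_neg, norm_mul, Real.norm_eq_abs, abs_cotLabel, one_mul,
          Real.norm_of_nonneg (logSlope_pos _).le]
        exact mul_le_one₀ (logSlope_le_one _) (norm_nonneg _) (norm_attnOut_le _ _ _)
    _ = _ := by simp

lemma inner_gradU_ge (d L₀ : ℕ) (lam : ℝ) (u : Vec d) (W : Mat d) :
    -(((2 * L₀ - 1 : ℕ) : ℝ) / 3) ≤ inner ℝ (gradU d L₀ lam u W) u := by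
  unfold gradU
  rw [sum_inner]
  calc -(((2 * L₀ - 1 : ℕ) : ℝ) / 3) = ∑ m ∈ Finset.range (2 * L₀ - 1), (-(1 / 3) : ℝ) := by
        simp; ring
    _ ≤ _ := by
        refine Finset.sum_le_sum fun m _ => ?_
        rw [inner_seqAvg, ← seqAvg_const (m := m) (-(1 / 3) : ℝ)]
        refine seqAvg_mono fun X => ?_
        rw [real_inner_smul_left, real_inner_comm]
        have := mul_logSlope_le (cotLabel L₀ X * transformer lam u W X)
        unfold transformer at *
        linarith

lemma norm_gradT_le {d m : ℕ} {lam : ℝ} (hlam : 0 < lam) (u : Vec d) (W : Mat d) (X : Seq m) :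
    ‖gradT lam u W X‖ ≤ 2 * ‖u‖ / lam := by
  unfold gradT
  calc _ ≤ ∑ i, attnWeight lam W X i * (2 * ‖u‖ / lam) := by
        refine norm_sum_le_of_le _ fun i _ => ?_
        have h1 : ‖outer (tok d X i) (tok d X (Fin.last m))‖ ≤ 1 := by
          rw [norm_outer]
          exact mul_le_one₀ (norm_tok_le _ _) (norm_nonneg _) (norm_tok_le _ _)
        have h2 : |inner ℝ u (tok d X i) - transformer lam u W X| ≤ 2 * ‖u‖ := by
          have h3 := (abs_real_inner_le_norm u (tok d X i)).trans
            (mul_le_of_le_one_right (norm_nonneg _) (norm_tok_le _ _))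
          have h4 := abs_transformer_le lam u W X
          have := abs_sub (inner ℝ u (tok d X i)) (transformer lam u W X)
          linarith
        have hp := attnWeight_pos lam W X i
        rw [norm_smul, Real.norm_eq_abs, abs_div, abs_mul, abs_of_pos hp, abs_of_pos hlam]
        calc _ ≤ attnWeight lam W X i * |inner ℝ u (tok d X i) - transformer lam u W X| / lam :=
              mul_le_of_le_one_right (by positivity) h1
          _ ≤ attnWeight lam W X i * (2 * ‖u‖) / lam := by gcongr
          _ = _ := by ring
    _ = _ := by rw [← Finset.sum_mul, attnWeight_sum, one_mul]

lemma norm_gradW_le {d L₀ : ℕ} {lam : ℝ} (hlam : 0 < lam) (u : Vec d) (W : Mat d) :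
    ‖gradW d L₀ lam u W‖ ≤ ((2 * L₀ - 1 : ℕ) : ℝ) * (2 * ‖u‖ / lam) := by
  unfold gradW
  calc _ ≤ ∑ m ∈ Finset.range (2 * L₀ - 1), (2 * ‖u‖ / lam) := by
        refine norm_sum_le_of_le _ fun m _ => norm_seqAvg_le fun X => ?_
        rw [norm_smul, norm_neg, norm_mul, Real.norm_eq_abs, abs_cotLabel, one_mul,
          Real.norm_of_nonneg (logSlope_pos _).le]
        have := norm_gradT_le hlam u W X
        calc _ ≤ 1 * ‖gradT lam u W X‖ := by gcongr; exact logSlope_le_one _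
          _ ≤ _ := by linarith
    _ = _ := by simp

/-- The linear layer grows at most like the square root of the training time. -/
lemma norm_train_fst_sq_le {d L₀ : ℕ} {lam η : ℝ} {t₀ : ℕ} (hη : 0 < η)
    (hN : η * ((2 * L₀ - 1 : ℕ) : ℝ) ≤ 1 / 3) (t : ℕ) :
    ‖(train d L₀ lam η t₀ t).1‖ ^ 2 ≤ η * ((2 * L₀ - 1 : ℕ) : ℝ) * t := by
  induction t with
  | zero => simp [train_zero]
  | succ t ih =>
    rw [train_succ_fst]
    set u := (train d L₀ lam η t₀ t).1
    set g := gradU d L₀ lam u (train d L₀ lam η t₀ t).2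
    set N := ((2 * L₀ - 1 : ℕ) : ℝ)
    have hN0 : 0 ≤ N := Nat.cast_nonneg _
    have h1 : ‖g‖ ≤ N := norm_gradU_le _ _ _ _ _
    have h2 : -(N / 3) ≤ inner ℝ g u := inner_gradU_ge _ _ _ _ _
    rw [norm_sub_sq_real, norm_smul, real_inner_smul_right, Real.norm_of_nonneg hη.le,
      real_inner_comm g u, mul_pow]
    have h3 : ‖g‖ ^ 2 ≤ N ^ 2 := by gcongr
    -- The squared norm grows by at most `2ηN/3` from the inner product and `ηN/3` from the squared
    -- step.
    have h4 : η ^ 2 * ‖g‖ ^ 2 ≤ η * N * (1 / 3) := by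
      calc η ^ 2 * ‖g‖ ^ 2 ≤ η ^ 2 * N ^ 2 := by gcongr
        _ = (η * N) * (η * N) := by ring
        _ ≤ _ := by gcongr
    have h5 : η * -(N / 3) ≤ η * inner ℝ g u := by gcongr
    push_cast
    nlinarith

/-! ### Symmetry reduction to position values and label-dependent scores. -/

/-- The position compared with the last one by the label of a sequence. -/
def keyPos (L₀ m : ℕ) : ℕ := m - (L₀ - 1)

/-- Whether the last token agrees with the key token. -/
def agree (L₀ : ℕ) {m : ℕ} (X : Seq m) : Bool :=
  X (Fin.last m) == X ⟨m - (L₀ - 1), by omega⟩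

/-- The label `±1` as a real number. -/
def sgn (y : Bool) : ℝ := if y then 1 else -1

@[simp] lemma sgn_true : sgn true = 1 := rfl
@[simp] lemma sgn_false : sgn false = -1 := rfl

lemma cotLabel_eq_sgn (L₀ : ℕ) {m : ℕ} (X : Seq m) : cotLabel L₀ X = sgn (agree L₀ X) := by
  simp [cotLabel, sgn, agree]

/-- Sum of the embeddings of the two tokens at one position. -/
noncomputable def pairVec (d p : ℕ) : Vec d := embed d p false + embed d p true

/-- The vector whose coordinates at position `p` are both `v p`. -/
noncomputable def linVec (d N : ℕ) (v : ℕ → ℝ) : Vec d :=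
  ∑ p ∈ Finset.range N, v p • pairVec d p

lemma inner_pairVec_embed {d p q : ℕ} (w : Token) (h : 2 * p + 2 ≤ d) :
    inner ℝ (pairVec d p) (embed d q w) = if p = q then (1 : ℝ) else 0 := by
  rw [pairVec, inner_add_left, inner_embed _ _ h, inner_embed _ _ h]
  cases w <;> simp

lemma inner_linVec_embed {d N : ℕ} (hd : 2 * N ≤ d) (v : ℕ → ℝ) (q : ℕ) (w : Token) :
    inner ℝ (linVec d N v) (embed d q w) = if q < N then v q else 0 := by
  rw [linVec, sum_inner]
  rw [Finset.sum_congr rfl (g := fun p => if p = q then v p else 0)]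
  · simp [Finset.sum_ite_eq']
  · intro p hp
    have := Finset.mem_range.1 hp
    rw [real_inner_smul_left, inner_pairVec_embed _ (by omega)]
    simp

lemma norm_linVec_sq {d N : ℕ} (hd : 2 * N ≤ d) (v : ℕ → ℝ) :
    ‖linVec d N v‖ ^ 2 = 2 * ∑ p ∈ Finset.range N, v p ^ 2 := by
  rw [← real_inner_self_eq_norm_sq]
  nth_rewrite 2 [linVec]
  rw [inner_sum, Finset.mul_sum]
  refine Finset.sum_congr rfl fun p hp => ?_
  have := Finset.mem_range.1 hp
  rw [real_inner_smul_right, pairVec, inner_add_right, inner_linVec_embed hd,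
    inner_linVec_embed hd]
  simp [this]
  ring

lemma linVec_sub_smul (d N : ℕ) (v w : ℕ → ℝ) (c : ℝ) :
    linVec d N v - c • linVec d N w = linVec d N (fun p => v p - c * w p) := by
  simp only [linVec, Finset.smul_sum, ← Finset.sum_sub_distrib, sub_smul, mul_smul]

/-- The embeddings run through the standard basis: coordinate `i` belongs to position `i / 2`, with
the letter given by parity. -/
lemma vec_ext {d : ℕ} {x y : Vec d}
    (h : ∀ p w, inner ℝ x (embed d p w) = inner ℝ y (embed d p w)) : x = y := by
  ext i
  have hi : 2 * ((i : ℕ) / 2) + (decide ((i : ℕ) % 2 = 1)).toNat = i := by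
    rcases Nat.mod_two_eq_zero_or_one i with h | h <;> simp [h] <;> omega
  have := h ((i : ℕ) / 2) (decide ((i : ℕ) % 2 = 1))
  rw [embed_eq_single _ (by rw [hi]; exact i.2)] at this
  simpa [EuclideanSpace.inner_single_right, hi] using this

/-- Average over the value of the label. -/
noncomputable def labelAvg (m : ℕ) (h : Bool → ℝ) : ℝ :=
  if m = 0 then h true else (h true + h false) / 2

lemma seqAvg_equiv {m : ℕ} (e : Seq m ≃ Seq m) (f : Seq m → ℝ) :
    seqAvg m (fun X => f (e X)) = seqAvg m f := by
  unfold seqAvg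
  rw [Equiv.sum_comp e f]

/-- Flip the token at one position. -/
def flipAt {m : ℕ} (i : Fin (m + 1)) : Seq m ≃ Seq m where
  toFun X := Function.update X i (!X i)
  invFun X := Function.update X i (!X i)
  left_inv X := by simp
  right_inv X := by simp

/-- Flip all tokens. -/
def flipAll {m : ℕ} : Seq m ≃ Seq m where
  toFun X := fun i => !X i
  invFun X := fun i => !X i
  left_inv X := by simp
  right_inv X := by simp

lemma agree_flipAll (L₀ : ℕ) {m : ℕ} (X : Seq m) : agree L₀ (flipAll X) = agree L₀ X := by
  simp only [agree, flipAll, Equiv.coe_fn_mk]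
  cases X (Fin.last m) <;> cases X ⟨m - (L₀ - 1), by omega⟩ <;> rfl

lemma keyPos_lt {L₀ m : ℕ} (hm : m < 2 * L₀ - 1) (h0 : m ≠ 0) : keyPos L₀ m < m := by
  unfold keyPos; omega

lemma agree_flipAt_key {L₀ m : ℕ} (hm : m < 2 * L₀ - 1) (h0 : m ≠ 0) (X : Seq m) :
    agree L₀ (flipAt ⟨m - (L₀ - 1), by omega⟩ X) = !agree L₀ X := by
  have hk := keyPos_lt hm h0
  unfold keyPos at hk
  have hne : Fin.last m ≠ ⟨m - (L₀ - 1), by omega⟩ := by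
    intro h
    have := congrArg Fin.val h
    simp at this
    omega
  simp only [agree, flipAt, Equiv.coe_fn_mk, Function.update_self, Function.update_of_ne hne]
  cases X (Fin.last m) <;> cases X ⟨m - (L₀ - 1), by omega⟩ <;> rfl

/-- Flipping the key token reverses the label, so labels are balanced, except at `m = 0`, where the
key token is the last token itself. -/
lemma seqAvg_agree {L₀ m : ℕ} (hm : m < 2 * L₀ - 1) (h : Bool → ℝ) :
    seqAvg m (fun X => h (agree L₀ X)) = labelAvg m h := by
  unfold labelAvg
  split_ifs with h0
  · subst h0
    have : ∀ X : Seq 0, agree L₀ X = true := by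
      intro X
      simp [agree]
    simp only [this, seqAvg_const]
  · have h1 := seqAvg_equiv (flipAt ⟨m - (L₀ - 1), by omega⟩)
      (fun X : Seq m => h (agree L₀ X))
    simp only [agree_flipAt_key hm h0] at h1
    have h2 : seqAvg m (fun X : Seq m => h (agree L₀ X) + h (!agree L₀ X)) =
        h true + h false := by
      rw [← seqAvg_const (m := m) (h true + h false)]
      congr 1
      funext X
      cases agree L₀ X <;> simp [add_comm]
    rw [seqAvg_add, h1] at h2
    linarith

/-- Flipping all tokens preserves the label and exchanges the two values of the token at `i`. -/
lemma seqAvg_agree_of_token {L₀ m : ℕ} (hm : m < 2 * L₀ - 1) (h : Bool → ℝ) (i : Fin (m + 1))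
    (w : Token) :
    seqAvg m (fun X => if X i = w then h (agree L₀ X) else 0) = labelAvg m h / 2 := by
  have h1 := seqAvg_equiv flipAll (fun X : Seq m => if X i = w then h (agree L₀ X) else 0)
  simp only [agree_flipAll] at h1
  have h2 : seqAvg m (fun X : Seq m => (if X i = w then h (agree L₀ X) else 0) +
      (if flipAll X i = w then h (agree L₀ X) else 0)) = labelAvg m h := by
    rw [← seqAvg_agree hm]
    congr 1
    funext X
    have : flipAll X i = !X i := rfl
    rw [this]
    cases X i <;> cases w <;> simp
  rw [seqAvg_add, h1] at h2
  linarith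

/-- A token that is neither the key nor the last one can be flipped without affecting the label or
the last token, which halves the average once more. -/
lemma seqAvg_agree_of_tokens {L₀ m : ℕ} (hm : m < 2 * L₀ - 1) (h : Bool → ℝ) (i : Fin (m + 1))
    (hi : (i : ℕ) ≠ m) (hk : (i : ℕ) ≠ keyPos L₀ m) (w w' : Token) :
    seqAvg m (fun X => if X i = w ∧ X (Fin.last m) = w' then h (agree L₀ X) else 0) =
      labelAvg m h / 4 := by
  have hl : Fin.last m ≠ i := fun e => hi (by rw [← e]; simp)
  have hk' : (⟨m - (L₀ - 1), by omega⟩ : Fin (m + 1)) ≠ i := fun e => hk (by rw [← e]; rfl)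
  have h1 := seqAvg_equiv (flipAt i)
    (fun X : Seq m => if X i = w ∧ X (Fin.last m) = w' then h (agree L₀ X) else 0)
  have ha : ∀ X : Seq m, agree L₀ (flipAt i X) = agree L₀ X := by
    intro X
    simp only [agree, flipAt, Equiv.coe_fn_mk, Function.update_of_ne hl,
      Function.update_of_ne hk']
  have hb : ∀ X : Seq m, flipAt i X i = !X i := fun X => by simp [flipAt]
  have hc : ∀ X : Seq m, flipAt i X (Fin.last m) = X (Fin.last m) := fun X => by
    simp [flipAt, Function.update_of_ne hl]
  simp only [ha, hb, hc] at h1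
  have h2 : seqAvg m (fun X : Seq m =>
      (if X i = w ∧ X (Fin.last m) = w' then h (agree L₀ X) else 0) +
      (if (!X i) = w ∧ X (Fin.last m) = w' then h (agree L₀ X) else 0)) = labelAvg m h / 2 := by
    rw [← seqAvg_agree_of_token hm h (Fin.last m) w']
    congr 1
    funext X
    cases X i <;> cases w <;> simp
  rw [seqAvg_add, h1] at h2
  linarith

/-- Fixing the key and last tokens amounts to fixing the last token and the label, so the one-token
average applies to `h` truncated to that label. -/
lemma seqAvg_agree_of_key {L₀ m : ℕ} (hm : m < 2 * L₀ - 1) (h0 : m ≠ 0) (h : Bool → ℝ)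
    (X₀ : Seq m) (i : Fin (m + 1)) (hi : (i : ℕ) = keyPos L₀ m) :
    seqAvg m (fun X => if X i = X₀ i ∧ X (Fin.last m) = X₀ (Fin.last m)
      then h (agree L₀ X) else 0) = h (agree L₀ X₀) / 4 := by
  have hk : i = ⟨m - (L₀ - 1), by omega⟩ := Fin.ext hi
  have h1 := seqAvg_agree_of_token hm
    (fun y => if y = agree L₀ X₀ then h y else 0) (Fin.last m) (X₀ (Fin.last m))
  have h2 : labelAvg m (fun y => if y = agree L₀ X₀ then h y else 0) = h (agree L₀ X₀) / 2 := by
    unfold labelAvg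
    rw [if_neg h0]
    cases agree L₀ X₀ <;> simp
  rw [h2] at h1
  rw [show h (agree L₀ X₀) / 4 = h (agree L₀ X₀) / 2 / 2 by ring, ← h1]
  congr 1
  funext X
  simp only [agree, ← hk]
  generalize X (Fin.last m) = a
  generalize X₀ (Fin.last m) = b
  generalize X i = c
  generalize X₀ i = e
  cases a <;> cases b <;> cases c <;> cases e <;> simp

/-- Attention weight of position `p` in the reduced description. -/
noncomputable def att (lam : ℝ) (S : ℕ → ℕ → Bool → ℝ) (m : ℕ) (y : Bool) (p : ℕ) : ℝ :=
  Real.exp (S m p y / lam) / ∑ j ∈ Finset.range (m + 1), Real.exp (S m j y / lam)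

/-- Output of the model in the reduced description. -/
noncomputable def out (lam : ℝ) (v : ℕ → ℝ) (S : ℕ → ℕ → Bool → ℝ) (m : ℕ) (y : Bool) : ℝ :=
  ∑ p ∈ Finset.range (m + 1), att lam S m y p * v p

/-- The parameters `(u, W)` are described by position values `v` and attention scores `S` which
depend only on the label. -/
structure IsReduced (d L₀ : ℕ) (u : Vec d) (W : Mat d) (v : ℕ → ℝ) (S : ℕ → ℕ → Bool → ℝ) :
    Prop where
  lin : u = linVec d (2 * L₀ - 1) v
  score : ∀ m < 2 * L₀ - 1, ∀ (X : Seq m) (i : Fin (m + 1)),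
    bilin W (tok d X i) (tok d X (Fin.last m)) = S m i (agree L₀ X)
  indep : ∀ m < 2 * L₀ - 1, ∀ p, p ≠ keyPos L₀ m → S m p true = S m p false

lemma attnWeight_eq_att {d L₀ m : ℕ} {W : Mat d} {S : ℕ → ℕ → Bool → ℝ} (lam : ℝ) {X : Seq m}
    (h : ∀ i, bilin W (tok d X i) (tok d X (Fin.last m)) = S m i (agree L₀ X)) (i : Fin (m + 1)) :
    attnWeight lam W X i = att lam S m (agree L₀ X) i := by
  simp only [attnWeight, softmax, att, h, Finset.sum_range]

section Reduced

variable {d L₀ : ℕ} {lam : ℝ} {u : Vec d} {W : Mat d} {v : ℕ → ℝ} {S : ℕ → ℕ → Bool → ℝ}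

lemma inner_linVec_tok {N m : ℕ} (hd : 2 * N ≤ d) (hm : m < N) (v : ℕ → ℝ) (X : Seq m)
    (i : Fin (m + 1)) : inner ℝ (linVec d N v) (tok d X i) = v i := by
  rw [tok, inner_linVec_embed hd, if_pos (by omega)]

lemma transformer_linVec {N m : ℕ} (hd : 2 * N ≤ d) (hm : m < N) (v : ℕ → ℝ) {X : Seq m}
    (h : ∀ i, bilin W (tok d X i) (tok d X (Fin.last m)) = S m i (agree L₀ X)) :
    transformer lam (linVec d N v) W X = out lam v S m (agree L₀ X) := by
  rw [transformer_eq_sum, out, Finset.sum_range]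
  refine Finset.sum_congr rfl fun i _ => ?_
  rw [attnWeight_eq_att lam h, inner_linVec_tok hd hm]

/-- Reduced gradient with respect to the linear layer. -/
noncomputable def redGradU (L₀ : ℕ) (lam : ℝ) (v : ℕ → ℝ) (S : ℕ → ℕ → Bool → ℝ) (p : ℕ) : ℝ :=
  -(1 / 2) * ∑ m ∈ Finset.range (2 * L₀ - 1), if p ≤ m then
    labelAvg m (fun y => sgn y * logSlope (sgn y * out lam v S m y) * att lam S m y p) else 0

lemma inner_tok_embed {N m : ℕ} (hd : 2 * N ≤ d) (hm : m < N) (X : Seq m) (i : Fin (m + 1))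
    (p : ℕ) (w : Token) :
    inner ℝ (tok d X i) (embed d p w) = if (i : ℕ) = p ∧ X i = w then (1 : ℝ) else 0 := by
  rw [tok, inner_embed _ _ (by omega)]

lemma inner_attnOut_embed {N m : ℕ} (hd : 2 * N ≤ d) (hm : m < N) (X : Seq m) (p : ℕ) (w : Token)
    (h : ∀ i, bilin W (tok d X i) (tok d X (Fin.last m)) = S m i (agree L₀ X)) :
    inner ℝ (attnOut lam W X) (embed d p w) = if h : p ≤ m then
      if X ⟨p, by omega⟩ = w then att lam S m (agree L₀ X) p else 0 else 0 := by
  rw [attnOut, sum_inner]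
  simp only [real_inner_smul_left, inner_tok_embed hd hm, attnWeight_eq_att lam h]
  split_ifs with hp
  · rw [Finset.sum_eq_single ⟨p, by omega⟩]
    · simp_all
    · intro b _ hb
      rw [if_neg, mul_zero]
      rintro ⟨rfl, _⟩
      exact hb rfl
    · simp
  · rw [Finset.sum_eq_single ⟨p, by omega⟩]
    · simp_all
    · intro b _ hb
      rw [if_neg, mul_zero]
      rintro ⟨rfl, _⟩
      exact hb rfl
    · simp
  · refine Finset.sum_eq_zero fun i _ => ?_
    rw [if_neg, mul_zero]
    rintro ⟨rfl, _⟩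
    have := i.2
    omega

lemma IsReduced.gradU_eq (hd : 2 * (2 * L₀ - 1) ≤ d) (h : IsReduced d L₀ u W v S) :
    gradU d L₀ lam u W = linVec d (2 * L₀ - 1) (redGradU L₀ lam v S) := by
  refine vec_ext fun p w => ?_
  rw [inner_linVec_embed hd, gradU, sum_inner]
  have key : ∀ m ∈ Finset.range (2 * L₀ - 1), inner ℝ (seqAvg m fun X : Seq m =>
      (-(cotLabel L₀ X * logSlope (cotLabel L₀ X * transformer lam u W X))) • attnOut lam W X)
      (embed d p w) = -(1 / 2) * if p ≤ m then
    labelAvg m (fun y => sgn y * logSlope (sgn y * out lam v S m y) * att lam S m y p) else 0 := by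
    intro m hm
    have hm := Finset.mem_range.1 hm
    rw [inner_seqAvg]
    split_ifs with hp
    · have h1 := seqAvg_agree_of_token hm (fun y =>
        -(sgn y * logSlope (sgn y * out lam v S m y) * att lam S m y p)) ⟨p, by omega⟩ w
      have h2 : labelAvg m (fun y =>
        -(sgn y * logSlope (sgn y * out lam v S m y) * att lam S m y p)) / 2 = -(1 / 2) *
          labelAvg m (fun y =>
            sgn y * logSlope (sgn y * out lam v S m y) * att lam S m y p) := by
        unfold labelAvg; split_ifs <;> ring
      rw [← h2, ← h1]
      congr 1
      funext X
      rw [real_inner_smul_left, inner_attnOut_embed hd hm X p w (h.score m hm X), dif_pos hp,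
        cotLabel_eq_sgn, h.lin, transformer_linVec hd hm v (h.score m hm X)]
      split_ifs <;> ring
    · rw [mul_zero, ← seqAvg_const (m := m) (0 : ℝ)]
      congr 1
      funext X
      rw [real_inner_smul_left, inner_attnOut_embed hd hm X p w (h.score m hm X), dif_neg hp,
        mul_zero]
  rw [Finset.sum_congr rfl key, ← Finset.mul_sum]
  split_ifs with hp
  · rfl
  · rw [Finset.sum_eq_zero, mul_zero]
    intro m hm
    have hm := Finset.mem_range.1 hm
    rw [if_neg (by omega)]

/-- Contribution of a label to the derivative of the loss in an attention score. -/
noncomputable def scoreForce (lam : ℝ) (v : ℕ → ℝ) (S : ℕ → ℕ → Bool → ℝ) (m p : ℕ)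
    (y : Bool) : ℝ :=
  sgn y * logSlope (sgn y * out lam v S m y) * att lam S m y p * (v p - out lam v S m y)

/-- Reduced ascent direction of the attention scores. -/
noncomputable def redGradS (L₀ : ℕ) (lam : ℝ) (v : ℕ → ℝ) (S : ℕ → ℕ → Bool → ℝ) (m p : ℕ)
    (y : Bool) : ℝ :=
  if p = m then labelAvg m (scoreForce lam v S m p) / 2
  else if p = keyPos L₀ m then scoreForce lam v S m p y / 4
  else labelAvg m (scoreForce lam v S m p) / 4

/-- The matrices `outer (tok d X j) (tok d X (Fin.last m))` are orthonormal or equal. The last token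
encodes its position, so different lengths never interact; within one length only sequences sharing
the tokens at `i` and at the end contribute. The three cases of `redGradS` are the corresponding
conditional averages. -/
lemma IsReduced.bilin_gradW (hd : 2 * (2 * L₀ - 1) ≤ d) (h : IsReduced d L₀ u W v S) {m : ℕ}
    (hm : m < 2 * L₀ - 1) (X₀ : Seq m) (i : Fin (m + 1)) :
    bilin (gradW d L₀ lam u W) (tok d X₀ i) (tok d X₀ (Fin.last m)) =
      -(redGradS L₀ lam v S m i (agree L₀ X₀) / lam) := by
  rw [bilin_eq_inner, real_inner_comm, gradW, sum_inner]
  have hterm : ∀ m' < 2 * L₀ - 1, ∀ X : Seq m', ∀ j : Fin (m' + 1),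
      inner ℝ (outer (tok d X j) (tok d X (Fin.last m')))
        (outer (tok d X₀ i) (tok d X₀ (Fin.last m))) =
      if ((j : ℕ) = i ∧ X j = X₀ i) ∧ m' = m ∧ X (Fin.last m') = X₀ (Fin.last m)
        then (1 : ℝ) else 0 := by
    intro m' hm' X j
    rw [inner_outer]
    nth_rewrite 2 [tok]
    nth_rewrite 3 [tok]
    rw [inner_tok_embed hd hm', inner_tok_embed hd hm', ite_and]
    simp only [Fin.val_last]
    split_ifs <;> simp_all
  rw [Finset.sum_eq_single m]
  · rw [inner_seqAvg]
    have e : ∀ X : Seq m, inner ℝ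
        ((-(cotLabel L₀ X * logSlope (cotLabel L₀ X * transformer lam u W X))) •
          gradT lam u W X) (outer (tok d X₀ i) (tok d X₀ (Fin.last m))) =
        if X i = X₀ i ∧ X (Fin.last m) = X₀ (Fin.last m)
          then -(scoreForce lam v S m i (agree L₀ X) / lam) else 0 := by
      intro X
      rw [real_inner_smul_left, gradT, sum_inner, Finset.sum_eq_single i]
      · rw [real_inner_smul_left, hterm m hm]
        rw [attnWeight_eq_att lam (h.score m hm X), cotLabel_eq_sgn, h.lin,
          transformer_linVec hd hm v (h.score m hm X), inner_linVec_tok hd hm]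
        simp only [true_and, scoreForce]
        split_ifs <;> ring
      · intro j _ hj
        rw [real_inner_smul_left, hterm m hm, if_neg, mul_zero]
        rintro ⟨⟨h1, _⟩, _⟩
        exact hj (Fin.ext h1)
      · simp
    simp only [e]
    have hlin : ∀ c : ℝ, labelAvg m (fun y => -(scoreForce lam v S m i y / lam)) / c =
        -(labelAvg m (scoreForce lam v S m i) / c / lam) := by
      intro c
      unfold labelAvg
      split_ifs <;> ring
    unfold redGradS
    split_ifs with h1 h2
    · have hi : i = Fin.last m := Fin.ext h1
      have := seqAvg_agree_of_token hm (fun y => -(scoreForce lam v S m i y / lam)) i (X₀ i)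
      rw [← hlin, ← this]
      congr 1
      funext X
      rw [hi]
      simp
    · have h0 : m ≠ 0 := by
        intro h0; apply h1; have := i.2; omega
      rw [seqAvg_agree_of_key hm h0 (fun y => -(scoreForce lam v S m i y / lam)) X₀ i h2]
      ring
    · rw [seqAvg_agree_of_tokens hm (fun y => -(scoreForce lam v S m i y / lam)) i h1 h2, hlin]
  · intro m' hm' hne
    have hm' := Finset.mem_range.1 hm'
    rw [inner_seqAvg, ← seqAvg_const (m := m') (0 : ℝ)]
    congr 1
    funext X
    rw [real_inner_smul_left, gradT, sum_inner, Finset.sum_eq_zero, mul_zero]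
    intro j _
    rw [real_inner_smul_left, hterm m' hm', if_neg, mul_zero]
    rintro ⟨_, h2, _⟩
    exact hne h2
  · intro hn
    exact absurd (Finset.mem_range.2 hm) hn

end Reduced

/-- Gradient descent in the reduced description. -/
noncomputable def redTrain (L₀ : ℕ) (lam η : ℝ) (t₀ : ℕ) :
    ℕ → (ℕ → ℝ) × (ℕ → ℕ → Bool → ℝ)
  | 0 => (fun _ => 0, fun _ _ _ => 0)
  | t + 1 =>
    let θ := redTrain L₀ lam η t₀ t
    (fun p => θ.1 p - η * redGradU L₀ lam θ.1 θ.2 p,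
      fun m p y => θ.2 m p y +
        (if t ≤ t₀ then η * lam else η) * (redGradS L₀ lam θ.1 θ.2 m p y / lam))

lemma isReduced_train {d L₀ : ℕ} (lam η : ℝ) (t₀ : ℕ) (hd : 2 * (2 * L₀ - 1) ≤ d) (t : ℕ) :
    IsReduced d L₀ (train d L₀ lam η t₀ t).1 (train d L₀ lam η t₀ t).2
      (redTrain L₀ lam η t₀ t).1 (redTrain L₀ lam η t₀ t).2 := by
  induction t with
  | zero =>
    refine ⟨?_, ?_, ?_⟩
    · simp [train_zero, redTrain, linVec]
    · intro m _ X i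
      simp [train_zero, redTrain, bilin]
    · intro m _ p _
      rfl
  | succ t ih =>
    refine ⟨?_, ?_, ?_⟩
    · rw [train_succ_fst, ih.gradU_eq hd]
      nth_rewrite 1 [ih.lin]
      rw [linVec_sub_smul]
      rfl
    · intro m hm X i
      have h1 := ih.score m hm X i
      have h2 := ih.bilin_gradW (lam := lam) hd hm X i
      rw [bilin_eq_inner] at h1 h2 ⊢
      rw [train_succ_snd, inner_sub_right, real_inner_smul_right, h1, h2]
      simp only [redTrain]
      ring
    · intro m hm p hp
      have := ih.indep m hm p hp
      simp only [redTrain, this, redGradS, if_neg hp]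

/-! ### Bounds on the movement of the attention matrix. -/

section Norms

variable {d L₀ : ℕ} {lam η : ℝ} {t₀ : ℕ}

lemma norm_train_snd_step (hlam : 0 < lam) (t : ℕ) {C : ℝ}
    (hu : ‖(train d L₀ lam η t₀ t).1‖ ≤ C) :
    ‖(train d L₀ lam η t₀ (t + 1)).2 - (train d L₀ lam η t₀ t).2‖ ≤
      |if t ≤ t₀ then η * lam else η| * (((2 * L₀ - 1 : ℕ) : ℝ) * (2 * C / lam)) := by
  rw [train_succ_snd, sub_sub_cancel_left, norm_neg, norm_smul, Real.norm_eq_abs]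
  refine mul_le_mul_of_nonneg_left ?_ (abs_nonneg _)
  refine (norm_gradW_le hlam _ _).trans ?_
  gcongr

lemma norm_train_snd_le_of_le (hη : 0 < η) (hlam : 0 < lam)
    (h0 : η * ((2 * L₀ - 1 : ℕ) : ℝ) * t₀ ≤ 1 / 3) (h1 : η * ((2 * L₀ - 1 : ℕ) : ℝ) ≤ 1 / 3)
    {t : ℕ} (ht : t ≤ t₀ + 1) :
    ‖(train d L₀ lam η t₀ t).2‖ ≤ 2 * (η * ((2 * L₀ - 1 : ℕ) : ℝ)) * t := by
  induction t with
  | zero => simp [train_zero]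
  | succ t ih =>
    have ht' : t ≤ t₀ := by omega
    have hsq := norm_train_fst_sq_le (d := d) (lam := lam) (t₀ := t₀) hη h1 t
    have hN : 0 ≤ η * ((2 * L₀ - 1 : ℕ) : ℝ) := by positivity
    have hu : ‖(train d L₀ lam η t₀ t).1‖ ≤ 1 := by
      have : η * ((2 * L₀ - 1 : ℕ) : ℝ) * t ≤ η * ((2 * L₀ - 1 : ℕ) : ℝ) * t₀ := by
        gcongr
      nlinarith [norm_nonneg (train d L₀ lam η t₀ t).1]
    have h2 := norm_train_snd_step (t₀ := t₀) hlam t hu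
    rw [if_pos ht', abs_of_pos (by positivity)] at h2
    -- The enlarged step size `η * lam` cancels the factor `1 / lam` of the attention gradient.
    have h3 : η * lam * (((2 * L₀ - 1 : ℕ) : ℝ) * (2 * 1 / lam)) =
        2 * (η * ((2 * L₀ - 1 : ℕ) : ℝ)) := by field_simp
    have h4 := norm_le_norm_add_norm_sub' (train d L₀ lam η t₀ (t + 1)).2
      (train d L₀ lam η t₀ t).2
    have h5 := ih (by omega)
    push_cast
    linarith

lemma norm_train_fst_le {x : ℝ} (hη : 0 < η) (h1 : η * ((2 * L₀ - 1 : ℕ) : ℝ) ≤ 1 / 3) {t : ℕ}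
    (hx : 0 ≤ x) (ht : η * ((2 * L₀ - 1 : ℕ) : ℝ) * t ≤ x ^ 2) :
    ‖(train d L₀ lam η t₀ t).1‖ ≤ x :=
  le_of_sq_le_sq ((norm_train_fst_sq_le hη h1 t).trans ht) hx

/-- In the second phase `‖u‖ ≤ x` and `lam = x³`, so a step has length at most `2ηN/x²`; over at
most `x²/(ηN)` steps this totals `2`. -/
lemma norm_train_snd_sub_le {x : ℝ} (hη : 0 < η) (hx : 0 < x) (hlam : lam = x ^ 3)
    (h0 : η * ((2 * L₀ - 1 : ℕ) : ℝ) * t₀ ≤ 1 / 3) (h1 : η * ((2 * L₀ - 1 : ℕ) : ℝ) ≤ 1 / 3)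
    {t : ℕ} (htt : t₀ ≤ t) (ht : η * ((2 * L₀ - 1 : ℕ) : ℝ) * t ≤ x ^ 2) :
    ‖(train d L₀ lam η t₀ t).2 - (train d L₀ lam η t₀ t₀).2‖ ≤ 3 := by
  have hlam0 : 0 < lam := by rw [hlam]; positivity
  have hN : 0 ≤ η * ((2 * L₀ - 1 : ℕ) : ℝ) := by positivity
  have key : ∀ s : ℕ, t₀ + 1 + s ≤ t →
      ‖(train d L₀ lam η t₀ (t₀ + 1 + s)).2 - (train d L₀ lam η t₀ t₀).2‖ ≤
        1 + 2 * (η * ((2 * L₀ - 1 : ℕ) : ℝ)) / x ^ 2 * s := by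
    intro s
    induction s with
    | zero =>
      intro _
      have hu : ‖(train d L₀ lam η t₀ t₀).1‖ ≤ 1 :=
        norm_train_fst_le hη h1 zero_le_one (by linarith)
      -- The step taken at `t₀` itself still has the large size `η * lam`; it accounts for the
      -- separate `1` in the bound.
      have h2 := norm_train_snd_step (t₀ := t₀) hlam0 t₀ hu
      rw [if_pos le_rfl, abs_of_pos (by positivity)] at h2
      have h3 : η * lam * (((2 * L₀ - 1 : ℕ) : ℝ) * (2 * 1 / lam)) =
          2 * (η * ((2 * L₀ - 1 : ℕ) : ℝ)) := by field_simp
      simp only [add_zero, Nat.cast_zero, mul_zero]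
      linarith
    | succ s ih =>
      intro hs
      have h5 := ih (by omega)
      have hu : ‖(train d L₀ lam η t₀ (t₀ + 1 + s)).1‖ ≤ x := by
        refine norm_train_fst_le hη h1 hx.le (le_trans ?_ ht)
        gcongr
        omega
      have h2 := norm_train_snd_step (t₀ := t₀) hlam0 (t₀ + 1 + s) hu
      rw [if_neg (by omega), abs_of_pos hη, hlam] at h2
      have h3 : η * (((2 * L₀ - 1 : ℕ) : ℝ) * (2 * x / x ^ 3)) =
          2 * (η * ((2 * L₀ - 1 : ℕ) : ℝ)) / x ^ 2 := by field_simp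
      rw [h3, ← hlam] at h2
      have h4 := norm_sub_le_norm_sub_add_norm_sub (train d L₀ lam η t₀ (t₀ + 1 + s + 1)).2
        (train d L₀ lam η t₀ (t₀ + 1 + s)).2 (train d L₀ lam η t₀ t₀).2
      rw [← add_assoc]
      push_cast
      linarith
  rcases eq_or_lt_of_le htt with rfl | hlt
  · simp
  · obtain ⟨s, rfl⟩ := Nat.exists_eq_add_of_le (Nat.succ_le_of_lt hlt)
    refine (key s le_rfl).trans ?_
    have h6 : η * ((2 * L₀ - 1 : ℕ) : ℝ) * s ≤ x ^ 2 := by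
      refine le_trans ?_ ht
      gcongr
      omega
    have h7 : 2 * (η * ((2 * L₀ - 1 : ℕ) : ℝ)) / x ^ 2 * s =
        2 * ((η * ((2 * L₀ - 1 : ℕ) : ℝ) * s) / x ^ 2) := by ring
    have h8 : (η * ((2 * L₀ - 1 : ℕ) : ℝ) * s) / x ^ 2 ≤ 1 := by
      rw [div_le_one (by positivity)]; exact h6
    rw [h7]; linarith

end Norms

/-! ### Comparison with uniform attention, and convexity in the linear layer. -/

section Uniform

variable {d L₀ : ℕ} {lam : ℝ}

lemma attnWeight_zero {m : ℕ} (X : Seq m) (i : Fin (m + 1)) :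
    attnWeight lam (0 : Mat d) X i = 1 / ((m : ℝ) + 1) := by
  simp [attnWeight, softmax, bilin]

lemma attnWeight_sub_le {m : ℕ} {W : Mat d} (hlam : 0 < lam) (hW : ‖W‖ / lam ≤ 1 / 4)
    (X : Seq m) (i : Fin (m + 1)) :
    |attnWeight lam W X i - 1 / ((m : ℝ) + 1)| ≤ 4 * (‖W‖ / lam) / ((m : ℝ) + 1) := by
  have := softmax_sub_le (fun i => bilin W (tok d X i) (tok d X (Fin.last m)) / lam) hW ?_ i
  · simpa [attnWeight] using this
  · intro j
    rw [abs_div, abs_of_pos hlam]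
    gcongr
    refine (abs_bilin_le _ _ _).trans ?_
    have h1 := norm_tok_le (d := d) X j
    have h2 := norm_tok_le (d := d) X (Fin.last m)
    have : ‖tok d X j‖ * ‖tok d X (Fin.last m)‖ ≤ 1 := mul_le_one₀ h1 (norm_nonneg _) h2
    exact mul_le_of_le_one_left (norm_nonneg _) this

lemma norm_attnOut_sub_le {m : ℕ} {W : Mat d} (hlam : 0 < lam) (hW : ‖W‖ / lam ≤ 1 / 4)
    (X : Seq m) : ‖attnOut lam W X - attnOut lam 0 X‖ ≤ 4 * (‖W‖ / lam) := by
  unfold attnOut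
  rw [← Finset.sum_sub_distrib]
  calc _ ≤ ∑ i : Fin (m + 1), 4 * (‖W‖ / lam) / ((m : ℝ) + 1) := by
        refine norm_sum_le_of_le _ fun i _ => ?_
        rw [← sub_smul, norm_smul, attnWeight_zero, Real.norm_eq_abs]
        calc _ ≤ |attnWeight lam W X i - 1 / ((m : ℝ) + 1)| * 1 := by
              gcongr; exact norm_tok_le _ _
          _ ≤ _ := by rw [mul_one]; exact attnWeight_sub_le hlam hW X i
    _ = _ := by
        simp
        field_simp

lemma norm_slope_smul_sub_le {E : Type*} [NormedAddCommGroup E] [InnerProductSpace ℝ E]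
    {y : ℝ} (hy : |y| = 1) {u w a b : E} (ha : ‖a‖ ≤ 1) :
    ‖(-(y * logSlope (y * inner ℝ u a))) • a - (-(y * logSlope (y * inner ℝ w b))) • b‖ ≤
      1 / 4 * |inner ℝ u a - inner ℝ w b| + ‖a - b‖ := by
  have e : (-(y * logSlope (y * inner ℝ u a))) • a - (-(y * logSlope (y * inner ℝ w b))) • b =
      (-(y * (logSlope (y * inner ℝ u a) - logSlope (y * inner ℝ w b)))) • a -
        (y * logSlope (y * inner ℝ w b)) • (a - b) := by
    module
  rw [e]
  refine (norm_sub_le _ _).trans ?_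
  rw [norm_smul, norm_smul, norm_neg, norm_mul, norm_mul, Real.norm_eq_abs y, hy, one_mul, one_mul,
    Real.norm_of_nonneg (logSlope_pos _).le, Real.norm_eq_abs]
  have h1 := logSlope_sub_le (y * inner ℝ u a) (y * inner ℝ w b)
  rw [← mul_sub, abs_mul, hy, one_mul] at h1
  have h2 : |logSlope (y * inner ℝ u a) - logSlope (y * inner ℝ w b)| * ‖a‖ ≤
      1 / 4 * |inner ℝ u a - inner ℝ w b| :=
    (mul_le_of_le_one_right (abs_nonneg _) ha).trans h1
  have h3 := mul_le_of_le_one_left (norm_nonneg (a - b)) (logSlope_le_one (y * inner ℝ w b))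
  linarith

lemma norm_gradU_sub_zero_le {u : Vec d} {W : Mat d} (hlam : 0 < lam) (hW : ‖W‖ / lam ≤ 1 / 4) :
    ‖gradU d L₀ lam u W - gradU d L₀ lam u 0‖ ≤
      ((2 * L₀ - 1 : ℕ) : ℝ) * (4 * (‖W‖ / lam) * (1 + ‖u‖)) := by
  unfold gradU
  rw [← Finset.sum_sub_distrib]
  calc _ ≤ ∑ m ∈ Finset.range (2 * L₀ - 1), 4 * (‖W‖ / lam) * (1 + ‖u‖) := by
        refine norm_sum_le_of_le _ fun m _ => ?_
        rw [← seqAvg_sub]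
        refine norm_seqAvg_le fun X => ?_
        unfold transformer
        refine (norm_slope_smul_sub_le (abs_cotLabel L₀ X) (norm_attnOut_le _ _ _)).trans ?_
        have h1 := norm_attnOut_sub_le hlam hW X
        rw [← inner_sub_right]
        have h2 := abs_real_inner_le_norm u (attnOut lam W X - attnOut lam 0 X)
        have h3 : ‖u‖ * ‖attnOut lam W X - attnOut lam 0 X‖ ≤ ‖u‖ * (4 * (‖W‖ / lam)) := by
          gcongr
        have h4 : 0 ≤ ‖u‖ * (4 * (‖W‖ / lam)) := by positivity
        nlinarith
    _ = _ := by simp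

lemma norm_gradU_sub_le {u w : Vec d} {W : Mat d} :
    ‖gradU d L₀ lam u W - gradU d L₀ lam w W‖ ≤ ((2 * L₀ - 1 : ℕ) : ℝ) * ‖u - w‖ := by
  unfold gradU
  rw [← Finset.sum_sub_distrib]
  calc _ ≤ ∑ m ∈ Finset.range (2 * L₀ - 1), ‖u - w‖ := by
        refine norm_sum_le_of_le _ fun m _ => ?_
        rw [← seqAvg_sub]
        refine norm_seqAvg_le fun X => ?_
        unfold transformer
        refine (norm_slope_smul_sub_le (abs_cotLabel L₀ X) (norm_attnOut_le _ _ _)).trans ?_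
        rw [← inner_sub_left, sub_self, norm_zero, add_zero]
        have h2 := abs_real_inner_le_norm (u - w) (attnOut lam W X)
        have h3 : ‖u - w‖ * ‖attnOut lam W X‖ ≤ ‖u - w‖ :=
          mul_le_of_le_one_right (norm_nonneg _) (norm_attnOut_le _ _ _)
        nlinarith [norm_nonneg (u - w)]
    _ = _ := by simp

lemma lossParity_convex (u w : Vec d) (W : Mat d) :
    lossParity d L₀ lam u W + inner ℝ (gradU d L₀ lam u W) (w - u) ≤ lossParity d L₀ lam w W := by
  rw [lossParity_eq, lossParity_eq, gradU, sum_inner, ← Finset.sum_add_distrib]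
  refine Finset.sum_le_sum fun m _ => ?_
  rw [inner_seqAvg, ← seqAvg_add]
  refine seqAvg_mono fun X => ?_
  have := logistic_convex (cotLabel L₀ X * transformer lam u W X)
    (cotLabel L₀ X * transformer lam w W X)
  unfold transformer at *
  rw [real_inner_smul_left, inner_sub_right, real_inner_comm w, real_inner_comm u]
  linarith

end Uniform

/-! ### Inexact gradient descent. -/

/-- Gradient descent on a smooth convex function with perturbed gradients. -/
lemma inexact_gradient_descent {E : Type*} [NormedAddCommGroup E] [InnerProductSpace ℝ E]
    {F : E → ℝ} {g : E → E} {M η ε D : ℝ} (hconv : ∀ x y, F x + inner ℝ (g x) (y - x) ≤ F y)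
    (hlip : ∀ x y, ‖g x - g y‖ ≤ M * ‖x - y‖) (hη : 0 < η) (hM : η * M ≤ 1 / 4)
    {u e : ℕ → E} (hu0 : u 0 = 0) (hu : ∀ t, u (t + 1) = u t - η • (g (u t) + e t)) {t : ℕ}
    (ht : 0 < t) {z : E} (he : ∀ s < t, ‖e s‖ ≤ ε) (hD : ∀ s < t, ‖u s - z‖ ≤ D) :
    F (u t) - F z ≤ ‖z‖ ^ 2 / (2 * (η * t)) + ε * D + η * ε ^ 2 + η * t * ε ^ 2 := by
  -- Descent is obtained from convexity at the new point plus the Lipschitz bound, without a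
  -- separate smoothness inequality.
  have hdesc : ∀ s < t, F (u (s + 1)) ≤
      F (u s) - η / 2 * ‖g (u s) + e s‖ ^ 2 + η * ‖e s‖ ^ 2 := by
    intro s _
    set h := g (u s) + e s with hh
    have hd : u (s + 1) - u s = -(η • h) := by rw [hu]; abel
    have h1 := hconv (u (s + 1)) (u s)
    have h2 : inner ℝ (g (u (s + 1))) (u s - u (s + 1)) = η * inner ℝ (g (u (s + 1))) h := by
      rw [← neg_sub, hd, neg_neg, real_inner_smul_right]
    have h3 : inner ℝ (g (u (s + 1))) h = inner ℝ (g (u (s + 1)) - g (u s)) h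
        + ‖h‖ ^ 2 - inner ℝ (e s) h := by
      rw [← real_inner_self_eq_norm_sq]
      nth_rewrite 3 [hh]
      rw [inner_sub_left, inner_add_left]
      ring
    have h4 := hlip (u (s + 1)) (u s)
    rw [hd, norm_neg, norm_smul, Real.norm_of_nonneg hη.le] at h4
    have h5 : -(1 / 4 * ‖h‖ ^ 2) ≤ inner ℝ (g (u (s + 1)) - g (u s)) h := by
      have h6 := neg_le_of_abs_le (abs_real_inner_le_norm (g (u (s + 1)) - g (u s)) h)
      have h7 : ‖g (u (s + 1)) - g (u s)‖ * ‖h‖ ≤ 1 / 4 * ‖h‖ ^ 2 := by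
        calc _ ≤ (M * (η * ‖h‖)) * ‖h‖ := by gcongr
          _ = (η * M) * ‖h‖ ^ 2 := by ring
          _ ≤ _ := by gcongr
      linarith
    have h8 : inner ℝ (e s) h ≤ ‖e s‖ ^ 2 + 1 / 4 * ‖h‖ ^ 2 := by
      have := real_inner_le_norm (e s) h
      nlinarith [sq_nonneg (‖e s‖ - 1 / 2 * ‖h‖)]
    have h9 : 1 / 2 * ‖h‖ ^ 2 - ‖e s‖ ^ 2 ≤ inner ℝ (g (u (s + 1))) h := by linarith
    have h10 := mul_le_mul_of_nonneg_left h9 hη.le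
    rw [h2] at h1
    linarith
  have hdist : ∀ s < t, ‖u (s + 1) - z‖ ^ 2 + 2 * η * (F (u (s + 1)) - F z) ≤
      ‖u s - z‖ ^ 2 + (2 * η * (ε * D) + 2 * η ^ 2 * ε ^ 2) := by
    intro s hs
    have hde := hdesc s hs
    set h := g (u s) + e s with hh
    have e1 : u (s + 1) - z = (u s - z) - η • h := by rw [hu]; abel
    have e2 : ‖u (s + 1) - z‖ ^ 2 =
        ‖u s - z‖ ^ 2 - 2 * (η * inner ℝ h (u s - z)) + η ^ 2 * ‖h‖ ^ 2 := by
      rw [e1, norm_sub_sq_real, real_inner_smul_right, norm_smul, Real.norm_of_nonneg hη.le,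
        mul_pow, real_inner_comm]
    have h1 := hconv (u s) z
    rw [← neg_sub, inner_neg_right] at h1
    have h2 : inner ℝ h (u s - z) = inner ℝ (g (u s)) (u s - z) + inner ℝ (e s) (u s - z) := by
      rw [hh, inner_add_left]
    have h3 := neg_le_of_abs_le (abs_real_inner_le_norm (e s) (u s - z))
    have h4 : ‖e s‖ * ‖u s - z‖ ≤ ε * D :=
      mul_le_mul (he s hs) (hD s hs) (norm_nonneg _) ((norm_nonneg _).trans (he s hs))
    have h5 : F (u s) - F z - ε * D ≤ inner ℝ h (u s - z) := by linarith
    have h6 := mul_le_mul_of_nonneg_left h5 hη.le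
    have h7 : ‖e s‖ ^ 2 ≤ ε ^ 2 := by gcongr; exact he s hs
    have h8 : η ^ 2 * ‖h‖ ^ 2 ≤ 2 * η * (F (u s) - F (u (s + 1)) + η * ε ^ 2) := by
      have : η * ‖h‖ ^ 2 ≤ 2 * (F (u s) - F (u (s + 1)) + η * ε ^ 2) := by
        have := mul_le_mul_of_nonneg_left h7 hη.le
        linarith
      nlinarith
    rw [e2]
    nlinarith
  -- Values are almost decreasing, so the bound on the average over iterates passes to the last
  -- iterate at the cost of `η t ε²`.
  have hmono : ∀ k ≤ t, F (u t) ≤ F (u (t - k)) + k * (η * ε ^ 2) := by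
    intro k
    induction k with
    | zero => simp
    | succ k ih =>
      intro hk
      have h1 := ih (by omega)
      have h2 := hdesc (t - (k + 1)) (by omega)
      rw [show t - (k + 1) + 1 = t - k by omega] at h2
      have h3 : ‖e (t - (k + 1))‖ ^ 2 ≤ ε ^ 2 := by gcongr; exact he _ (by omega)
      have h4 := mul_le_mul_of_nonneg_left h3 hη.le
      have h5 : 0 ≤ η / 2 * ‖g (u (t - (k + 1))) + e (t - (k + 1))‖ ^ 2 := by positivity
      push_cast
      linarith
  have hsum : ∀ k ≤ t, ‖u k - z‖ ^ 2 + 2 * η * (k * (F (u t) - F z - t * (η * ε ^ 2))) ≤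
      ‖z‖ ^ 2 + k * (2 * η * (ε * D) + 2 * η ^ 2 * ε ^ 2) := by
    intro k
    induction k with
    | zero => simp [hu0]
    | succ k ih =>
      intro hk
      have h1 := ih (by omega)
      have h2 := hdist k (by omega)
      have h3 := hmono (t - (k + 1)) (by omega)
      rw [show t - (t - (k + 1)) = k + 1 by omega] at h3
      have h4 : ((t - (k + 1) : ℕ) : ℝ) * (η * ε ^ 2) ≤ t * (η * ε ^ 2) := by
        gcongr; omega
      have h5 : F (u t) - F z - t * (η * ε ^ 2) ≤ F (u (k + 1)) - F z := by linarith
      have h6 := mul_le_mul_of_nonneg_left h5 (show 0 ≤ 2 * η by positivity)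
      push_cast
      nlinarith
  have hfin := hsum t le_rfl
  have ht' : (0 : ℝ) < t := by exact_mod_cast ht
  have h1 : 2 * η * (t * (F (u t) - F z - t * (η * ε ^ 2))) ≤
      ‖z‖ ^ 2 + t * (2 * η * (ε * D) + 2 * η ^ 2 * ε ^ 2) := by
    linarith [sq_nonneg ‖u t - z‖]
  have h2 : F (u t) - F z - t * (η * ε ^ 2) ≤
      (‖z‖ ^ 2 + t * (2 * η * (ε * D) + 2 * η ^ 2 * ε ^ 2)) / (2 * (η * t)) := by
    rw [le_div_iff₀ (by positivity)]
    linarith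
  have h3 : (‖z‖ ^ 2 + t * (2 * η * (ε * D) + 2 * η ^ 2 * ε ^ 2)) / (2 * (η * t)) =
      ‖z‖ ^ 2 / (2 * (η * t)) + ε * D + η * ε ^ 2 := by
    field_simp
    ring
  rw [h3] at h2
  linarith

/-! ### Nearly uniform attention and the dynamics of the first phase. -/

lemma att_pos (lam : ℝ) (S : ℕ → ℕ → Bool → ℝ) (m : ℕ) (y : Bool) (p : ℕ) :
    0 < att lam S m y p := by
  unfold att
  have : 0 < ∑ j ∈ Finset.range (m + 1), Real.exp (S m j y / lam) :=
    Finset.sum_pos (fun j _ => Real.exp_pos _) ⟨0, by simp⟩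
  positivity

lemma att_sum (lam : ℝ) (S : ℕ → ℕ → Bool → ℝ) (m : ℕ) (y : Bool) :
    ∑ p ∈ Finset.range (m + 1), att lam S m y p = 1 := by
  unfold att
  rw [← Finset.sum_div]
  have : 0 < ∑ j ∈ Finset.range (m + 1), Real.exp (S m j y / lam) :=
    Finset.sum_pos (fun j _ => Real.exp_pos _) ⟨0, by simp⟩
  exact div_self this.ne'

lemma att_zero_zero (lam : ℝ) (S : ℕ → ℕ → Bool → ℝ) (y : Bool) : att lam S 0 y 0 = 1 := by
  have := att_sum lam S 0 y
  simpa using this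

lemma out_zero (lam : ℝ) (v : ℕ → ℝ) (S : ℕ → ℕ → Bool → ℝ) (y : Bool) :
    out lam v S 0 y = v 0 := by
  simp [out, att_zero_zero]

lemma exists_agree_eq {L₀ m : ℕ} (hm : m < 2 * L₀ - 1) (h0 : m ≠ 0) (y : Bool) :
    ∃ X : Seq m, agree L₀ X = y := by
  refine ⟨fun i => if i = Fin.last m then true else y, ?_⟩
  have hk := keyPos_lt hm h0
  unfold keyPos at hk
  have hne : (⟨m - (L₀ - 1), by omega⟩ : Fin (m + 1)) ≠ Fin.last m := by
    intro h
    have := congrArg Fin.val h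
    simp at this
    omega
  simp [agree, hne]

/-- All attention weights are within a relative error `δ` of the uniform ones. -/
def NearUniform (lam : ℝ) (S : ℕ → ℕ → Bool → ℝ) (N : ℕ) (δ : ℝ) : Prop :=
  ∀ m, m ≠ 0 → m < N → ∀ y p, p ≤ m →
    |att lam S m y p - 1 / ((m : ℝ) + 1)| ≤ δ / ((m : ℝ) + 1)

lemma NearUniform.mono {lam : ℝ} {S : ℕ → ℕ → Bool → ℝ} {N : ℕ} {δ δ' : ℝ}
    (h : NearUniform lam S N δ) (hδ : δ ≤ δ') : NearUniform lam S N δ' := by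
  intro m h0 hm y p hp
  refine (h m h0 hm y p hp).trans ?_
  gcongr

lemma IsReduced.nearUniform {d L₀ : ℕ} {lam : ℝ} {u : Vec d} {W : Mat d} {v : ℕ → ℝ}
    {S : ℕ → ℕ → Bool → ℝ} (h : IsReduced d L₀ u W v S) (hlam : 0 < lam)
    (hW : ‖W‖ / lam ≤ 1 / 4) : NearUniform lam S (2 * L₀ - 1) (4 * (‖W‖ / lam)) := by
  intro m h0 hm y p hp
  obtain ⟨X, rfl⟩ := exists_agree_eq hm h0 y
  have := attnWeight_sub_le hlam hW X ⟨p, by omega⟩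
  rwa [attnWeight_eq_att lam (h.score m hm X)] at this

section Step

variable {lam : ℝ} {v : ℕ → ℝ} {S : ℕ → ℕ → Bool → ℝ} {N : ℕ} {δ r : ℝ}

lemma NearUniform.out_sub_le (h : NearUniform lam S N δ) {m : ℕ} (h0 : m ≠ 0) (hm : m < N)
    (hv : ∀ p, 1 ≤ p → |v p| ≤ r) (y : Bool) :
    |out lam v S m y - v 0 / ((m : ℝ) + 1)| ≤ δ * |v 0| / ((m : ℝ) + 1) + r := by
  have hr : 0 ≤ r := (abs_nonneg _).trans (hv 1 le_rfl)
  have hsum := att_sum lam S m y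
  rw [Finset.sum_range_succ'] at hsum
  rw [out, Finset.sum_range_succ']
  have h1 : |∑ p ∈ Finset.range m, att lam S m y (p + 1) * v (p + 1)| ≤ r := by
    calc _ ≤ ∑ p ∈ Finset.range m, att lam S m y (p + 1) * r := by
          refine (Finset.abs_sum_le_sum_abs _ _).trans (Finset.sum_le_sum fun p _ => ?_)
          rw [abs_mul, abs_of_pos (att_pos _ _ _ _ _)]
          exact mul_le_mul_of_nonneg_left (hv _ (by omega)) (att_pos _ _ _ _ _).le
      _ = (∑ p ∈ Finset.range m, att lam S m y (p + 1)) * r := by rw [Finset.sum_mul]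
      _ ≤ 1 * r := by
          have := att_pos lam S m y 0
          exact mul_le_mul_of_nonneg_right (by linarith) hr
      _ = r := one_mul r
  have h2 : |(att lam S m y 0 - 1 / ((m : ℝ) + 1)) * v 0| ≤ δ * |v 0| / ((m : ℝ) + 1) := by
    rw [abs_mul]
    calc _ ≤ δ / ((m : ℝ) + 1) * |v 0| :=
          mul_le_mul_of_nonneg_right (h m h0 hm y 0 (by omega)) (abs_nonneg _)
      _ = _ := by ring
  have e : ∑ p ∈ Finset.range m, att lam S m y (p + 1) * v (p + 1) + att lam S m y 0 * v 0 -
      v 0 / ((m : ℝ) + 1) = (att lam S m y 0 - 1 / ((m : ℝ) + 1)) * v 0 +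
        ∑ p ∈ Finset.range m, att lam S m y (p + 1) * v (p + 1) := by ring
  rw [e]
  exact (abs_add_le _ _).trans (add_le_add h2 h1)

lemma NearUniform.att_sub_le (h : NearUniform lam S N δ) {m : ℕ} (h0 : m ≠ 0) (hm : m < N)
    {p : ℕ} (hp : p ≤ m) : |att lam S m true p - att lam S m false p| ≤ 2 * δ / ((m : ℝ) + 1) := by
  have h1 := abs_le.1 (h m h0 hm true p hp)
  have h2 := abs_le.1 (h m h0 hm false p hp)
  have e : 2 * δ / ((m : ℝ) + 1) = δ / ((m : ℝ) + 1) + δ / ((m : ℝ) + 1) := by ring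
  rw [e, abs_le]
  constructor <;> linarith [h1.1, h1.2, h2.1, h2.2]

lemma NearUniform.out_true_sub_false_le (h : NearUniform lam S N δ) (_hδ : 0 ≤ δ) {m : ℕ}
    (h0 : m ≠ 0) (hm : m < N) (hv : ∀ p, 1 ≤ p → |v p| ≤ r) :
    |out lam v S m true - out lam v S m false| ≤ 2 * δ * (|v 0| / ((m : ℝ) + 1) + r) := by
  have hr : 0 ≤ r := (abs_nonneg _).trans (hv 1 le_rfl)
  rw [out, out, ← Finset.sum_sub_distrib]
  have hm0 : (0 : ℝ) < (m : ℝ) + 1 := by positivity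
  calc _ ≤ ∑ p ∈ Finset.range (m + 1), 2 * δ / ((m : ℝ) + 1) * |v p| := by
        refine (Finset.abs_sum_le_sum_abs _ _).trans (Finset.sum_le_sum fun p hp => ?_)
        have hp := Finset.mem_range.1 hp
        rw [← sub_mul, abs_mul]
        exact mul_le_mul_of_nonneg_right (h.att_sub_le h0 hm (by omega)) (abs_nonneg _)
    _ = (∑ p ∈ Finset.range m, 2 * δ / ((m : ℝ) + 1) * |v (p + 1)|) +
          2 * δ / ((m : ℝ) + 1) * |v 0| := Finset.sum_range_succ' _ _
    _ ≤ (∑ p ∈ Finset.range m, 2 * δ / ((m : ℝ) + 1) * r) + 2 * δ / ((m : ℝ) + 1) * |v 0| := by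
        gcongr with p _
        exact hv _ (by omega)
    _ = 2 * δ * (m / ((m : ℝ) + 1)) * r + 2 * δ / ((m : ℝ) + 1) * |v 0| := by
        simp; ring
    _ ≤ 2 * δ * 1 * r + 2 * δ / ((m : ℝ) + 1) * |v 0| := by
        gcongr
        rw [div_le_one hm0]; linarith
    _ = _ := by ring

/-- The terms are dominated by a telescoping sum. A length contributes its attention weight times
its output, both of order `1/(m + 1)`; summability keeps the total force of order `s`, with no loss
in `N`. -/
lemma sum_inv_sq_le (n : ℕ) :
    ∑ m ∈ Finset.range n, 1 / ((m : ℝ) + 2) ^ 2 ≤ 1 - 1 / ((n : ℝ) + 1) := by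
  induction n with
  | zero => simp
  | succ n ih =>
    rw [Finset.sum_range_succ]
    have : 1 / ((n : ℝ) + 2) ^ 2 ≤ 1 / ((n : ℝ) + 1) - 1 / ((n : ℝ) + 2) := by
      rw [div_sub_div _ _ (by positivity) (by positivity), div_le_div_iff₀ (by positivity)
        (by positivity)]
      nlinarith [(Nat.cast_nonneg n : (0 : ℝ) ≤ n)]
    push_cast
    have e : (n : ℝ) + 1 + 1 = n + 2 := by ring
    rw [e]
    linarith

/-- A single length contributes little to the gradient of the linear layer. -/
lemma NearUniform.force_le (h : NearUniform lam S N δ) (hδ : 0 ≤ δ) (hδ1 : δ ≤ 1 / 2) {s : ℝ}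
    (hs : 0 ≤ s) (hv0 : |v 0| ≤ s) (hv : ∀ p, 1 ≤ p → |v p| ≤ s / (2 * N)) {m p : ℕ} (h0 : m ≠ 0)
    (hm : m < N) (hp : p ≤ m) :
    |labelAvg m (fun y => sgn y * logSlope (sgn y * out lam v S m y) * att lam S m y p)| ≤
      s * (1 / ((m : ℝ) + 1) ^ 2) + δ / ((m : ℝ) + 1) := by
  have hm0 : (0 : ℝ) < (m : ℝ) + 1 := by positivity
  have hmN : (m : ℝ) + 1 ≤ N := by exact_mod_cast hm
  have hT : ∀ y, |out lam v S m y| ≤ 2 * s / ((m : ℝ) + 1) := by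
    intro y
    have h1 := h.out_sub_le h0 hm hv y
    have h2 := abs_sub_abs_le_abs_sub (out lam v S m y) (v 0 / ((m : ℝ) + 1))
    have h3 : |v 0 / ((m : ℝ) + 1)| ≤ s / ((m : ℝ) + 1) := by
      rw [abs_div, abs_of_pos hm0]; gcongr
    have h4 : δ * |v 0| / ((m : ℝ) + 1) ≤ 1 / 2 * s / ((m : ℝ) + 1) := by gcongr
    have h5 : s / (2 * N) ≤ s / (2 * ((m : ℝ) + 1)) := by gcongr
    have e : 2 * s / ((m : ℝ) + 1) = s / ((m : ℝ) + 1) + 1 / 2 * s / ((m : ℝ) + 1) +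
      s / (2 * ((m : ℝ) + 1)) := by field_simp; ring
    linarith
  have ha : att lam S m true p ≤ 2 / ((m : ℝ) + 1) := by
    have h1 := (abs_le.1 (h m h0 hm true p hp)).2
    have h2 : δ / ((m : ℝ) + 1) ≤ 1 / ((m : ℝ) + 1) := by gcongr; linarith
    have e : 2 / ((m : ℝ) + 1) = 1 / ((m : ℝ) + 1) + 1 / ((m : ℝ) + 1) := by ring
    linarith
  have hs1 : |logSlope (out lam v S m true) - logSlope (-out lam v S m false)| ≤
      s / ((m : ℝ) + 1) := by
    refine (logSlope_sub_le _ _).trans ?_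
    rw [sub_neg_eq_add]
    have h1 := abs_add_le (out lam v S m true) (out lam v S m false)
    have h2 := hT true
    have h3 := hT false
    have e : s / ((m : ℝ) + 1) = 1 / 4 * (2 * s / ((m : ℝ) + 1) + 2 * s / ((m : ℝ) + 1)) := by
      ring
    rw [e]
    linarith
  have hd := h.att_sub_le h0 hm hp
  unfold labelAvg
  rw [if_neg h0]
  simp only [sgn_true, sgn_false, one_mul, neg_mul]
  -- The labels push in opposite directions; what survives is the difference of slopes, of order the
  -- output, and the difference of weights, of order `δ`.
  have e : (logSlope (out lam v S m true) * att lam S m true p +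
      -(logSlope (-out lam v S m false) * att lam S m false p)) / 2 =
      1 / 2 * ((logSlope (out lam v S m true) - logSlope (-out lam v S m false)) *
        att lam S m true p) + 1 / 2 * (logSlope (-out lam v S m false) *
          (att lam S m true p - att lam S m false p)) := by ring
  rw [e]
  refine (abs_add_le _ _).trans (add_le_add ?_ ?_)
  · rw [abs_mul, abs_mul, abs_of_pos (att_pos _ _ _ _ _), abs_of_pos (by norm_num : (0 : ℝ) < 1 / 2)]
    calc _ ≤ 1 / 2 * (s / ((m : ℝ) + 1) * (2 / ((m : ℝ) + 1))) := by
          gcongr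
          exact (att_pos _ _ _ _ _).le
      _ = _ := by field_simp
  · rw [abs_mul, abs_mul, abs_of_pos (logSlope_pos _), abs_of_pos (by norm_num : (0 : ℝ) < 1 / 2)]
    calc _ ≤ 1 / 2 * (1 * (2 * δ / ((m : ℝ) + 1))) := by
          gcongr
          exact logSlope_le_one _
      _ = _ := by ring

lemma NearUniform.sum_force_le (h : NearUniform lam S N δ) (hδ : 0 ≤ δ) (hδ1 : δ ≤ 1 / 2) {s : ℝ}
    (hs : 0 ≤ s) (hv0 : |v 0| ≤ s) (hv : ∀ p, 1 ≤ p → |v p| ≤ s / (2 * N)) (hN : 0 < N) (p : ℕ) :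
    |∑ m ∈ Finset.range (N - 1), if p ≤ m + 1 then
      labelAvg (m + 1) (fun y => sgn y * logSlope (sgn y * out lam v S (m + 1) y) *
        att lam S (m + 1) y p) else 0| ≤ s + δ * N := by
  calc _ ≤ ∑ m ∈ Finset.range (N - 1), (s * (1 / ((m : ℝ) + 2) ^ 2) + δ) := by
        refine (Finset.abs_sum_le_sum_abs _ _).trans (Finset.sum_le_sum fun m hm => ?_)
        have hm := Finset.mem_range.1 hm
        split_ifs with hp
        · have h1 := h.force_le hδ hδ1 hs hv0 hv (m := m + 1) (p := p) (by omega) (by omega) hp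
          push_cast at h1
          have e : (m : ℝ) + 1 + 1 = m + 2 := by ring
          rw [e] at h1
          have h2 : δ / ((m : ℝ) + 2) ≤ δ := by
            apply div_le_self hδ
            have : (0 : ℝ) ≤ m := Nat.cast_nonneg m
            linarith
          linarith
        · rw [abs_zero]; positivity
    _ = s * ∑ m ∈ Finset.range (N - 1), (1 / ((m : ℝ) + 2) ^ 2) + δ * ((N - 1 : ℕ) : ℝ) := by
        rw [Finset.sum_add_distrib, ← Finset.mul_sum]
        simp [mul_comm]
    _ ≤ s * 1 + δ * N := by
        have h1 := sum_inv_sq_le (N - 1)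
        have h2 : (0 : ℝ) ≤ 1 / (((N - 1 : ℕ) : ℝ) + 1) := by positivity
        have h3 : ((N - 1 : ℕ) : ℝ) ≤ N := by exact_mod_cast Nat.sub_le _ _
        gcongr
        linarith
    _ = _ := by ring

end Step

lemma redGradU_eq {L₀ : ℕ} (hL : 1 ≤ L₀) (lam : ℝ) (v : ℕ → ℝ) (S : ℕ → ℕ → Bool → ℝ) (p : ℕ) :
    redGradU L₀ lam v S p = -(1 / 2) * ((∑ m ∈ Finset.range (2 * L₀ - 1 - 1),
      if p ≤ m + 1 then labelAvg (m + 1) (fun y => sgn y *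
        logSlope (sgn y * out lam v S (m + 1) y) * att lam S (m + 1) y p) else 0) +
      if p = 0 then logSlope (v 0) else 0) := by
  unfold redGradU
  rw [show 2 * L₀ - 1 = 2 * L₀ - 1 - 1 + 1 by omega, Finset.sum_range_succ']
  congr 2
  by_cases hp : p = 0
  · subst hp
    simp [labelAvg, out_zero, att_zero_zero]
  · rw [if_neg (by omega), if_neg hp]

/-- Early behaviour of the position values. -/
lemma redTrain_fst_bounds {L₀ : ℕ} (hL : 1 ≤ L₀) {lam η : ℝ} {t₀ : ℕ} (hη : 0 < η) {δ : ℝ}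
    (hδ : 0 ≤ δ) (hδN : δ * ((2 * L₀ - 1 : ℕ) : ℝ) ^ 2 ≤ 1 / 64) {T : ℕ}
    (hT : η * ((2 * L₀ - 1 : ℕ) : ℝ) * T ≤ 1 / 64)
    (hS : ∀ t ≤ T, NearUniform lam (redTrain L₀ lam η t₀ t).2 (2 * L₀ - 1) δ) :
    ∀ t ≤ T, (η * t / 8 ≤ (redTrain L₀ lam η t₀ t).1 0 ∧
      (redTrain L₀ lam η t₀ t).1 0 ≤ η * t) ∧
      ∀ p, 1 ≤ p → |(redTrain L₀ lam η t₀ t).1 p| ≤ η * t / (64 * ((2 * L₀ - 1 : ℕ) : ℝ)) := by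
  intro t
  set N := 2 * L₀ - 1 with hNdef
  have hN1 : 1 ≤ N := by omega
  have hNR : (1 : ℝ) ≤ N := by exact_mod_cast hN1
  induction t with
  | zero => intro _; simp [redTrain]
  | succ t ih =>
    intro ht
    obtain ⟨⟨h1, h2⟩, h3⟩ := ih (by omega)
    set v := (redTrain L₀ lam η t₀ t).1 with hv
    set S := (redTrain L₀ lam η t₀ t).2 with hSd
    set s := η * t with hs
    have hs0 : 0 ≤ s := by positivity
    have hsN : s * N ≤ 1 / 64 := by
      refine le_trans ?_ hT
      have : (t : ℝ) ≤ T := by exact_mod_cast (by omega : t ≤ T)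
      calc s * N = η * N * t := by ring
        _ ≤ _ := by gcongr
    have hδ2 : δ * N ≤ 1 / 64 := by nlinarith
    have hδ1 : δ ≤ 1 / 64 := by nlinarith
    have hs1 : s ≤ 1 / 64 := by nlinarith
    have hvp : ∀ p, 1 ≤ p → |v p| ≤ s / (2 * N) := fun p hp => (h3 p hp).trans (by
      gcongr; norm_num)
    have hf := fun p => (hS t (by omega)).sum_force_le hδ (by linarith) hs0
      (by rw [abs_of_nonneg (le_trans (by positivity) h1)]; exact h2) hvp hN1 p
    have hstep : ∀ p, (redTrain L₀ lam η t₀ (t + 1)).1 p = v p - η * redGradU L₀ lam v S p :=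
      fun p => rfl
    push_cast
    refine ⟨?_, ?_⟩
    · have hf0 := abs_le.1 (hf 0)
      rw [hstep, redGradU_eq hL, if_pos rfl]
      set B := ∑ m ∈ Finset.range (2 * L₀ - 1 - 1), if 0 ≤ m + 1 then
        labelAvg (m + 1) (fun y => sgn y * logSlope (sgn y * out lam v S (m + 1) y) *
        att lam S (m + 1) y 0) else 0
      have hB1 : -(1 / 32) ≤ B := by have := hf0.1; linarith
      have hB2 : B ≤ 1 / 32 := by have := hf0.2; linarith
      have hl1 : logSlope (v 0) ≤ 1 := logSlope_le_one _
      -- The length-one sequence supplies an uncancelled force of about `1/2`, against which the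
      -- other lengths (at most `1/32`) are negligible.
      have hl2 : 1 / 2 - 1 / 64 ≤ logSlope (v 0) := by
        have hv0 : 0 ≤ v 0 := le_trans (by positivity) h1
        have h4 := (abs_le.1 (logSlope_sub_le (v 0) 0)).1
        rw [sub_zero, abs_of_nonneg hv0, logSlope_zero] at h4
        linarith
      have e : η * ((t : ℝ) + 1) = s + η := by rw [hs]; ring
      rw [e]
      constructor <;> nlinarith
    · intro p hp
      have hfp := hf p
      rw [hstep, redGradU_eq hL, if_neg (by omega), add_zero]
      set B := ∑ m ∈ Finset.range (2 * L₀ - 1 - 1), if p ≤ m + 1 then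
        labelAvg (m + 1) (fun y => sgn y * logSlope (sgn y * out lam v S (m + 1) y) *
        att lam S (m + 1) y p) else 0
      have h4 := h3 p hp
      have h5 : |η * (-(1 / 2) * B)| ≤ η / (64 * N) := by
        have h0 : |-(1 / 2) * B| = 1 / 2 * |B| := by rw [abs_mul]; norm_num
        rw [abs_mul, abs_of_pos hη, h0, div_eq_mul_one_div η]
        refine mul_le_mul_of_nonneg_left ?_ hη.le
        rw [le_div_iff₀ (by positivity)]
        have h6 : |B| * N ≤ (s + δ * N) * N := mul_le_mul_of_nonneg_right hfp (by positivity)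
        have h7 : (s + δ * N) * N = s * N + δ * N ^ 2 := by ring
        linarith
      have e : η * ((t : ℝ) + 1) / (64 * N) = s / (64 * N) + η / (64 * N) := by rw [hs]; ring
      rw [e]
      have h8 := abs_sub (v p) (η * (-(1 / 2) * B))
      linarith

section Step

variable {lam : ℝ} {v : ℕ → ℝ} {S : ℕ → ℕ → Bool → ℝ} {L₀ : ℕ} {δ : ℝ}

/-- The relative error `9/64` is `1/64` from the attention weights plus `1/8` from the values at
later positions. -/
lemma NearUniform.out_mem {N : ℕ} (h : NearUniform lam S N δ) (hδ1 : δ ≤ 1 / 64) (hv0 : 0 < v 0)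
    (hv : ∀ p, 1 ≤ p → |v p| ≤ v 0 / (8 * N)) {m : ℕ} (h0 : m ≠ 0) (hm : m < N) (y : Bool) :
    |out lam v S m y - v 0 / ((m : ℝ) + 1)| ≤ 9 / 64 * (v 0 / ((m : ℝ) + 1)) := by
  have hmN : (m : ℝ) + 1 ≤ N := by exact_mod_cast hm
  have h1 := h.out_sub_le h0 hm hv y
  rw [abs_of_pos hv0] at h1
  have h2 : δ * v 0 / ((m : ℝ) + 1) ≤ 1 / 64 * v 0 / ((m : ℝ) + 1) := by gcongr
  have h3 : v 0 / (8 * N) ≤ v 0 / (8 * ((m : ℝ) + 1)) := by gcongr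
  have e : 9 / 64 * (v 0 / ((m : ℝ) + 1)) = 1 / 64 * v 0 / ((m : ℝ) + 1) +
    v 0 / (8 * ((m : ℝ) + 1)) := by field_simp; norm_num
  linarith

/-- While the key position is the first one, its score separates the two labels. -/
lemma NearUniform.redGradS_first (h : NearUniform lam S (2 * L₀ - 1) δ) (hδ : 0 ≤ δ)
    (hδ1 : δ ≤ 1 / 64) (hv0 : 0 < v 0) (hv1 : v 0 ≤ 1 / 64)
    (hv : ∀ p, 1 ≤ p → |v p| ≤ v 0 / (8 * ((2 * L₀ - 1 : ℕ) : ℝ))) {m : ℕ} (h0 : m ≠ 0)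
    (hm : m < L₀) :
    redGradS L₀ lam v S m 1 true < redGradS L₀ lam v S m 0 true ∧
      redGradS L₀ lam v S m 0 false < redGradS L₀ lam v S m 1 true := by
  have hmN : m < 2 * L₀ - 1 := by omega
  have hmN' : (m : ℝ) + 1 ≤ ((2 * L₀ - 1 : ℕ) : ℝ) := by exact_mod_cast hmN
  have hm2 : (2 : ℝ) ≤ (m : ℝ) + 1 := by
    have : (1 : ℝ) ≤ m := by exact_mod_cast Nat.one_le_iff_ne_zero.2 h0
    linarith
  have hk : keyPos L₀ m = 0 := by unfold keyPos; omega
  have ho := fun y => abs_le.1 (h.out_mem hδ1 hv0 hv h0 hmN y)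
  have hdT := h.out_true_sub_false_le hδ h0 hmN hv
  have ha0 := fun y => abs_le.1 (h m h0 hmN y 0 (by omega))
  have ha1 := fun y => abs_le.1 (h m h0 hmN y 1 (by omega))
  have hda := h.att_sub_le h0 hmN (p := 1) (by omega)
  have hv1p := hv 1 le_rfl
  have hr : v 0 / (8 * ((2 * L₀ - 1 : ℕ) : ℝ)) ≤ 1 / 8 * (v 0 / ((m : ℝ) + 1)) := by
    have e : 1 / 8 * (v 0 / ((m : ℝ) + 1)) = v 0 / (8 * ((m : ℝ) + 1)) := by field_simp
    rw [e]
    gcongr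
  rw [abs_of_pos hv0] at hdT
  set Tp := out lam v S m true with hTp
  set Tm := out lam v S m false with hTm
  set A := (1 : ℝ) / ((m : ℝ) + 1) with hA
  have hA0 : 0 < A := by positivity
  have hA1 : A ≤ 1 / 2 := by rw [hA, div_le_div_iff₀ (by positivity) (by norm_num)]; linarith
  have eA : v 0 / ((m : ℝ) + 1) = A * v 0 := by rw [hA]; ring
  have eD : δ / ((m : ℝ) + 1) = A * δ := by rw [hA]; ring
  have eD2 : 2 * δ / ((m : ℝ) + 1) = 2 * (A * δ) := by rw [hA]; ring
  rw [eA] at hr hdT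
  rw [eD2] at hda
  simp only [eA] at ho
  simp only [eD] at ha0 ha1
  have hAv : 0 < A * v 0 := by positivity
  have hAv2 : A * v 0 ≤ 1 / 2 * v 0 := by gcongr
  have hAδ : A * δ ≤ A * (1 / 64) := by gcongr
  have hop := ho true
  have hom := ho false
  rw [← hTp] at hop
  rw [← hTm] at hom
  have hsl : ∀ x : ℝ, |x| ≤ 1 / 64 → 1 / 2 - 1 / 256 ≤ logSlope x := by
    intro x hx
    have h4 := (abs_le.1 (logSlope_sub_le x 0)).1
    rw [sub_zero, logSlope_zero] at h4
    linarith
  have hTp1 : |Tp| ≤ 1 / 64 := by rw [abs_le]; constructor <;> linarith [hop.1, hop.2]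
  have hTm1 : |-Tm| ≤ 1 / 64 := by rw [abs_le]; constructor <;> linarith [hom.1, hom.2]
  set Λ := labelAvg m (scoreForce lam v S m 1) with hΛ
  have hΛb : |Λ| ≤ A * v 0 * (1 / 16) := by
    -- Telescoping between the labels changes one factor at a time: slope, weight, output.
    have e : Λ = 1 / 2 * ((logSlope Tp - logSlope (-Tm)) * att lam S m true 1 * (v 1 - Tp)) +
        1 / 2 * (logSlope (-Tm) * (att lam S m true 1 - att lam S m false 1) * (v 1 - Tp)) +
        1 / 2 * (logSlope (-Tm) * att lam S m false 1 * (Tm - Tp)) := by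
      rw [hΛ, labelAvg, if_neg h0]
      simp only [scoreForce, sgn_true, sgn_false, one_mul, neg_mul, ← hTp, ← hTm]
      ring
    have hvT : |v 1 - Tp| ≤ 82 / 64 * (A * v 0) := by
      have := abs_le.1 hv1p
      rw [abs_le]; constructor <;> linarith [hop.1, hop.2, this.1, this.2]
    have hs1 : |logSlope Tp - logSlope (-Tm)| ≤ 1 / 128 := by
      refine (logSlope_sub_le _ _).trans ?_
      have h5 : |Tp - -Tm| ≤ 1 / 32 := by
        refine (abs_sub _ _).trans ?_
        linarith
      linarith
    have hatt : ∀ y, att lam S m y 1 ≤ 65 / 64 * A := fun y => by linarith [(ha1 y).2]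
    have hatt0 : ∀ y, 0 < att lam S m y 1 := fun y => att_pos _ _ _ _ _
    have hl := logSlope_le_one (-Tm)
    have hl0 := logSlope_pos (-Tm)
    have t1 : |1 / 2 * ((logSlope Tp - logSlope (-Tm)) * att lam S m true 1 * (v 1 - Tp))| ≤
        1 / 2 * (1 / 128 * (65 / 64 * (1 / 2)) * (82 / 64 * (A * v 0))) := by
      rw [abs_mul, abs_mul, abs_mul, abs_of_pos (hatt0 true),
        abs_of_pos (by norm_num : (0 : ℝ) < 1 / 2)]
      have := hatt true
      have := hatt0 true
      gcongr
      linarith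
    have t2 : |1 / 2 * (logSlope (-Tm) * (att lam S m true 1 - att lam S m false 1) *
        (v 1 - Tp))| ≤ 1 / 2 * (1 * (2 * (1 / 2 * (1 / 64))) * (82 / 64 * (A * v 0))) := by
      rw [abs_mul, abs_mul, abs_mul, abs_of_pos hl0, abs_of_pos (by norm_num : (0 : ℝ) < 1 / 2)]
      have : |att lam S m true 1 - att lam S m false 1| ≤ 2 * (1 / 2 * (1 / 64)) := by
        refine hda.trans ?_
        linarith
      gcongr
    have t3 : |1 / 2 * (logSlope (-Tm) * att lam S m false 1 * (Tm - Tp))| ≤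
        1 / 2 * (1 * (65 / 64 * (1 / 2)) * (2 * (1 / 64) * (9 / 8 * (A * v 0)))) := by
      rw [abs_mul, abs_mul, abs_mul, abs_of_pos hl0, abs_of_pos (hatt0 false),
        abs_of_pos (by norm_num : (0 : ℝ) < 1 / 2)]
      have h6 : |Tm - Tp| ≤ 2 * (1 / 64) * (9 / 8 * (A * v 0)) := by
        rw [abs_sub_comm]
        refine hdT.trans ?_
        gcongr
        linarith
      have := hatt false
      have := hatt0 false
      gcongr
      linarith
    rw [e]
    refine (abs_add_three _ _ _).trans ?_
    linarith
  have hG1 : |redGradS L₀ lam v S m 1 true| ≤ A * v 0 * (1 / 32) := by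
    -- For `m = 1` position `1` is the last one, with factor `1/2` instead of `1/4`; the bound
    -- covers both cases.
    have hle : |redGradS L₀ lam v S m 1 true| ≤ |Λ| / 2 := by
      unfold redGradS
      rw [hk]
      split_ifs with h1 h2
      · rw [abs_div, abs_two]
      · exact h2.elim
      · rw [abs_div]
        have : |(4 : ℝ)| = 4 := by norm_num
        rw [this]
        linarith [abs_nonneg Λ]
    linarith
  have hG0 : ∀ y, redGradS L₀ lam v S m 0 y = scoreForce lam v S m 0 y / 4 := by
    intro y
    unfold redGradS
    rw [hk, if_neg (by omega), if_pos rfl]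
  -- At the key position the labels do not cancel: slope about `1/2`, weight about `A`, and `v 0 -
  -- T` a fixed fraction of `v 0` because `A ≤ 1/2`.
  have hbig : ∀ (x φ T : ℝ), 1 / 2 - 1 / 256 ≤ x → A - A * δ ≤ φ →
      T ≤ 73 / 64 * (A * v 0) → A * v 0 * (1 / 32) < x * φ * (v 0 - T) / 4 := by
    intro x φ T hx hφ hT
    have hφ' : 63 / 64 * A ≤ φ := by linarith
    have hT' : 27 / 64 * v 0 ≤ v 0 - T := by linarith
    have : (1 / 2 - 1 / 256) * (63 / 64 * A) * (27 / 64 * v 0) ≤ x * φ * (v 0 - T) := by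
      gcongr
      · have : 0 ≤ φ := le_trans (by positivity) hφ'
        have : 0 ≤ x := le_trans (by norm_num) hx
        positivity
    linarith
  have hb1 := hbig (logSlope Tp) (att lam S m true 0) Tp (hsl _ hTp1)
    (by linarith [(ha0 true).1]) (by linarith [hop.2])
  have hb2 := hbig (logSlope (-Tm)) (att lam S m false 0) Tm (hsl _ hTm1)
    (by linarith [(ha0 false).1]) (by linarith [hom.2])
  have hG1' := abs_le.1 hG1
  rw [hG0, hG0]
  simp only [scoreForce, sgn_true, sgn_false, one_mul, neg_mul, ← hTp, ← hTm]
  constructor <;> linarith [hG1'.1, hG1'.2]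

/-- A later key position gets a larger score when the labels disagree. -/
lemma NearUniform.redGradS_key (h : NearUniform lam S (2 * L₀ - 1) δ)
    (hδ1 : δ ≤ 1 / 64) (hv0 : 0 < v 0)
    (hv : ∀ p, 1 ≤ p → |v p| ≤ v 0 / (8 * ((2 * L₀ - 1 : ℕ) : ℝ))) {m : ℕ}
    (hm : L₀ ≤ m) (hmN : m < 2 * L₀ - 1) :
    redGradS L₀ lam v S m (keyPos L₀ m) true < redGradS L₀ lam v S m (keyPos L₀ m) false := by
  have h0 : m ≠ 0 := by omega
  have hk := keyPos_lt hmN h0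
  have hk1 : 1 ≤ keyPos L₀ m := by unfold keyPos; omega
  have hmN' : (m : ℝ) + 1 ≤ ((2 * L₀ - 1 : ℕ) : ℝ) := by exact_mod_cast hmN
  have ho := fun y => abs_le.1 (h.out_mem hδ1 hv0 hv h0 hmN y)
  have hvk := (abs_le.1 (hv _ hk1)).2
  have hr : v 0 / (8 * ((2 * L₀ - 1 : ℕ) : ℝ)) ≤ 1 / 8 * (v 0 / ((m : ℝ) + 1)) := by
    have e : 1 / 8 * (v 0 / ((m : ℝ) + 1)) = v 0 / (8 * ((m : ℝ) + 1)) := by field_simp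
    rw [e]
    gcongr
  have hpos : 0 < v 0 / ((m : ℝ) + 1) := by positivity
  -- The key position is no longer the first one, so its value is below the output, which is carried
  -- by `v 0`; this reverses the sign found for the first position.
  have hneg : ∀ y, v (keyPos L₀ m) - out lam v S m y < 0 := fun y => by linarith [(ho y).1]
  have hG : ∀ y, redGradS L₀ lam v S m (keyPos L₀ m) y =
      scoreForce lam v S m (keyPos L₀ m) y / 4 := by
    intro y
    rw [redGradS, if_neg hk.ne, if_pos rfl]
  rw [hG, hG]
  simp only [scoreForce, sgn_true, sgn_false, one_mul, neg_mul]
  have h1 := mul_neg_of_pos_of_neg (mul_pos (logSlope_pos (out lam v S m true))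
    (att_pos lam S m true (keyPos L₀ m))) (hneg true)
  have h2 := mul_neg_of_pos_of_neg (mul_pos (logSlope_pos (-out lam v S m false))
    (att_pos lam S m false (keyPos L₀ m))) (hneg false)
  linarith

end Step

/-! ### Separability after the first phase. -/

/-- Order relations between attention scores which make the data separable. -/
structure ScoresSeparate (L₀ : ℕ) (S : ℕ → ℕ → Bool → ℝ) : Prop where
  first_true : ∀ m, m ≠ 0 → m < L₀ → S m 1 true < S m 0 true
  first_false : ∀ m, m ≠ 0 → m < L₀ → S m 0 false < S m 1 true
  key : ∀ m, L₀ ≤ m → m < 2 * L₀ - 1 → S m (keyPos L₀ m) true < S m (keyPos L₀ m) false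

lemma redGradS_zero (L₀ : ℕ) (lam : ℝ) (S : ℕ → ℕ → Bool → ℝ) (m p : ℕ) (y : Bool) :
    redGradS L₀ lam (fun _ => 0) S m p y = 0 := by
  have : scoreForce lam (fun _ => 0) S m p = fun _ => 0 := by
    funext y
    simp [scoreForce, out]
  simp [redGradS, this, labelAvg]

lemma scoresSeparate_redTrain {L₀ : ℕ} (hL : 1 ≤ L₀) {lam η : ℝ} {t₀ : ℕ} (hη : 0 < η)
    (hlam : 0 < lam) {δ : ℝ}
    (hδ : 0 ≤ δ) (hδN : δ * ((2 * L₀ - 1 : ℕ) : ℝ) ^ 2 ≤ 1 / 64)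
    (hT : η * ((2 * L₀ - 1 : ℕ) : ℝ) * t₀ ≤ 1 / 64) (ht₀ : 2 ≤ t₀)
    (hS : ∀ t ≤ t₀, NearUniform lam (redTrain L₀ lam η t₀ t).2 (2 * L₀ - 1) δ) :
    ScoresSeparate L₀ (redTrain L₀ lam η t₀ t₀).2 := by
  have hb := redTrain_fst_bounds hL hη hδ hδN hT hS
  have hN1 : (1 : ℝ) ≤ ((2 * L₀ - 1 : ℕ) : ℝ) := by exact_mod_cast (by omega : 1 ≤ 2 * L₀ - 1)
  have hδ1 : δ ≤ 1 / 64 := (le_mul_of_one_le_right hδ (one_le_pow₀ hN1)).trans hδN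
  have hstep : ∀ t ≤ t₀, ∀ m p y, (redTrain L₀ lam η t₀ (t + 1)).2 m p y =
      (redTrain L₀ lam η t₀ t).2 m p y + η *
        redGradS L₀ lam (redTrain L₀ lam η t₀ t).1 (redTrain L₀ lam η t₀ t).2 m p y := by
    intro t ht m p y
    simp only [redTrain, if_pos ht]
    field_simp
  have hprop : ∀ t ≤ t₀, 1 ≤ t → 0 < (redTrain L₀ lam η t₀ t).1 0 ∧
      (redTrain L₀ lam η t₀ t).1 0 ≤ 1 / 64 ∧
      ∀ p, 1 ≤ p → |(redTrain L₀ lam η t₀ t).1 p| ≤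
        (redTrain L₀ lam η t₀ t).1 0 / (8 * ((2 * L₀ - 1 : ℕ) : ℝ)) := by
    intro t ht h1
    obtain ⟨⟨h2, h3⟩, h4⟩ := hb t ht
    have ht1 : (1 : ℝ) ≤ t := by exact_mod_cast h1
    have ht2 : (t : ℝ) ≤ t₀ := by exact_mod_cast ht
    refine ⟨lt_of_lt_of_le (by positivity) h2, ?_, fun p hp => (h4 p hp).trans ?_⟩
    · refine h3.trans (le_trans ?_ hT)
      calc η * t ≤ η * 1 * t₀ := by rw [mul_one]; gcongr
        _ ≤ _ := by gcongr
    · have e : η * t / (64 * ((2 * L₀ - 1 : ℕ) : ℝ)) =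
        (η * t / 8) / (8 * ((2 * L₀ - 1 : ℕ) : ℝ)) := by field_simp; norm_num
      rw [e]
      gcongr
  -- The step at `t = 0` leaves the scores unchanged because `u₀ = 0`; the first separating step is
  -- the one at `t = 1`, hence `2 ≤ t₀`.
  have hone : ∀ m p y, (redTrain L₀ lam η t₀ 1).2 m p y = 0 := by
    intro m p y
    have := hstep 0 (by omega) m p y
    rw [zero_add] at this
    rw [this]
    have h0 : redTrain L₀ lam η t₀ 0 = (fun _ => 0, fun _ _ _ => 0) := rfl
    rw [h0, redGradS_zero]
    simp
  have key : ∀ t, t + 2 ≤ t₀ → ScoresSeparate L₀ (redTrain L₀ lam η t₀ (t + 2)).2 := by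
    intro t
    induction t with
    | zero =>
      intro _
      obtain ⟨h1, h2, h3⟩ := hprop 1 (by omega) le_rfl
      have hs := hstep 1 (by omega)
      simp only [hone, zero_add] at hs
      refine ⟨fun m h0 hm => ?_, fun m h0 hm => ?_, fun m hm hmN => ?_⟩
      · have := ((hS 1 (by omega)).redGradS_first hδ hδ1 h1 h2 h3 h0 hm).1
        rw [hs, hs]
        gcongr
      · have := ((hS 1 (by omega)).redGradS_first hδ hδ1 h1 h2 h3 h0 hm).2
        rw [hs, hs]
        gcongr
      · have := (hS 1 (by omega)).redGradS_key hδ1 h1 h3 hm hmN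
        rw [hs, hs]
        gcongr
    | succ t ih =>
      intro ht
      have ih := ih (by omega)
      obtain ⟨h1, h2, h3⟩ := hprop (t + 2) (by omega) (by omega)
      have hs := hstep (t + 2) (by omega)
      rw [show t + 1 + 2 = t + 2 + 1 by omega]
      refine ⟨fun m h0 hm => ?_, fun m h0 hm => ?_, fun m hm hmN => ?_⟩
      · have := ((hS (t + 2) (by omega)).redGradS_first hδ hδ1 h1 h2 h3 h0 hm).1
        have := ih.first_true m h0 hm
        rw [hs, hs]
        gcongr
      · have := ((hS (t + 2) (by omega)).redGradS_first hδ hδ1 h1 h2 h3 h0 hm).2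
        have := ih.first_false m h0 hm
        rw [hs, hs]
        gcongr
      · have := (hS (t + 2) (by omega)).redGradS_key hδ1 h1 h3 hm hmN
        have := ih.key m hm hmN
        rw [hs, hs]
        gcongr
  obtain ⟨s, rfl⟩ := Nat.exists_eq_add_of_le' ht₀
  exact key s le_rfl

/-- Attention output up to normalisation. -/
noncomputable def rawOut (lam : ℝ) (v : ℕ → ℝ) (S : ℕ → ℕ → Bool → ℝ) (m : ℕ) (y : Bool) : ℝ :=
  ∑ p ∈ Finset.range (m + 1), Real.exp (S m p y / lam) * v p

lemma out_eq_rawOut_div (lam : ℝ) (v : ℕ → ℝ) (S : ℕ → ℕ → Bool → ℝ) (m : ℕ) (y : Bool) :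
    out lam v S m y =
      rawOut lam v S m y / ∑ j ∈ Finset.range (m + 1), Real.exp (S m j y / lam) := by
  unfold out rawOut att
  rw [Finset.sum_div]
  refine Finset.sum_congr rfl fun p _ => by ring

lemma sgn_mul_out_pos {lam : ℝ} {v : ℕ → ℝ} {S : ℕ → ℕ → Bool → ℝ} {m : ℕ} {y : Bool}
    (h : 0 < sgn y * rawOut lam v S m y) : 0 < sgn y * out lam v S m y := by
  have : 0 < ∑ j ∈ Finset.range (m + 1), Real.exp (S m j y / lam) :=
    Finset.sum_pos (fun j _ => Real.exp_pos _) ⟨0, by simp⟩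
  rw [out_eq_rawOut_div, ← mul_div_assoc]
  positivity

lemma rawOut_congr {lam : ℝ} {v w : ℕ → ℝ} {S : ℕ → ℕ → Bool → ℝ} {m : ℕ} {y : Bool}
    (h : ∀ p ≤ m, v p = w p) : rawOut lam v S m y = rawOut lam w S m y := by
  refine Finset.sum_congr rfl fun p hp => ?_
  rw [h p (by have := Finset.mem_range.1 hp; omega)]

section Separation

variable {L₀ : ℕ} {lam : ℝ} {S : ℕ → ℕ → Bool → ℝ}

/-- With values `1, -1, -δ, -δ, …` the raw output is the difference of the exponentiated scores at
positions `0` and `1`, which has the sign of the label, minus a multiple of `δ`. A small `δ`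
preserves the positive sign and only reinforces the negative one. The later values are made negative
for use at the longer lengths. -/
lemma ScoresSeparate.exists_initial (hlam : 0 < lam) (h : ScoresSeparate L₀ S)
    (hind : ∀ m < 2 * L₀ - 1, ∀ p, p ≠ keyPos L₀ m → S m p true = S m p false) :
    ∃ v : ℕ → ℝ, v 0 = 1 ∧ (∀ p, 1 ≤ p → v p < 0) ∧
      ∀ m, m ≠ 0 → m < L₀ → ∀ y, 0 < sgn y * rawOut lam v S m y := by
  let B : ℕ → ℝ := fun m => ∑ p ∈ Finset.range (m - 1), Real.exp (S m (p + 1 + 1) true / lam)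
  have hev : ∀ᶠ δ : ℝ in nhdsWithin 0 (Set.Ioi 0), ∀ m ∈ Finset.range L₀, m ≠ 0 →
      δ * B m < Real.exp (S m 0 true / lam) - Real.exp (S m 1 true / lam) := by
    rw [Filter.eventually_all_finset]
    intro m hm
    by_cases h0 : m = 0
    · simp [h0]
    · have ht : Filter.Tendsto (fun δ : ℝ => δ * B m) (nhdsWithin 0 (Set.Ioi 0)) (nhds 0) := by
        have : Filter.Tendsto (fun δ : ℝ => δ * B m) (nhds 0) (nhds (0 * B m)) :=
          (continuous_id.mul continuous_const).tendsto 0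
        rw [zero_mul] at this
        exact this.mono_left nhdsWithin_le_nhds
      have hpos : 0 < Real.exp (S m 0 true / lam) - Real.exp (S m 1 true / lam) := by
        have := h.first_true m h0 (Finset.mem_range.1 hm)
        rw [sub_pos, Real.exp_lt_exp]
        gcongr
      filter_upwards [ht.eventually_lt_const hpos] with δ hδ _ using hδ
  obtain ⟨δ, hδ, hδ0⟩ := (hev.and self_mem_nhdsWithin).exists
  have hδ0 : 0 < δ := hδ0
  refine ⟨fun p => if p = 0 then 1 else if p = 1 then -1 else -δ, by simp, ?_, ?_⟩
  · intro p hp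
    dsimp only
    rw [if_neg (by omega)]
    split_ifs <;> linarith
  · intro m h0 hm y
    have hk : keyPos L₀ m = 0 := by unfold keyPos; omega
    have e : rawOut lam (fun p => if p = 0 then 1 else if p = 1 then -1 else -δ) S m y =
        Real.exp (S m 0 y / lam) - Real.exp (S m 1 true / lam) - δ * B m := by
      have hi : ∀ p, S m (p + 1) y = S m (p + 1) true := by
        intro p
        cases y
        · exact (hind m (by omega) (p + 1) (by omega)).symm
        · rfl
      rw [rawOut, Finset.sum_range_succ', show m = m - 1 + 1 by omega, Finset.sum_range_succ',
        show m - 1 + 1 = m by omega]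
      simp only [hi, B, Finset.mul_sum]
      simp only [Nat.add_eq_zero_iff, one_ne_zero, and_false, if_false, zero_add, if_true,
        Nat.add_eq_right, mul_one, mul_neg, Finset.sum_neg_distrib]
      have : ∑ x ∈ Finset.range (m - 1), Real.exp (S m (x + 1 + 1) true / lam) * δ =
        ∑ i ∈ Finset.range (m - 1), δ * Real.exp (S m (i + 1 + 1) true / lam) :=
        Finset.sum_congr rfl fun _ _ => mul_comm _ _
      rw [this]
      ring
    rw [e]
    cases y
    · have hlt := h.first_false m h0 hm
      have : Real.exp (S m 0 false / lam) < Real.exp (S m 1 true / lam) := by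
        rw [Real.exp_lt_exp]
        gcongr
      have hB : 0 ≤ δ * B m := by positivity
      simp only [sgn_false]
      linarith
    · have := hδ m (Finset.mem_range.2 hm) h0
      simp only [sgn_true]
      linarith

/-- Induction on the length: the newest value `v m` affects no shorter sequence. The key value is
negative and its score is larger for label `-1`, so the partial outputs of the two labels are
already ordered; `v m`, whose weight ignores the label, moves zero to their midpoint. -/
lemma ScoresSeparate.exists_separator (hL : 1 ≤ L₀) (hlam : 0 < lam) (h : ScoresSeparate L₀ S)
    (hind : ∀ m < 2 * L₀ - 1, ∀ p, p ≠ keyPos L₀ m → S m p true = S m p false) :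
    ∃ v : ℕ → ℝ, 0 < v 0 ∧
      ∀ m, m ≠ 0 → m < 2 * L₀ - 1 → ∀ y, 0 < sgn y * rawOut lam v S m y := by
  have key : ∀ n, L₀ + n ≤ 2 * L₀ - 1 → ∃ v : ℕ → ℝ, v 0 = 1 ∧ (∀ p, 1 ≤ p → p < L₀ → v p < 0) ∧
      ∀ m, m ≠ 0 → m < L₀ + n → ∀ y, 0 < sgn y * rawOut lam v S m y := by
    intro n
    induction n with
    | zero =>
      intro _
      obtain ⟨v, h1, h2, h3⟩ := h.exists_initial hlam hind
      exact ⟨v, h1, fun p hp _ => h2 p hp, h3⟩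
    | succ n ih =>
      intro hn
      obtain ⟨v, h1, h2, h3⟩ := ih (by omega)
      set m := L₀ + n with hm
      have hmN : m < 2 * L₀ - 1 := by omega
      have hkm := keyPos_lt hmN (by omega : m ≠ 0)
      have hk1 : 1 ≤ keyPos L₀ m := by unfold keyPos; omega
      have hk2 : keyPos L₀ m < L₀ := by unfold keyPos; omega
      let R : Bool → ℝ := fun y => ∑ p ∈ Finset.range m, Real.exp (S m p y / lam) * v p
      have hR : 0 < R true - R false := by
        have e : R true - R false = (Real.exp (S m (keyPos L₀ m) true / lam) -
            Real.exp (S m (keyPos L₀ m) false / lam)) * v (keyPos L₀ m) := by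
          simp only [R]
          rw [← Finset.sum_sub_distrib, Finset.sum_eq_single (keyPos L₀ m)]
          · ring
          · intro p _ hp
            rw [hind m hmN p hp]
            ring
          · intro hp
            exact absurd (Finset.mem_range.2 hkm) hp
        rw [e]
        refine mul_pos_of_neg_of_neg ?_ (h2 _ hk1 hk2)
        rw [sub_neg, Real.exp_lt_exp]
        have := h.key m (by omega) hmN
        gcongr
      let x := -(R true + R false) / (2 * Real.exp (S m m true / lam))
      have hx : Real.exp (S m m true / lam) * x = -(R true + R false) / 2 := by
        simp only [x]
        field_simp
      refine ⟨Function.update v m x, ?_, ?_, ?_⟩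
      · rw [Function.update_of_ne (by omega), h1]
      · intro p hp hpL
        rw [Function.update_of_ne (by omega)]
        exact h2 p hp hpL
      · intro m' h0 hm' y
        rcases Nat.lt_or_ge m' m with hlt | hge
        · rw [rawOut_congr (w := v) (fun p hp => Function.update_of_ne (by omega) _ _)]
          exact h3 m' h0 hlt y
        · obtain rfl : m' = m := by omega
          have e : rawOut lam (Function.update v m x) S m y =
              R y + -(R true + R false) / 2 := by
            rw [rawOut, Finset.sum_range_succ, Function.update_self]
            have hy : S m m y = S m m true := by
              cases y
              · exact (hind m hmN m (by omega)).symm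
              · rfl
            rw [hy, hx]
            congr 1
            refine Finset.sum_congr rfl fun p hp => ?_
            have := Finset.mem_range.1 hp
            rw [Function.update_of_ne (by omega)]
          rw [e]
          cases y
          · simp only [sgn_false]; linarith
          · simp only [sgn_true]; linarith
  obtain ⟨v, h1, _, h3⟩ := key (L₀ - 1) (by omega)
  exact ⟨v, by rw [h1]; norm_num, fun m h0 hm y => h3 m h0 (by omega) y⟩

end Separation

/-! ### Existence and symmetry of the max-margin vector. -/

section Margin

variable {d L₀ : ℕ} {lam : ℝ} {u : Vec d} {W : Mat d} {v : ℕ → ℝ} {S : ℕ → ℕ → Bool → ℝ}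

lemma inner_label_smul_attnOut {m : ℕ} (w : Vec d) (X : Seq m) :
    inner ℝ w (label L₀ X • attnOut lam W X) = sgn (agree L₀ X) * transformer lam w W X := by
  rw [label_eq, cotLabel_eq_sgn, real_inner_smul_right, transformer]

lemma agree_zero (X : Seq 0) : agree L₀ X = true := by simp [agree]

lemma IsReduced.exists_hasUnitMargin (hL : 1 ≤ L₀) (hd : 2 * (2 * L₀ - 1) ≤ d) (hlam : 0 < lam)
    (h : IsReduced d L₀ u W v S) (hS : ScoresSeparate L₀ S) :
    ∃ w : Vec d, HasUnitMargin L₀ lam W w := by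
  obtain ⟨w, h0, h1⟩ := hS.exists_separator hL hlam h.indep
  set f : (m : ℕ) → Seq m → ℝ :=
    fun m X => sgn (agree L₀ X) * out lam w S m (agree L₀ X) with hf
  have hpos : ∀ m < 2 * L₀ - 1, ∀ X : Seq m, 0 < f m X := by
    intro m hm X
    rcases Nat.eq_zero_or_pos m with rfl | hm0
    · simp only [hf, agree_zero, sgn_true, out_zero, one_mul]
      exact h0
    · exact sgn_mul_out_pos (h1 m (by omega) hm _)
  -- A sum of inverse margins dominates each of them, so it serves as a common scaling factor.
  set c := ∑ m ∈ Finset.range (2 * L₀ - 1), ∑ X : Seq m, (f m X)⁻¹ with hc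
  refine ⟨c • linVec d (2 * L₀ - 1) w, fun m hm X => ?_⟩
  have e : inner ℝ (c • linVec d (2 * L₀ - 1) w) (label L₀ X • attnOut lam W X) = c * f m X := by
    rw [real_inner_smul_left, inner_label_smul_attnOut,
      transformer_linVec hd hm w (h.score m hm X)]
  rw [e]
  have hle : (f m X)⁻¹ ≤ c := by
    have h2 : (f m X)⁻¹ ≤ ∑ X : Seq m, (f m X)⁻¹ :=
      Finset.single_le_sum (f := fun X : Seq m => (f m X)⁻¹)
        (fun Y _ => (inv_pos.2 (hpos m hm Y)).le) (Finset.mem_univ X)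
    refine h2.trans ?_
    exact Finset.single_le_sum (f := fun m => ∑ X : Seq m, (f m X)⁻¹)
      (fun k hk => Finset.sum_nonneg fun Y _ =>
        (inv_pos.2 (hpos k (Finset.mem_range.1 hk) Y)).le) (Finset.mem_range.2 hm)
  calc (1 : ℝ) = (f m X)⁻¹ * f m X := (inv_mul_cancel₀ (hpos m hm X).ne').symm
    _ ≤ c * f m X := mul_le_mul_of_nonneg_right hle (hpos m hm X).le

/-- The feasible set is closed and nonempty in a finite-dimensional space, so it has a point nearest
to the origin. -/
lemma exists_isMaxMargin (h : ∃ w : Vec d, HasUnitMargin L₀ lam W w) :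
    ∃ w : Vec d, IsMaxMargin L₀ lam W w := by
  have hcl : IsClosed {w : Vec d | HasUnitMargin L₀ lam W w} := by
    simp only [HasUnitMargin, Set.ofPred_forall]
    refine isClosed_iInter fun m => isClosed_iInter fun _ => isClosed_iInter fun X => ?_
    exact isClosed_le continuous_const (continuous_id.inner continuous_const)
  obtain ⟨w, hw, hmin⟩ := hcl.exists_infDist_eq_dist h (0 : Vec d)
  refine ⟨w, hw, fun x hx => ?_⟩
  have hx' : x ∈ {w : Vec d | HasUnitMargin L₀ lam W w} := hx
  have := Metric.infDist_le_dist_of_mem (x := (0 : Vec d)) hx'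
  rw [hmin, dist_zero_left, dist_zero_left] at this
  exact this

/-- There is a max-margin solution that does not distinguish the two tokens. -/
lemma IsReduced.exists_isMaxMargin_linVec (hL : 1 ≤ L₀) (hd : 2 * (2 * L₀ - 1) ≤ d)
    (hlam : 0 < lam) (h : IsReduced d L₀ u W v S) (hS : ScoresSeparate L₀ S) :
    ∃ w : ℕ → ℝ, IsMaxMargin L₀ lam W (linVec d (2 * L₀ - 1) w) := by
  obtain ⟨x, hx, hmin⟩ := exists_isMaxMargin (h.exists_hasUnitMargin hL hd hlam hS)
  -- Averaging over the two letters is an orthogonal projection, so the norm does not increase; the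
  -- new margin at `X` averages the old margins at `X` and `flipAll X`, which share a label.
  let w : ℕ → ℝ := fun p => (inner ℝ x (embed d p false) + inner ℝ x (embed d p true)) / 2
  have hnorm : ‖linVec d (2 * L₀ - 1) w‖ ≤ ‖x‖ := by
    have e : inner ℝ x (linVec d (2 * L₀ - 1) w) = ‖linVec d (2 * L₀ - 1) w‖ ^ 2 := by
      rw [norm_linVec_sq hd, linVec, inner_sum, Finset.mul_sum]
      refine Finset.sum_congr rfl fun p _ => ?_
      rw [real_inner_smul_right, pairVec, inner_add_right]
      simp only [w]
      ring
    have h1 := real_inner_le_norm x (linVec d (2 * L₀ - 1) w)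
    rw [e, sq] at h1
    by_contra hlt
    push Not at hlt
    have := mul_lt_mul_of_pos_right hlt (lt_of_le_of_lt (norm_nonneg x) hlt)
    linarith
  refine ⟨w, fun m hm X => ?_, fun z hz => hnorm.trans (hmin z hz)⟩
  have h1 := hx m hm X
  have h2 := hx m hm (flipAll X)
  rw [inner_label_smul_attnOut] at h1 h2 ⊢
  rw [agree_flipAll] at h2
  have e : transformer lam (linVec d (2 * L₀ - 1) w) W X =
      (transformer lam x W X + transformer lam x W (flipAll X)) / 2 := by
    rw [transformer_eq_sum, transformer_eq_sum, transformer_eq_sum, ← Finset.sum_add_distrib,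
      Finset.sum_div]
    refine Finset.sum_congr rfl fun i _ => ?_
    rw [attnWeight_eq_att lam (h.score m hm X), attnWeight_eq_att lam (h.score m hm (flipAll X)),
      agree_flipAll, inner_linVec_tok hd hm]
    have hf : flipAll X i = !X i := rfl
    simp only [w, tok, hf]
    cases X i <;> simp <;> ring
  rw [e]
  linarith

end Margin

/-! ### The limit direction, and its closeness to the max-margin vector. -/

/-- Sum of the first `m + 1` values. -/
noncomputable def prefixSum (v : ℕ → ℝ) (m : ℕ) : ℝ := ∑ p ∈ Finset.range (m + 1), v p

lemma norm_le_of_abs_le {d N : ℕ} (hd : 2 * N ≤ d) (hN : 1 ≤ N) {v : ℕ → ℝ} {c : ℝ} (hc : 0 ≤ c)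
    (h : ∀ p < N, |v p| ≤ c) : ‖linVec d N v‖ ≤ 2 * N * c := by
  refine le_of_sq_le_sq ?_ (by positivity)
  rw [norm_linVec_sq hd]
  have hNR : (1 : ℝ) ≤ N := by exact_mod_cast hN
  calc 2 * ∑ p ∈ Finset.range N, v p ^ 2 ≤ 2 * ∑ p ∈ Finset.range N, c ^ 2 := by
        refine mul_le_mul_of_nonneg_left (Finset.sum_le_sum fun p hp => ?_) zero_le_two
        exact sq_le_sq.2 (by rw [abs_of_nonneg hc]; exact h p (Finset.mem_range.1 hp))
    _ = 2 * N * c ^ 2 := by simp; ring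
    _ ≤ (2 * N) * (2 * N) * c ^ 2 := by
        gcongr
        all_goals linarith
    _ = _ := by ring

lemma abs_le_norm_linVec {d N : ℕ} (hd : 2 * N ≤ d) (v : ℕ → ℝ) {p : ℕ} (hp : p < N) :
    |v p| ≤ ‖linVec d N v‖ := by
  refine le_of_sq_le_sq ?_ (norm_nonneg _)
  rw [norm_linVec_sq hd, sq_abs]
  have := Finset.single_le_sum (f := fun p => v p ^ 2) (fun _ _ => sq_nonneg _)
    (Finset.mem_range.2 hp)
  have h2 : 0 ≤ v p ^ 2 := sq_nonneg _
  linarith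

/-- Values of the limit direction. -/
noncomputable def limitDir (p : ℕ) : ℝ := if p = 0 then 1 / 2 else if p = 1 then -(1 / 2) else 0

/-- Small prefix sums make `v 1` close to `-v 0` and, by differences, all later values small. The
sign of `v 0` selects the limit direction rather than its opposite. -/
lemma norm_sub_limitDir_le {d N : ℕ} (hd : 2 * N ≤ d) (hN : 2 ≤ N) {v : ℕ → ℝ} {δ : ℝ}
    (hv0 : 0 ≤ v 0) (h : ∀ m, m ≠ 0 → m < N → |prefixSum v m| ≤ δ) :
    ‖linVec d N v - ‖linVec d N v‖ • linVec d N limitDir‖ ≤ 10 * N * δ := by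
  have hδ : 0 ≤ δ := (abs_nonneg _).trans (h 1 one_ne_zero (by omega))
  have hNR : (2 : ℝ) ≤ N := by exact_mod_cast hN
  set q := linVec d N limitDir with hq
  set u := linVec d N v with hu
  set r := v 0 - v 1 with hr
  have hq1 : ‖q‖ = 1 := by
    have h2 : ‖q‖ ^ 2 = 1 := by
      rw [hq, norm_linVec_sq hd, show N = (N - 2) + 1 + 1 by omega, Finset.sum_range_succ',
        Finset.sum_range_succ']
      simp [limitDir]
      norm_num
    nlinarith [norm_nonneg q]
  have h01 : |v 0 + v 1| ≤ δ := by
    have := h 1 one_ne_zero (by omega)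
    simpa [prefixSum, Finset.sum_range_succ] using this
  have hρ : ‖u - r • q‖ ≤ 2 * N * (2 * δ) := by
    rw [hu, hq, linVec_sub_smul]
    refine norm_le_of_abs_le hd (by omega) (by positivity) fun p hp => ?_
    rcases p with _ | _ | p
    · have e : v 0 - r * limitDir 0 = (v 0 + v 1) / 2 := by simp [limitDir, hr]; ring
      rw [e, abs_div, abs_two]
      linarith [abs_nonneg (v 0 + v 1)]
    · have e : v (0 + 1) - r * limitDir (0 + 1) = (v 0 + v 1) / 2 := by
        simp [limitDir, hr]; ring
      rw [e, abs_div, abs_two]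
      linarith [abs_nonneg (v 0 + v 1)]
    · have e : v (p + 1 + 1) - r * limitDir (p + 1 + 1) =
          prefixSum v (p + 1 + 1) - prefixSum v (p + 1) := by
        rw [prefixSum, prefixSum, Finset.sum_range_succ _ (p + 1 + 1)]
        simp [limitDir]
      rw [e]
      have h1 := h (p + 1 + 1) (by omega) hp
      have h2 := h (p + 1) (by omega) (by omega)
      have := abs_sub (prefixSum v (p + 1 + 1)) (prefixSum v (p + 1))
      linarith
  have hrn : ‖r • q‖ = |r| := by rw [norm_smul, hq1, mul_one, Real.norm_eq_abs]
  have h3 := abs_norm_sub_norm_le u (r • q)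
  rw [hrn] at h3
  have hr2 : |(|r| - r)| ≤ 2 * δ := by
    have h4 := abs_le.1 h01
    rcases le_total 0 r with hr0 | hr0
    · rw [abs_of_nonneg hr0, sub_self, abs_zero]; positivity
    · rw [abs_of_nonpos hr0, abs_le]
      constructor <;> linarith [h4.1, h4.2]
  have h5 : ‖u - ‖u‖ • q‖ ≤ ‖u - r • q‖ + |(‖u‖ - r)| := by
    have e : u - ‖u‖ • q = (u - r • q) - (‖u‖ - r) • q := by module
    rw [e]
    refine (norm_sub_le _ _).trans ?_
    rw [norm_smul, hq1, mul_one, Real.norm_eq_abs]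
  have h6 : |(‖u‖ - r)| ≤ |(‖u‖ - |r|)| + |(|r| - r)| := abs_sub_le _ _ _
  nlinarith

/-- A max-margin solution for nearly uniform attention is large and close to the limit
direction. -/
lemma NearUniform.margin_bounds {d N : ℕ} (hd : 2 * N ≤ d) (hN : 2 ≤ N) {lam : ℝ}
    {S : ℕ → ℕ → Bool → ℝ} {δ : ℝ} (h : NearUniform lam S N δ) {w : ℕ → ℝ} (hw0 : 0 ≤ w 0)
    (hw : ∀ m, m ≠ 0 → m < N → ∀ y, 1 ≤ sgn y * out lam w S m y) :
    1 ≤ δ * ‖linVec d N w‖ ∧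
      ‖linVec d N w - ‖linVec d N w‖ • linVec d N limitDir‖ ≤
        10 * N * (N * (δ * ‖linVec d N w‖)) := by
  set b := ‖linVec d N w‖ with hb
  have hclose : ∀ m, m ≠ 0 → m < N → ∀ y,
      |out lam w S m y - prefixSum w m / ((m : ℝ) + 1)| ≤ δ * b := by
    intro m h0 hm y
    have hm0 : (0 : ℝ) < (m : ℝ) + 1 := by positivity
    have hδ : 0 ≤ δ / ((m : ℝ) + 1) := (abs_nonneg _).trans (h m h0 hm y 0 (by omega))
    rw [out, prefixSum, Finset.sum_div, ← Finset.sum_sub_distrib]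
    calc _ ≤ ∑ p ∈ Finset.range (m + 1), δ / ((m : ℝ) + 1) * b := by
          refine (Finset.abs_sum_le_sum_abs _ _).trans (Finset.sum_le_sum fun p hp => ?_)
          have hp := Finset.mem_range.1 hp
          have e : att lam S m y p * w p - w p / ((m : ℝ) + 1) =
            (att lam S m y p - 1 / ((m : ℝ) + 1)) * w p := by ring
          rw [e, abs_mul]
          exact mul_le_mul (h m h0 hm y p (by omega)) (abs_le_norm_linVec hd w (by omega))
            (abs_nonneg _) hδ
      _ = _ := by
          simp
          field_simp
  have hb1 : ∀ m, m ≠ 0 → m < N → 1 ≤ δ * b ∧ |prefixSum w m / ((m : ℝ) + 1)| ≤ δ * b := by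
    intro m h0 hm
    have h1 := abs_le.1 (hclose m h0 hm true)
    have h2 := abs_le.1 (hclose m h0 hm false)
    have h3 := hw m h0 hm true
    have h4 := hw m h0 hm false
    simp only [sgn_true, sgn_false, one_mul, neg_mul] at h3 h4
    rw [abs_le]
    -- One number lies within `δ * b` of an output at least `1` and of an output at most `-1`.
    refine ⟨?_, ?_, ?_⟩ <;> linarith [h1.1, h1.2, h2.1, h2.2]
  refine ⟨(hb1 1 one_ne_zero (by omega)).1, ?_⟩
  refine norm_sub_limitDir_le hd hN hw0 fun m h0 hm => ?_
  have h1 := hb1 m h0 hm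
  have hm0 : (0 : ℝ) < (m : ℝ) + 1 := by positivity
  have hmN : (m : ℝ) + 1 ≤ N := by exact_mod_cast hm
  rw [abs_div, abs_of_pos hm0, div_le_iff₀ hm0] at h1
  refine h1.2.trans ?_
  rw [mul_comm]
  have : 0 ≤ δ * b := by linarith [h1.1]
  gcongr

/-! ### Excess loss for uniform attention along the training trajectory. -/

lemma logistic_add_neg (s : ℝ) : Real.log (4 + s ^ 2 / 2) ≤ logistic s + logistic (-s) := by
  unfold logistic
  rw [neg_neg, ← Real.log_mul (by positivity) (by positivity)]
  refine Real.log_le_log (by positivity) ?_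
  have e : (1 + Real.exp (-s)) * (1 + Real.exp s) = 2 + (Real.exp s + Real.exp (-s)) := by
    have : Real.exp (-s) * Real.exp s = 1 := by rw [← Real.exp_add]; simp
    linear_combination this
  rw [e]
  rcases le_total 0 s with h | h
  · have h1 := Real.quadratic_le_exp_of_nonneg h
    have h2 := Real.add_one_le_exp (-s)
    linarith
  · have h1 := Real.quadratic_le_exp_of_nonneg (neg_nonneg.2 h)
    have h2 := Real.add_one_le_exp s
    rw [neg_sq] at h1
    linarith

lemma logistic_zero : logistic 0 = Real.log 2 := by norm_num [logistic]

/-- With `W = 0` the output ignores the label, so every length above one sees the same value with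
both signs and costs at least `log 2`; only length one can be fitted. -/
lemma lossParity_linVec_zero {d L₀ : ℕ} (hL : 1 ≤ L₀) (hd : 2 * (2 * L₀ - 1) ≤ d) (lam : ℝ)
    (v : ℕ → ℝ) :
    lossParity d L₀ lam (linVec d (2 * L₀ - 1) v) 0 =
      ∑ m ∈ Finset.range (2 * L₀ - 1 - 1),
        (logistic (prefixSum v (m + 1) / (m + 2)) + logistic (-(prefixSum v (m + 1) / (m + 2)))) / 2
        + logistic (v 0) := by
  rw [lossParity_eq]
  have key : ∀ m ∈ Finset.range (2 * L₀ - 1), seqAvg m (fun X : Seq m =>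
      logistic (cotLabel L₀ X * transformer lam (linVec d (2 * L₀ - 1) v) 0 X)) =
      labelAvg m (fun y => logistic (sgn y * (prefixSum v m / (m + 1)))) := by
    intro m hm
    have hm := Finset.mem_range.1 hm
    rw [← seqAvg_agree hm]
    congr 1
    funext X
    have h0 : ∀ i : Fin (m + 1), bilin (0 : Mat d) (tok d X i) (tok d X (Fin.last m)) =
      (fun _ _ _ => 0 : ℕ → ℕ → Bool → ℝ) m i (agree L₀ X) := by
      intro i; simp [bilin]
    rw [cotLabel_eq_sgn, transformer_linVec (L₀ := L₀) (S := fun _ _ _ => 0) hd hm v h0]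
    congr 2
    rw [out, prefixSum, Finset.sum_div]
    refine Finset.sum_congr rfl fun p _ => ?_
    simp [att]
    ring
  rw [Finset.sum_congr rfl key]
  nth_rewrite 1 [show 2 * L₀ - 1 = 2 * L₀ - 1 - 1 + 1 by omega]
  rw [Finset.sum_range_succ']
  congr 1
  · refine Finset.sum_congr rfl fun m _ => ?_
    have e : (m : ℝ) + 1 + 1 = m + 2 := by ring
    simp only [labelAvg, Nat.add_eq_zero_iff, one_ne_zero, and_false, if_false, sgn_true, sgn_false,
      one_mul, neg_mul, Nat.cast_add, Nat.cast_one, e]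
  · simp [labelAvg, prefixSum]

lemma exp_le_one_add_two_mul {x : ℝ} (h0 : 0 ≤ x) (h1 : x ≤ 1) : Real.exp x ≤ 1 + 2 * x := by
  have := (abs_le.1 (Real.abs_exp_sub_one_sub_id_le (x := x) (by rwa [abs_of_nonneg h0]))).2
  nlinarith

/-- A small excess loss forces a large first value and small prefix sums. -/
lemma of_excess_loss_le {d L₀ : ℕ} (hL : 1 ≤ L₀) (hd : 2 * (2 * L₀ - 1) ≤ d) {lam : ℝ}
    {v : ℕ → ℝ} {Δ : ℝ} (hΔ0 : 0 ≤ Δ) (hΔ : Δ ≤ 1 / 2)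
    (h : lossParity d L₀ lam (linVec d (2 * L₀ - 1) v) 0 -
      ((2 * L₀ - 1 - 1 : ℕ) : ℝ) * Real.log 2 ≤ Δ) :
    Real.exp (-v 0) ≤ 2 * Δ ∧ ∀ m, m ≠ 0 → m < 2 * L₀ - 1 →
      prefixSum v m ^ 2 ≤ ((2 * L₀ - 1 : ℕ) : ℝ) ^ 2 * (32 * Δ) := by
  rw [lossParity_linVec_zero hL hd] at h
  set f : ℕ → ℝ := fun m => (logistic (prefixSum v (m + 1) / (m + 2)) +
    logistic (-(prefixSum v (m + 1) / (m + 2)))) / 2 - Real.log 2 with hf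
  have h4 : Real.log 4 = 2 * Real.log 2 := by
    rw [show (4 : ℝ) = 2 ^ 2 by norm_num, Real.log_pow]; norm_num
  have hf1 : ∀ m, Real.log (1 + (prefixSum v (m + 1) / (m + 2)) ^ 2 / 8) / 2 ≤ f m := by
    intro m
    have h1 := logistic_add_neg (prefixSum v (m + 1) / (m + 2))
    have e : 4 + (prefixSum v (m + 1) / (m + 2)) ^ 2 / 2 =
      4 * (1 + (prefixSum v (m + 1) / (m + 2)) ^ 2 / 8) := by ring
    rw [e, Real.log_mul (by norm_num) (by positivity), h4] at h1
    simp only [hf]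
    linarith
  have hf0 : ∀ m, 0 ≤ f m := by
    intro m
    refine le_trans ?_ (hf1 m)
    have : 0 ≤ Real.log (1 + (prefixSum v (m + 1) / (m + 2)) ^ 2 / 8) :=
      Real.log_nonneg (by linarith [sq_nonneg (prefixSum v (m + 1) / ((m : ℝ) + 2))])
    positivity
  have hs : ∑ m ∈ Finset.range (2 * L₀ - 1 - 1), f m + logistic (v 0) ≤ Δ := by
    simp only [hf, Finset.sum_sub_distrib, Finset.sum_const, Finset.card_range, nsmul_eq_mul]
    linarith
  have hs0 : 0 ≤ ∑ m ∈ Finset.range (2 * L₀ - 1 - 1), f m := Finset.sum_nonneg fun m _ => hf0 m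
  constructor
  · have h1 : logistic (v 0) ≤ Δ := by linarith
    unfold logistic at h1
    rw [Real.log_le_iff_le_exp (by positivity)] at h1
    have := exp_le_one_add_two_mul hΔ0 (by linarith)
    linarith
  · intro m h0 hm
    obtain ⟨k, rfl⟩ := Nat.exists_eq_succ_of_ne_zero h0
    have h1 : f k ≤ ∑ m ∈ Finset.range (2 * L₀ - 1 - 1), f m :=
      Finset.single_le_sum (fun m _ => hf0 m) (Finset.mem_range.2 (by omega))
    have h2 := logistic_nonneg (v 0)
    have h3 := hf1 k
    have h5 : Real.log (1 + (prefixSum v (k + 1) / (k + 2)) ^ 2 / 8) ≤ 2 * Δ := by linarith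
    rw [Real.log_le_iff_le_exp (by positivity)] at h5
    have h6 := exp_le_one_add_two_mul (x := 2 * Δ) (by linarith) (by linarith)
    have h7 : (prefixSum v (k + 1) / (k + 2)) ^ 2 ≤ 32 * Δ := by linarith
    have hk : (k : ℝ) + 2 ≤ ((2 * L₀ - 1 : ℕ) : ℝ) := by exact_mod_cast hm
    have e : prefixSum v (k + 1) ^ 2 = ((k : ℝ) + 2) ^ 2 * (prefixSum v (k + 1) / (k + 2)) ^ 2 := by
      field_simp
    rw [Nat.succ_eq_add_one, e]
    gcongr

/-- Comparison point for gradient descent. -/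
noncomputable def compareDir (R : ℝ) (p : ℕ) : ℝ := if p = 0 then R else if p = 1 then -R else 0

lemma prefixSum_compareDir (R : ℝ) (m : ℕ) : prefixSum (compareDir R) (m + 1) = 0 := by
  rw [prefixSum, Finset.sum_range_succ', Finset.sum_range_succ']
  simp [compareDir]

lemma norm_compareDir_le {d N : ℕ} (hd : 2 * N ≤ d) {R : ℝ} (hR : 0 ≤ R) :
    ‖linVec d N (compareDir R)‖ ≤ 2 * R := by
  refine le_of_sq_le_sq ?_ (by positivity)
  rw [norm_linVec_sq hd]
  have e : ∀ p, compareDir R p ^ 2 = (if p = 0 then R ^ 2 else 0) + if p = 1 then R ^ 2 else 0 := by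
    intro p
    unfold compareDir
    split_ifs with h1 h2 <;> first | omega | simp
  simp only [e, Finset.sum_add_distrib, Finset.sum_ite_eq']
  have : 0 ≤ R ^ 2 := sq_nonneg R
  split_ifs <;> nlinarith

/-- The excess loss with uniform attention decays along the training trajectory. -/
lemma excess_loss_train_le {d L₀ : ℕ} (hL : 1 ≤ L₀) (hd : 2 * (2 * L₀ - 1) ≤ d) {lam η x g : ℝ}
    {t₀ t : ℕ} (hη : 0 < η) (hx : 0 < x) (hlam : lam = x ^ 3) (hlam16 : 16 ≤ lam)
    (hN : η * ((2 * L₀ - 1 : ℕ) : ℝ) ≤ 1 / 4)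
    (ht₀ : η * ((2 * L₀ - 1 : ℕ) : ℝ) * t₀ ≤ 1 / 3)
    (hg : 1 ≤ g) (hgt : g ^ 4 = η * t) (ht : η * ((2 * L₀ - 1 : ℕ) : ℝ) * t ≤ x ^ 2) :
    lossParity d L₀ lam (train d L₀ lam η t₀ t).1 0 -
      ((2 * L₀ - 1 - 1 : ℕ) : ℝ) * Real.log 2 ≤ 2400 * ((2 * L₀ - 1 : ℕ) : ℝ) ^ 4 / g ^ 2 := by
  set N := 2 * L₀ - 1 with hNdef
  have hN1 : (1 : ℝ) ≤ N := by exact_mod_cast (by omega : 1 ≤ N)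
  have hg0 : 0 < g := by linarith
  have hlam0 : 0 < lam := by linarith
  have htpos : 0 < t := by
    rcases Nat.eq_zero_or_pos t with h | h
    · rw [h] at hgt; simp at hgt; exact absurd hgt hg0.ne'
    · exact h
  have hxg : g ^ 2 ≤ x := by
    refine le_of_sq_le_sq ?_ hx.le
    calc (g ^ 2) ^ 2 = 1 * (η * t) := by rw [← hgt]; ring
      _ ≤ N * (η * t) := by gcongr
      _ = η * N * t := by ring
      _ ≤ x ^ 2 := ht
  -- The time limit `ηNt ≤ x²` gives `g² ≤ x`. With `‖u‖ ≤ N g²` and `‖W‖ ≤ 4`, the gradient error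
  -- is then of order `N²/g⁴`.
  have hlamg : g ^ 6 ≤ lam := by
    rw [hlam, show g ^ 6 = (g ^ 2) ^ 3 by ring]
    gcongr
  -- At height `R = log(ηt)` the comparison point has excess loss at most `1/(ηt)`, while its
  -- squared norm is only logarithmic in `ηt`.
  set R := Real.log (g ^ 4) with hR
  have hR0 : 0 ≤ R := Real.log_nonneg (one_le_pow₀ hg)
  have hRg : R ≤ 4 * g := by
    rw [hR, Real.log_pow]
    have := Real.log_le_sub_one_of_pos hg0
    push_cast
    linarith
  set z := linVec d N (compareDir R) with hz
  have hzn : ‖z‖ ≤ 2 * R := norm_compareDir_le hd hR0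
  have hFz : lossParity d L₀ lam z 0 - ((N - 1 : ℕ) : ℝ) * Real.log 2 ≤ 1 / g ^ 4 := by
    rw [hz, lossParity_linVec_zero hL hd]
    simp only [prefixSum_compareDir, zero_div, neg_zero, logistic_zero, Finset.sum_const,
      Finset.card_range, nsmul_eq_mul, compareDir, if_true]
    have h1 : logistic R ≤ 1 / g ^ 4 := by
      unfold logistic
      have h2 := Real.log_le_sub_one_of_pos (show 0 < 1 + Real.exp (-R) by positivity)
      have h3 : Real.exp (-R) = 1 / g ^ 4 := by
        rw [Real.exp_neg, hR, Real.exp_log (by positivity), one_div]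
      linarith
    linarith
  set u : ℕ → Vec d := fun s => (train d L₀ lam η t₀ s).1 with hu
  set Wt : ℕ → Mat d := fun s => (train d L₀ lam η t₀ s).2 with hWt
  have hsub : ∀ s ≤ t, η * N * s ≤ η * N * t := fun s hs => by gcongr
  have hun : ∀ s < t, ‖u s‖ ≤ N * g ^ 2 := by
    intro s hs
    refine norm_train_fst_le hη (by linarith) (by positivity) ?_
    calc η * N * s ≤ η * N * t := hsub s hs.le
      _ = N * g ^ 4 := by rw [hgt]; ring
      _ ≤ N * N * g ^ 4 := by
          gcongr
          exact le_mul_of_one_le_left (by positivity) hN1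
      _ = _ := by ring
  have hWn : ∀ s < t, ‖Wt s‖ ≤ 4 := by
    have h0 : ‖Wt t₀‖ ≤ 1 := by
      refine (norm_train_snd_le_of_le hη hlam0 ht₀ (by linarith) (by omega)).trans ?_
      linarith
    intro s hs
    rcases le_total s t₀ with hle | hle
    · refine (norm_train_snd_le_of_le hη hlam0 ht₀ (by linarith) (by omega)).trans ?_
      have : η * N * s ≤ η * N * t₀ := by gcongr
      linarith
    · have h1 := norm_train_snd_sub_le (d := d) hη hx hlam ht₀ (by linarith) hle
        ((hsub s hs.le).trans ht)
      have h2 := norm_le_norm_add_norm_sub' (Wt s) (Wt t₀)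
      linarith
  set e : ℕ → Vec d := fun s => gradU d L₀ lam (u s) (Wt s) - gradU d L₀ lam (u s) 0 with he
  have hstep : ∀ s, u (s + 1) = u s - η • (gradU d L₀ lam (u s) 0 + e s) := by
    intro s
    simp only [hu, he, hWt, add_sub_cancel]
    exact train_succ_fst d L₀ lam η t₀ s
  have hen : ∀ s < t, ‖e s‖ ≤ 32 * N ^ 2 / g ^ 4 := by
    intro s hs
    have h1 : ‖Wt s‖ / lam ≤ 4 / g ^ 6 :=
      div_le_div₀ (by norm_num) (hWn s hs) (by positivity) hlamg
    have h2 : ‖Wt s‖ / lam ≤ 1 / 4 := by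
      rw [div_le_iff₀ hlam0]
      linarith [hWn s hs]
    have h3 := hun s hs
    have h4 : 1 + ‖u s‖ ≤ 2 * N * g ^ 2 := by
      have : 1 ≤ N * g ^ 2 := one_le_mul_of_one_le_of_one_le hN1 (one_le_pow₀ hg)
      linarith
    refine (norm_gradU_sub_zero_le hlam0 h2).trans ?_
    calc _ ≤ N * (4 * (4 / g ^ 6) * (2 * N * g ^ 2)) := by gcongr
      _ = _ := by field_simp; norm_num
  have hDn : ∀ s < t, ‖u s - z‖ ≤ 9 * N * g ^ 2 := by
    intro s hs
    have h3 := hun s hs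
    have h1 := norm_sub_le (u s) z
    have h2 : g ≤ N * g ^ 2 := by
      calc g = 1 * (g * 1) := by ring
        _ ≤ N * (g * g) := by gcongr
        _ = _ := by ring
    linarith
  have hmain := inexact_gradient_descent (F := fun u => lossParity d L₀ lam u 0)
    (g := fun u => gradU d L₀ lam u 0) (M := N) (fun a b => lossParity_convex a b 0)
    (fun a b => norm_gradU_sub_le) hη hN (u := u) (e := e) rfl hstep htpos (z := z) hen hDn
  rw [← hgt] at hmain
  have hη1 : η ≤ g ^ 4 := by
    have : η * 1 ≤ η * N := by gcongr
    have : 1 ≤ g ^ 4 := one_le_pow₀ hg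
    linarith
  have t1 : ‖z‖ ^ 2 / (2 * g ^ 4) ≤ 32 / g ^ 2 := by
    calc ‖z‖ ^ 2 / (2 * g ^ 4) ≤ (2 * (4 * g)) ^ 2 / (2 * g ^ 4) := by
          gcongr
          linarith
      _ = _ := by field_simp; norm_num
  have t2 : 32 * N ^ 2 / g ^ 4 * (9 * N * g ^ 2) = 288 * (N : ℝ) ^ 3 / g ^ 2 := by
    field_simp; norm_num
  have t4 : g ^ 4 * (32 * N ^ 2 / g ^ 4) ^ 2 ≤ 1024 * (N : ℝ) ^ 4 / g ^ 2 := by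
    calc g ^ 4 * (32 * N ^ 2 / g ^ 4) ^ 2 = 1024 * (N : ℝ) ^ 4 / g ^ 4 := by field_simp; norm_num
      _ ≤ _ := by
        gcongr
        norm_num
  have t3 : η * (32 * N ^ 2 / g ^ 4) ^ 2 ≤ g ^ 4 * (32 * N ^ 2 / g ^ 4) ^ 2 := by gcongr
  have t5 : 1 / g ^ 4 ≤ 1 / g ^ 2 := by
    gcongr
    norm_num
  have t6 : 33 / g ^ 2 ≤ 33 * (N : ℝ) ^ 4 / g ^ 2 := by
    gcongr
    exact le_mul_of_one_le_right (by norm_num) (one_le_pow₀ hN1)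
  have t7 : 288 * (N : ℝ) ^ 3 / g ^ 2 ≤ 288 * (N : ℝ) ^ 4 / g ^ 2 := by
    gcongr
    norm_num
  have t8 : 2400 * (N : ℝ) ^ 4 / g ^ 2 = 33 * (N : ℝ) ^ 4 / g ^ 2 + 288 * (N : ℝ) ^ 4 / g ^ 2 +
      1024 * (N : ℝ) ^ 4 / g ^ 2 + 1024 * (N : ℝ) ^ 4 / g ^ 2 + 31 * (N : ℝ) ^ 4 / g ^ 2 := by ring
  have t9 : (33 : ℝ) / g ^ 2 = 32 / g ^ 2 + 1 / g ^ 2 := by ring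
  have t10 : 0 ≤ 31 * (N : ℝ) ^ 4 / g ^ 2 := by positivity
  rw [t2] at hmain
  linarith

/-! ### Alignment of the two directions and conclusion. -/

lemma inner_normalize_ge {E : Type*} [NormedAddCommGroup E] [InnerProductSpace ℝ E] {x y : E}
    (hx : x ≠ 0) (hy : y ≠ 0) {c : ℝ} (h : ‖(1 / ‖x‖) • x - (1 / ‖y‖) • y‖ ≤ |c|) :
    1 - 1 / 2 * c ^ 2 ≤ inner ℝ ((1 / ‖x‖) • x) ((1 / ‖y‖) • y) := by
  have h1 : ∀ z : E, z ≠ 0 → ‖(1 / ‖z‖) • z‖ = 1 := by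
    intro z hz
    have := norm_pos_iff.2 hz
    rw [norm_smul, Real.norm_of_nonneg (by positivity)]
    field_simp
  have h2 := norm_sub_sq_real ((1 / ‖x‖) • x) ((1 / ‖y‖) • y)
  rw [h1 x hx, h1 y hy] at h2
  have h3 : ‖(1 / ‖x‖) • x - (1 / ‖y‖) • y‖ ^ 2 ≤ c ^ 2 := by
    rw [← sq_abs c]
    gcongr
  linarith

lemma norm_normalize_sub_le {E : Type*} [NormedAddCommGroup E] [InnerProductSpace ℝ E] {x q : E}
    (hx : x ≠ 0) {ρ : ℝ} (h : ‖x - ‖x‖ • q‖ ≤ ρ * ‖x‖) : ‖(1 / ‖x‖) • x - q‖ ≤ ρ := by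
  have hpos := norm_pos_iff.2 hx
  have e : (1 / ‖x‖) • x - q = (1 / ‖x‖) • (x - ‖x‖ • q) := by
    rw [smul_sub, smul_smul, one_div, inv_mul_cancel₀ hpos.ne', one_smul]
  rw [e, norm_smul, Real.norm_of_nonneg (by positivity), one_div, inv_mul_le_iff₀ hpos]
  linarith

section Final

variable {d L₀ : ℕ} {lam η : ℝ} {t₀ : ℕ}

lemma nearUniform_redTrain (hd : 2 * (2 * L₀ - 1) ≤ d) (hlam : 16 ≤ lam) (hη : 0 < η)
    (hN : η * ((2 * L₀ - 1 : ℕ) : ℝ) ≤ 1 / 64)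
    (ht₀ : η * ((2 * L₀ - 1 : ℕ) : ℝ) * t₀ ≤ 1 / 64) {t : ℕ} (ht : t ≤ t₀) :
    NearUniform lam (redTrain L₀ lam η t₀ t).2 (2 * L₀ - 1) (4 / lam) := by
  have hlam0 : 0 < lam := by linarith
  have hW : ‖(train d L₀ lam η t₀ t).2‖ ≤ 1 := by
    refine (norm_train_snd_le_of_le hη hlam0 (by linarith) (by linarith) (by omega)).trans ?_
    have : η * ((2 * L₀ - 1 : ℕ) : ℝ) * t ≤ η * ((2 * L₀ - 1 : ℕ) : ℝ) * t₀ := by gcongr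
    linarith
  have h1 : ‖(train d L₀ lam η t₀ t).2‖ / lam ≤ 1 / lam := by gcongr
  have h2 : 1 / lam ≤ 1 / 4 := by
    rw [div_le_div_iff₀ hlam0 (by norm_num)]; linarith
  refine ((isReduced_train lam η t₀ hd t).nearUniform hlam0 (h1.trans h2)).mono ?_
  have e : 4 / lam = 4 * (1 / lam) := by ring
  rw [e]
  gcongr

lemma exists_maxMargin_train (hL : 1 ≤ L₀) (hd : 2 * (2 * L₀ - 1) ≤ d)
    (hlam : 256 * ((2 * L₀ - 1 : ℕ) : ℝ) ^ 2 ≤ lam) (hη : 0 < η)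
    (hN : η * ((2 * L₀ - 1 : ℕ) : ℝ) ≤ 1 / 64) (h2 : 2 ≤ t₀)
    (ht₀ : η * ((2 * L₀ - 1 : ℕ) : ℝ) * t₀ ≤ 1 / 64) :
    ∃ w : ℕ → ℝ, IsMaxMargin L₀ lam (train d L₀ lam η t₀ t₀).2 (linVec d (2 * L₀ - 1) w) := by
  have hN1 : (1 : ℝ) ≤ ((2 * L₀ - 1 : ℕ) : ℝ) := by exact_mod_cast (by omega : 1 ≤ 2 * L₀ - 1)
  have hlam16 : 16 ≤ lam := by nlinarith
  have hlam0 : 0 < lam := by linarith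
  refine (isReduced_train lam η t₀ hd t₀).exists_isMaxMargin_linVec hL hd hlam0 ?_
  refine scoresSeparate_redTrain hL hη hlam0 (δ := 4 / lam) (by positivity) ?_ ht₀ h2
    fun t ht => nearUniform_redTrain hd hlam16 hη hN ht₀ ht
  -- With `δ = 4 / lam`, the requirement `δ N² ≤ 1/64` is exactly `lam ≥ 256 N²`, the source of the
  -- constant `Clam`.
  rw [div_mul_eq_mul_div, div_le_div_iff₀ hlam0 (by norm_num)]
  linarith

lemma IsMaxMargin.le_out {W : Mat d} {u : Vec d} {v w : ℕ → ℝ} {S : ℕ → ℕ → Bool → ℝ}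
    (hd : 2 * (2 * L₀ - 1) ≤ d) (hr : IsReduced d L₀ u W v S)
    (h : IsMaxMargin L₀ lam W (linVec d (2 * L₀ - 1) w)) {m : ℕ} (h0 : m ≠ 0)
    (hm : m < 2 * L₀ - 1) (y : Bool) : 1 ≤ sgn y * out lam w S m y := by
  obtain ⟨X, rfl⟩ := exists_agree_eq hm h0 y
  have := h.1 m hm X
  rwa [inner_label_smul_attnOut, transformer_linVec hd hm w (hr.score m hm X)] at this

lemma IsMaxMargin.one_le {W : Mat d} {u : Vec d} {v w : ℕ → ℝ} {S : ℕ → ℕ → Bool → ℝ}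
    (hL : 1 ≤ L₀) (hd : 2 * (2 * L₀ - 1) ≤ d) (hr : IsReduced d L₀ u W v S)
    (h : IsMaxMargin L₀ lam W (linVec d (2 * L₀ - 1) w)) : 1 ≤ w 0 := by
  have hm : 0 < 2 * L₀ - 1 := by omega
  have := h.1 0 hm (fun _ => true)
  rwa [inner_label_smul_attnOut, transformer_linVec hd hm w (hr.score 0 hm _), agree_zero,
    out_zero, sgn_true, one_mul] at this

lemma train_late {x g : ℝ} (hL : 1 ≤ L₀) (hd : 2 * (2 * L₀ - 1) ≤ d) (hη : 0 < η) (hx : 0 < x)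
    (hlam : lam = x ^ 3) (hlam16 : 16 ≤ lam) (hN : η * ((2 * L₀ - 1 : ℕ) : ℝ) ≤ 1 / 64)
    (ht₀ : η * ((2 * L₀ - 1 : ℕ) : ℝ) * t₀ ≤ 1 / 64) {t : ℕ} (hgt : g ^ 4 = η * t)
    (hg : 40000 * ((2 * L₀ - 1 : ℕ) : ℝ) ^ 4 ≤ g)
    (ht : η * ((2 * L₀ - 1 : ℕ) : ℝ) * t ≤ x ^ 2) :
    Real.log g ≤ (redTrain L₀ lam η t₀ t).1 0 ∧ ∀ m, m ≠ 0 → m < 2 * L₀ - 1 →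
      |prefixSum (redTrain L₀ lam η t₀ t).1 m| ≤ 1 / (40 * ((2 * L₀ - 1 : ℕ) : ℝ)) := by
  have hN1 : (1 : ℝ) ≤ ((2 * L₀ - 1 : ℕ) : ℝ) := by exact_mod_cast (by omega : 1 ≤ 2 * L₀ - 1)
  have hloss := excess_loss_train_le (t₀ := t₀) (t := t) (g := g) hL hd hη hx hlam hlam16
    (by linarith) (by linarith)
    (le_trans (one_le_mul_of_one_le_of_one_le (by norm_num) (one_le_pow₀ hN1)) hg) hgt ht
  rw [(isReduced_train lam η t₀ hd t).lin] at hloss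
  set N := ((2 * L₀ - 1 : ℕ) : ℝ) with hNd
  have hN4 : 1 ≤ N ^ 4 := one_le_pow₀ hN1
  have hg1 : 40000 ≤ g := by linarith
  have hg0 : 0 < g := by linarith
  -- One factor `g` absorbs `N⁴` through `g ≥ 40000 N⁴`; the other is kept for the logarithmic
  -- growth of `v 0`.
  have hΔ : 2400 * N ^ 4 / g ^ 2 ≤ 3 / (50 * g) := by
    rw [div_le_div_iff₀ (by positivity) (by positivity)]
    nlinarith
  have hg2 : 3 / (50 * g) ≤ 1 / 2 := by
    rw [div_le_div_iff₀ (by positivity) (by norm_num)]; linarith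
  obtain ⟨h1, h2⟩ := of_excess_loss_le hL hd (by positivity) (hΔ.trans hg2) hloss
  refine ⟨?_, fun m h0 hm => ?_⟩
  · have h3 : Real.exp (-(redTrain L₀ lam η t₀ t).1 0) ≤ g⁻¹ := by
      refine h1.trans ?_
      calc 2 * (2400 * N ^ 4 / g ^ 2) ≤ 2 * (3 / (50 * g)) := by gcongr
        _ = 3 / 25 * g⁻¹ := by field_simp; norm_num
        _ ≤ 1 * g⁻¹ := by gcongr; norm_num
        _ = _ := one_mul _
    rw [← Real.le_log_iff_exp_le (by positivity), Real.log_inv] at h3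
    linarith
  · refine abs_le_of_sq_le_sq ?_ (by positivity)
    refine (h2 m h0 hm).trans ?_
    have hgg : (40000 * N ^ 4) * (40000 * N ^ 4) ≤ g ^ 2 := by
      rw [sq]
      gcongr
    rw [div_pow, one_pow, ← mul_div_assoc, ← mul_div_assoc, div_le_div_iff₀ (by positivity) (by positivity)]
    have e : N ^ 2 * (32 * (2400 * N ^ 4)) * (40 * N) ^ 2 = 122880000 * (N ^ 4 * N ^ 4) := by ring
    rw [e]
    have h5 : 0 ≤ N ^ 4 * N ^ 4 := by positivity
    linarith

/-- Alignment with the max-margin direction for at least two positions. -/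
lemma alignment_of_two_le {x g : ℝ} {w : ℕ → ℝ} (hL : 2 ≤ L₀) (hd : 2 * (2 * L₀ - 1) ≤ d)
    (hη : 0 < η) (hx : 0 < x) (hlam : lam = x ^ 3) (hlam16 : 16 ≤ lam)
    (hN : η * ((2 * L₀ - 1 : ℕ) : ℝ) ≤ 1 / 64)
    (ht₀ : η * ((2 * L₀ - 1 : ℕ) : ℝ) * t₀ ≤ 1 / 64) {t : ℕ} (hgt : g ^ 4 = η * t)
    (hg : 40000 * ((2 * L₀ - 1 : ℕ) : ℝ) ^ 4 ≤ g)
    (ht : η * ((2 * L₀ - 1 : ℕ) : ℝ) * t ≤ x ^ 2)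
    (hw : IsMaxMargin L₀ lam (train d L₀ lam η t₀ t₀).2 (linVec d (2 * L₀ - 1) w)) :
    1 - 1 / 2 * (1 / (6 * ‖linVec d (2 * L₀ - 1) w‖) - 1 / ‖(train d L₀ lam η t₀ t).1‖) ^ 2 ≤
      inner ℝ ((1 / ‖(train d L₀ lam η t₀ t).1‖) • (train d L₀ lam η t₀ t).1)
        ((1 / ‖linVec d (2 * L₀ - 1) w‖) • linVec d (2 * L₀ - 1) w) := by
  have hlam0 : 0 < lam := by linarith
  obtain ⟨hv0, hpre⟩ := train_late (by omega) hd hη hx hlam hlam16 hN ht₀ hgt hg ht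
  have hred := isReduced_train lam η t₀ hd t
  have hred0 := isReduced_train lam η t₀ hd t₀
  have hwo := hw.one_le (by omega) hd hred0
  have hu1 : ‖(train d L₀ lam η t₀ t).1‖ ≤ x := norm_train_fst_le hη (by linarith) hx.le ht
  obtain ⟨hb1, hb2⟩ := (nearUniform_redTrain hd hlam16 hη hN ht₀ le_rfl).margin_bounds hd
    (by omega) (by linarith) fun m h0 hm y => hw.le_out hd hred0 h0 hm y
  rw [hred.lin] at hu1 ⊢
  set v := (redTrain L₀ lam η t₀ t).1 with hv
  set u := linVec d (2 * L₀ - 1) v with hu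
  set us := linVec d (2 * L₀ - 1) w with hus
  have hN1 : (1 : ℝ) ≤ ((2 * L₀ - 1 : ℕ) : ℝ) := by exact_mod_cast (by omega : 1 ≤ 2 * L₀ - 1)
  have hN4 : 1 ≤ ((2 * L₀ - 1 : ℕ) : ℝ) ^ 4 := one_le_pow₀ hN1
  have hg1 : 40000 ≤ g := by linarith
  have hlogg : 0 < Real.log g := Real.log_pos (by linarith)
  have hvu : |v 0| ≤ ‖u‖ := abs_le_norm_linVec hd v (by omega)
  have hwu : |w 0| ≤ ‖us‖ := abs_le_norm_linVec hd w (by omega)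
  have ha : 0 < ‖u‖ := lt_of_lt_of_le (by linarith [le_abs_self (v 0)]) hvu
  have hb : 0 < ‖us‖ := lt_of_lt_of_le (by linarith [le_abs_self (w 0)]) hwu
  have hxg : g ^ 2 ≤ x := by
    refine le_of_sq_le_sq ?_ hx.le
    calc (g ^ 2) ^ 2 = 1 * (η * t) := by rw [← hgt]; ring
      _ ≤ ((2 * L₀ - 1 : ℕ) : ℝ) * (η * t) := by gcongr
      _ = η * ((2 * L₀ - 1 : ℕ) : ℝ) * t := by ring
      _ ≤ x ^ 2 := ht
  have hq1 := norm_sub_limitDir_le hd (by omega) (by linarith) hpre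
  set q := linVec d (2 * L₀ - 1) limitDir with hq
  set N := ((2 * L₀ - 1 : ℕ) : ℝ) with hNd
  -- The prefix-sum bound `1/(40N)` was chosen so that `10 N` times it equals `1/4`.
  have hd1 : ‖(1 / ‖u‖) • u - q‖ ≤ 1 / 4 * (1 / ‖u‖) := by
    refine norm_normalize_sub_le (norm_pos_iff.1 ha) (hq1.trans (le_of_eq ?_))
    field_simp
    norm_num
  have hd2 : ‖(1 / ‖us‖) • us - q‖ ≤ 40 * N ^ 2 / lam := by
    refine norm_normalize_sub_le (norm_pos_iff.1 hb) (hb2.trans (le_of_eq ?_))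
    field_simp
    norm_num
  have hxx : 160 * N ^ 2 ≤ x ^ 2 := by
    have h4 : N ^ 2 ≤ N ^ 4 := pow_le_pow_right₀ hN1 (by norm_num)
    have h3 : g ≤ g ^ 2 := le_self_pow₀ (by linarith) two_ne_zero
    have h5 : x ≤ x ^ 2 := le_self_pow₀ (by linarith) two_ne_zero
    linarith
  have h1a : 1 / x ≤ 1 / ‖u‖ := by gcongr
  have hd2' : 40 * N ^ 2 / lam ≤ 1 / 4 * (1 / ‖u‖) := by
    refine le_trans ?_ (mul_le_mul_of_nonneg_left h1a (by norm_num))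
    have e : 40 * N ^ 2 / lam = 40 * N ^ 2 / x ^ 2 * (1 / x) := by
      rw [hlam]; field_simp
    have h5 : 40 * N ^ 2 / x ^ 2 ≤ 1 / 4 := by
      rw [div_le_iff₀ (by positivity)]; linarith
    rw [e]
    gcongr
  -- Here `‖us‖ ≥ lam / 4` with `lam = x³`, while `‖u‖ ≤ x`.
  have hb3 : 1 / (6 * ‖us‖) ≤ 1 / 2 * (1 / ‖u‖) := by
    have h5 : 1 / ‖us‖ ≤ 4 / lam := by
      rw [div_le_div_iff₀ hb hlam0]
      rw [div_mul_eq_mul_div, le_div_iff₀ hlam0] at hb1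
      linarith
    have h6 : 4 / lam ≤ 1 / x := by
      have h7 : 1 ≤ N ^ 2 := one_le_pow₀ hN1
      have e : 4 / lam = 4 / x ^ 2 * (1 / x) := by rw [hlam]; field_simp
      have h8 : 4 / x ^ 2 ≤ 1 := by
        rw [div_le_one (by positivity)]; linarith
      rw [e]
      exact mul_le_of_le_one_left (by positivity) h8
    have e : 1 / (6 * ‖us‖) = 1 / 6 * (1 / ‖us‖) := by field_simp
    have : 0 ≤ 1 / ‖u‖ := by positivity
    rw [e]
    linarith
  refine inner_normalize_ge (norm_pos_iff.1 ha) (norm_pos_iff.1 hb) ?_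
  -- The quantity squared in the theorem is negative: its absolute value is at least `1/(2‖u‖)`, the
  -- sum of the two distances `1/(4‖u‖)` to the limit direction.
  rw [abs_sub_comm, abs_of_nonneg]
  · have h7 := norm_sub_le_norm_sub_add_norm_sub ((1 / ‖u‖) • u) q ((1 / ‖us‖) • us)
    rw [norm_sub_rev q] at h7
    linarith
  · have : 0 ≤ 1 / ‖u‖ := by positivity
    linarith

/-- With a single position the two directions coincide. -/
lemma alignment_of_one {d : ℕ} (hd : 2 * 1 ≤ d) {v w : ℕ → ℝ} (hv : 0 < v 0) (hw : 0 < w 0)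
    (c : ℝ) : 1 - 1 / 2 * c ^ 2 ≤
      inner ℝ ((1 / ‖linVec d 1 v‖) • linVec d 1 v) ((1 / ‖linVec d 1 w‖) • linVec d 1 w) := by
  have hne : ∀ z : ℕ → ℝ, 0 < z 0 → linVec d 1 z ≠ 0 := by
    intro z hz h
    have := abs_le_norm_linVec hd z one_pos
    rw [h, norm_zero] at this
    linarith [le_abs_self (z 0)]
  have hlin : ∀ z : ℕ → ℝ, 0 < z 0 →
      (1 / ‖linVec d 1 z‖) • linVec d 1 z = (1 / ‖pairVec d 0‖) • pairVec d 0 := by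
    intro z hz
    have e : linVec d 1 z = z 0 • pairVec d 0 := by simp [linVec]
    rw [e, norm_smul, Real.norm_of_nonneg hz.le, smul_smul]
    congr 1
    field_simp
  refine inner_normalize_ge (hne v hv) (hne w hw) ?_
  rw [hlin v hv, hlin w hw, sub_self, norm_zero]
  exact abs_nonneg c

end Final

end ParityCoT

theorem theorem5 :
    -- absolute constants
    ∃ Clam c₀ cT CT CW : ℝ, 0 < Clam ∧ 0 < c₀ ∧ 0 < cT ∧ cT ≤ CT ∧ 0 < CW ∧
    ∀ ε : ℝ, 0 < ε →
    -- the constant of the logarithmic lower bound depends on `ε` only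
    ∃ cu : ℝ, 0 < cu ∧
    ∀ L₀ : ℕ, 1 ≤ L₀ →
    -- the constant that bounds `t₂` depends on `ε` and `L₀` only
    ∃ K : ℝ, 0 < K ∧
    ∀ (d : ℕ) (lam η : ℝ) (t₀ : ℕ),
      2 * (2 * L₀ - 1) ≤ d →
      Clam * ((2 * L₀ - 1 : ℕ) : ℝ) ^ 2 ≤ lam →
      0 < η →
      2 ≤ t₀ →
      (t₀ : ℝ) ≤ c₀ / (η * ((2 * L₀ - 1 : ℕ) : ℝ)) →
      -- the max-margin solution for the attention outputs at time `t₀` exists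
      ∃ uStar : Vec d, IsMaxMargin L₀ lam (train d L₀ lam η t₀ t₀).2 uStar ∧
      ∃ t₂ T : ℝ,
        1 ≤ t₂ ∧ t₂ ≤ K * η ^ (-(1 + ε)) ∧
        cT * (lam ^ (2 / 3 : ℝ) / (η * ((2 * L₀ - 1 : ℕ) : ℝ))) ≤ T ∧
        T ≤ CT * (lam ^ (2 / 3 : ℝ) / (η * ((2 * L₀ - 1 : ℕ) : ℝ))) ∧
        ∀ t : ℕ, t₂ ≤ (t : ℝ) → (t : ℝ) ≤ T →
          cu * Real.log t ≤ ‖(train d L₀ lam η t₀ t).1‖ ∧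
          1 - 1 / 2 * (1 / (6 * ‖uStar‖) - 1 / ‖(train d L₀ lam η t₀ t).1‖) ^ 2 ≤
            inner ℝ ((1 / ‖(train d L₀ lam η t₀ t).1‖) • (train d L₀ lam η t₀ t).1)
              ((1 / ‖uStar‖) • uStar) ∧
          ‖(train d L₀ lam η t₀ t).2 - (train d L₀ lam η t₀ t₀).2‖ ≤ CW := by
  refine ⟨256, 1 / 64, 1, 1, 3, by norm_num, by norm_num, by norm_num, le_rfl, by norm_num, ?_⟩
  intro ε hε
  -- From `ηt ≥ η^(-ε)` follows `log(ηt) ≥ ε/(1+ε) · log t`; the factor `1/4` comes from `g =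
  -- (ηt)^(1/4)`.
  refine ⟨ε / (4 * (1 + ε)), by positivity, ?_⟩
  intro L₀ hL
  have hN1 : (1 : ℝ) ≤ ((2 * L₀ - 1 : ℕ) : ℝ) := by exact_mod_cast (by omega : 1 ≤ 2 * L₀ - 1)
  -- Chosen so that `ηt ≥ K` is the threshold `g ≥ 40000 N⁴` of `train_late`.
  set K := (40000 * ((2 * L₀ - 1 : ℕ) : ℝ) ^ 4) ^ 4 with hK
  have hKb : 1 ≤ 40000 * ((2 * L₀ - 1 : ℕ) : ℝ) ^ 4 :=
    one_le_mul_of_one_le_of_one_le (by norm_num) (one_le_pow₀ hN1)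
  have hK1 : 1 ≤ K := one_le_pow₀ hKb
  refine ⟨K, by linarith, ?_⟩
  intro d lam η t₀ hd hlam hη h2 ht₀
  have hηN : 0 < η * ((2 * L₀ - 1 : ℕ) : ℝ) := by positivity
  have hT0 : η * ((2 * L₀ - 1 : ℕ) : ℝ) * t₀ ≤ 1 / 64 := by
    rw [le_div_iff₀ hηN] at ht₀
    linarith
  have hNs : η * ((2 * L₀ - 1 : ℕ) : ℝ) ≤ 1 / 64 := by
    refine le_trans ?_ hT0
    have : (1 : ℝ) ≤ t₀ := by exact_mod_cast (by omega : 1 ≤ t₀)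
    exact le_mul_of_one_le_right hηN.le this
  have hη1 : η ≤ 1 := by
    have := le_mul_of_one_le_right hη.le hN1
    linarith
  have hlam16 : 16 ≤ lam := by nlinarith
  have hlam0 : 0 < lam := by linarith
  obtain ⟨w, hw⟩ := exists_maxMargin_train hL hd hlam hη hNs h2 hT0
  refine ⟨_, hw, K * η ^ (-(1 + ε)), lam ^ (2 / 3 : ℝ) / (η * ((2 * L₀ - 1 : ℕ) : ℝ)), ?_, le_rfl,
    by rw [one_mul], by rw [one_mul], ?_⟩
  · have : 1 ≤ η ^ (-(1 + ε)) := Real.one_le_rpow_of_pos_of_le_one_of_nonpos hη hη1 (by linarith)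
    exact one_le_mul_of_one_le_of_one_le hK1 this
  intro t ht2 htT
  set x := lam ^ (1 / 3 : ℝ) with hx
  have hx0 : 0 < x := by positivity
  have hx3 : lam = x ^ 3 := by
    rw [hx, ← Real.rpow_natCast, ← Real.rpow_mul hlam0.le]
    norm_num
  have hx2 : lam ^ (2 / 3 : ℝ) = x ^ 2 := by
    rw [hx, ← Real.rpow_natCast, ← Real.rpow_mul hlam0.le]
    norm_num
  rw [hx2, le_div_iff₀ hηN] at htT
  have htx : η * ((2 * L₀ - 1 : ℕ) : ℝ) * t ≤ x ^ 2 := by linarith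
  have hpow : η * η ^ (-(1 + ε)) = η ^ (-ε) := by
    nth_rewrite 1 [← Real.rpow_one η]
    rw [← Real.rpow_add hη]
    congr 1
    ring
  have hτ : K * η ^ (-ε) ≤ η * t := by
    rw [← hpow]
    have := mul_le_mul_of_nonneg_left ht2 hη.le
    linarith
  have hηε : 1 ≤ η ^ (-ε) :=
    Real.one_le_rpow_of_pos_of_le_one_of_nonpos hη hη1 (by linarith)
  have hτK : K ≤ η * t := le_trans (le_mul_of_one_le_right (by linarith) hηε) hτ
  have hτ0 : 0 < η * t := by linarith
  have htt : t₀ ≤ t := by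
    have h3 : η * t₀ ≤ η * t := by
      have h4 : η * t₀ ≤ η * ((2 * L₀ - 1 : ℕ) : ℝ) * t₀ := by
        gcongr
        exact le_mul_of_one_le_right hη.le hN1
      linarith
    exact_mod_cast le_of_mul_le_mul_left h3 hη
  set g := (η * t) ^ (1 / 4 : ℝ) with hg
  have hg0 : 0 < g := by positivity
  have hg4 : g ^ 4 = η * t := by
    rw [hg, ← Real.rpow_natCast, ← Real.rpow_mul hτ0.le]
    norm_num
  have hgK : 40000 * ((2 * L₀ - 1 : ℕ) : ℝ) ^ 4 ≤ g := by
    refine le_of_pow_le_pow_left₀ four_ne_zero hg0.le ?_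
    rw [hg4]
    exact hτK
  obtain ⟨hv0, _⟩ := train_late (t₀ := t₀) hL hd hη hx0 hx3 hlam16 hNs hT0 hg4 hgK htx
  have hred := isReduced_train lam η t₀ hd t
  refine ⟨?_, ?_, norm_train_snd_sub_le hη hx0 hx3 (by linarith) (by linarith) htt htx⟩
  · have h3 : |(redTrain L₀ lam η t₀ t).1 0| ≤ ‖(train d L₀ lam η t₀ t).1‖ := by
      rw [hred.lin]
      exact abs_le_norm_linVec hd _ (by omega)
    refine le_trans ?_ (hv0.trans ((le_abs_self _).trans h3))
    have ht0 : (0 : ℝ) < t := by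
      have : (t₀ : ℝ) ≤ t := by exact_mod_cast htt
      have : (2 : ℝ) ≤ t₀ := by exact_mod_cast h2
      linarith
    have hlogg : Real.log g = (Real.log η + Real.log t) / 4 := by
      rw [hg, Real.log_rpow hτ0, Real.log_mul hη.ne' ht0.ne']
      ring
    have hlogη : -ε * Real.log η ≤ Real.log η + Real.log t := by
      rw [← Real.log_rpow hη, ← Real.log_mul hη.ne' ht0.ne']
      refine Real.log_le_log (by positivity) (le_trans ?_ hτ)
      exact le_mul_of_one_le_left (by positivity) hK1
    rw [hlogg, div_mul_eq_mul_div, div_le_div_iff₀ (by positivity) (by norm_num)]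
    nlinarith
  · rcases Nat.lt_or_ge 1 L₀ with h1 | h1
    · exact alignment_of_two_le h1 hd hη hx0 hx3 hlam16 hNs hT0 hg4 hgK htx hw
    · obtain rfl : L₀ = 1 := le_antisymm h1 hL
      have hlogg : 0 < Real.log g := Real.log_pos (by norm_num at hgK; linarith)
      have hw0 := hw.one_le le_rfl hd (isReduced_train lam η t₀ hd t₀)
      rw [hred.lin]
      exact alignment_of_one hd (by linarith) (by linarith) _
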